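/- Let $k$ be an algebraically closed field. Let $Q=(Q_0,Q_1,s,e)$ be a finite connected quiver and let $\mathcal P$ be a set of paths of length two in $Q$ such that $A=kQ/\langle\mathcal P\rangle$ is gentle; that is: (i) at most two arrows start, and at most two arrows end, at each vertex; (ii) for each $\beta\in Q_1$ there is at most one arrow $\alpha$ with $e(\alpha)=s(\beta)$ and $\beta\alpha\notin\mathcal P$, at most one arrow $\alpha$ with $e(\alpha)=s(\beta)$ and $\beta\alpha\in\mathcal P$, at most one arrow $\gamma$ with $s(\gamma)=e(\beta)$ and $\gamma\beta\notin\mathcal P$, and at most one arrow $\gamma$ with $s(\gamma)=e(\beta)$ and $\gamma\beta\in\mathcal P$; (iii) for each $\beta\in Q_1$, all sufficiently long paths that begin with $\beta$, and all sufficiently long paths that end with $\beta$, contain a subpath in $\mathcal P$. Assume that $Q$ is not the Kronecker quiver (two vertices $a\neq b$ and exactly two arrows, both from $a$ to $b$). Put $c(Q)=\#Q_1-\#Q_0+1$. Let $\operatorname{Aut}(A)$ be the group of $k$-algebra automorphisms of $A$, a Zariski closed subgroup of $\operatorname{GL}(A)$, let $\operatorname{Inn}(A)$ be the normal subgroup of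 the automorphisms $a\mapsto x^{-1}ax$ with $x\in A^*$, and let $\operatorname{Out}^o(A)$ be the connected component of the identity in the affine algebraic group $\operatorname{Out}(A)=\operatorname{Aut}(A)/\operatorname{Inn}(A)$. Then $\operatorname{Out}^o(A)$ is isomorphic, as an affine algebraic group, to a closed subgroup of the group of lower triangular invertible $n\times n$ matrices over $k$ for some $n$, and it is a semidirect product $\operatorname{Out}^o(A)=S\ltimes\mathcal U$, where $S$ is a maximal torus of $\operatorname{Out}^o(A)$ with $S\cong(k^*)^{c(Q)}$ as algebraic groups and $\mathcal U$ is a closed normal nilpotent subgroup. -/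

import Mathlib

universe u v w

open Quiver Topology
open scoped MatrixGroups

noncomputable section

/-! ## Paths and the path algebra of a quiver -/

/-- All paths of the quiver `V`: `p.1` is the start and `p.2.1` the end of `p`. -/
abbrev QPath (V : Type u) [Quiver.{v} V] : Type (max u v) :=
  Σ a b : V, Quiver.Path a b

/-- The `k`-module underlying the path algebra: the paths form a basis. -/
def PathAlgebra (k : Type w) [Field k] (V : Type u) [Quiver.{v} V] : Type (max u v w) :=
  QPath V →₀ k

namespace PathAlgebra

variable (k : Type w) [Field k] {V : Type u} [Quiver.{v} V]

instance : AddCommGroup (PathAlgebra k V) := inferInstanceAs (AddCommGroup (QPath V →₀ k))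

instance : Module k (PathAlgebra k V) := inferInstanceAs (Module k (QPath V →₀ k))

/-- The basis element given by a path. -/
def of (p : QPath V) : PathAlgebra k V := Finsupp.single p (1 : k)

open Classical in
/-- The product `q p` of two paths: first `p`, then `q`, and zero if `p` does not end where `q`
starts. -/
def pathMul (q p : QPath V) : PathAlgebra k V :=
  if h : p.2.1 = q.1 then of k ⟨p.1, q.2.1, p.2.2.comp (q.2.2.cast h.symm rfl)⟩ else 0

/-- The bilinear extension of the product of paths. -/
def mulMap : PathAlgebra k V →ₗ[k] PathAlgebra k V →ₗ[k] PathAlgebra k V :=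
  Finsupp.linearCombination k fun q => Finsupp.linearCombination k fun p => pathMul k q p

instance : Mul (PathAlgebra k V) := ⟨fun x y => mulMap k x y⟩

instance [Fintype V] : One (PathAlgebra k V) := ⟨∑ a : V, of k ⟨a, a, Path.nil⟩⟩

variable {k}

theorem mul_eq (x y : PathAlgebra k V) : x * y = mulMap k x y := rfl

theorem one_eq [Fintype V] : (1 : PathAlgebra k V) = ∑ a : V, of k ⟨a, a, Path.nil⟩ := rfl

theorem mulMap_of_of (q p : QPath V) : mulMap k (of k q) (of k p) = pathMul k q p := by
  unfold mulMap of
  erw [Finsupp.linearCombination_single, one_smul, Finsupp.linearCombination_single, one_smul]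

theorem hom_ext {M : Type*} [AddCommMonoid M] [Module k M] {f g : PathAlgebra k V →ₗ[k] M}
    (h : ∀ p, f (of k p) = g (of k p)) : f = g :=
  Finsupp.lhom_ext' fun p => LinearMap.ext_ring (h p)

theorem pathMul_comp {a b c : V} (q : Path b c) (p : Path a b) :
    pathMul k ⟨b, c, q⟩ ⟨a, b, p⟩ = of k ⟨a, c, p.comp q⟩ := by
  simp [pathMul]

theorem pathMul_ne {q p : QPath V} (h : p.2.1 ≠ q.1) : pathMul k q p = 0 := by
  simp [pathMul, h]

theorem mul_assoc_of (r q p : QPath V) :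
    mulMap k (pathMul k r q) (of k p) = mulMap k (of k r) (pathMul k q p) := by
  obtain ⟨a, b, p⟩ := p
  obtain ⟨b', c, q⟩ := q
  obtain ⟨c', d, r⟩ := r
  by_cases h : b = b'
  · subst h
    by_cases h' : c = c'
    · subst h'
      simp only [pathMul_comp, mulMap_of_of, Path.comp_assoc]
    · rw [pathMul_ne (q := ⟨c', d, r⟩) (p := ⟨b, c, q⟩) h', pathMul_comp, mulMap_of_of,
        pathMul_ne (q := ⟨c', d, r⟩) (p := ⟨a, c, p.comp q⟩) h', map_zero, LinearMap.zero_apply]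
  · rw [pathMul_ne (q := ⟨b', c, q⟩) (p := ⟨a, b, p⟩) h, map_zero]
    by_cases h' : c = c'
    · subst h'
      rw [pathMul_comp, mulMap_of_of,
        pathMul_ne (q := ⟨b', d, q.comp r⟩) (p := ⟨a, b, p⟩) h]
    · rw [pathMul_ne (q := ⟨c', d, r⟩) (p := ⟨b', c, q⟩) h', map_zero, LinearMap.zero_apply]

theorem mulMap_assoc (x y z : PathAlgebra k V) :
    mulMap k (mulMap k x y) z = mulMap k x (mulMap k y z) := by
  have h : (LinearMap.llcomp k (PathAlgebra k V) (PathAlgebra k V)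
        (PathAlgebra k V →ₗ[k] PathAlgebra k V) (mulMap k)).comp (mulMap k) =
      ((LinearMap.llcomp k (PathAlgebra k V) (PathAlgebra k V →ₗ[k] PathAlgebra k V)
        (PathAlgebra k V →ₗ[k] PathAlgebra k V)).flip (mulMap k)).comp
        ((LinearMap.llcomp k (PathAlgebra k V) (PathAlgebra k V) (PathAlgebra k V)).comp
          (mulMap k)) := by
    refine hom_ext fun r => hom_ext fun q => hom_ext fun p => ?_
    simpa [mulMap_of_of] using mul_assoc_of r q p
  simpa using LinearMap.congr_fun (LinearMap.congr_fun (LinearMap.congr_fun h x) y) z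

theorem one_mulMap [Fintype V] (x : PathAlgebra k V) :
    mulMap k (∑ a : V, of k ⟨a, a, Path.nil⟩) x = x := by
  have h : mulMap k (∑ a : V, of k ⟨a, a, Path.nil⟩) = LinearMap.id (M := PathAlgebra k V) := by
    refine hom_ext fun p => ?_
    obtain ⟨a, b, p⟩ := p
    rw [map_sum, LinearMap.sum_apply, Finset.sum_eq_single b]
    · rw [mulMap_of_of, pathMul_comp]; rfl
    · intro c _ hc
      rw [mulMap_of_of, pathMul_ne]
      exact fun h => hc h.symm
    · simp
  rw [h]; rfl

theorem mulMap_one [Fintype V] (x : PathAlgebra k V) :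
    mulMap k x (∑ a : V, of k ⟨a, a, Path.nil⟩) = x := by
  have h : (mulMap k).flip (∑ a : V, of k ⟨a, a, Path.nil⟩) =
      LinearMap.id (M := PathAlgebra k V) := by
    refine hom_ext fun p => ?_
    obtain ⟨a, b, p⟩ := p
    rw [LinearMap.flip_apply, map_sum, Finset.sum_eq_single a]
    · rw [mulMap_of_of, pathMul_comp, Path.nil_comp]; rfl
    · intro c _ hc
      rw [mulMap_of_of, pathMul_ne]
      exact hc
    · simp
  exact LinearMap.congr_fun h x

instance [Fintype V] : Ring (PathAlgebra k V) where
  __ := (inferInstance : AddCommGroup (PathAlgebra k V))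
  left_distrib x y z := map_add (mulMap k x) y z
  right_distrib x y z := by simp only [mul_eq, map_add, LinearMap.add_apply]
  zero_mul x := by simp only [mul_eq, map_zero, LinearMap.zero_apply]
  mul_zero x := map_zero (mulMap k x)
  mul_assoc := mulMap_assoc
  one_mul := one_mulMap
  mul_one := mulMap_one

instance [Fintype V] : Algebra k (PathAlgebra k V) :=
  Algebra.ofModule (fun r x y => by simp only [mul_eq, map_smul, LinearMap.smul_apply])
    (fun r x y => by simp only [mul_eq, map_smul])

end PathAlgebra

/-! ## Gentle quivers with relations -/

section Gentle

variable {V : Type u} [Quiver.{v} V]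

/-- The path of length two `β α` (first `α`, then `β`). -/
def twoPath {a b c : V} (α : a ⟶ b) (β : b ⟶ c) : QPath V :=
  ⟨a, c, α.toPath.comp β.toPath⟩

/-- The path `p` contains a subpath belonging to `P`. -/
def HasSubpathIn (P : Set (QPath V)) {a b : V} (p : Path a b) : Prop :=
  ∃ (c d : V) (x : Path a c) (y : Path c d) (z : Path d b),
    p = (x.comp y).comp z ∧ (⟨c, d, y⟩ : QPath V) ∈ P

/-- The quiver `V` with the set of paths `P` as relations is gentle. -/
structure IsGentle (P : Set (QPath V)) : Prop where
  /-- All relations are monomials (paths) of length two. -/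
  length_two : ∀ p ∈ P, p.2.2.length = 2
  /-- At most two arrows start at each vertex. -/
  card_out : ∀ a : V, Cardinal.mk (Σ b : V, a ⟶ b) ≤ 2
  /-- At most two arrows end at each vertex. -/
  card_in : ∀ b : V, Cardinal.mk (Σ a : V, a ⟶ b) ≤ 2
  /-- For each arrow `β` there is at most one arrow `α` with `β α` a path not in `P`. -/
  pred_not_mem : ∀ {b c : V} (β : b ⟶ c), {α : Σ a : V, a ⟶ b | twoPath α.2 β ∉ P}.Subsingleton
  /-- For each arrow `β` there is at most one arrow `γ` with `γ β` a path not in `P`. -/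
  succ_not_mem : ∀ {a b : V} (β : a ⟶ b), {γ : Σ c : V, b ⟶ c | twoPath β γ.2 ∉ P}.Subsingleton
  /-- All sufficiently long paths ending with a given arrow `β` contain a relation, and so do all
  sufficiently long paths beginning with `β`. -/
  bounded : ∀ {a b : V} (β : a ⟶ b), ∃ n : ℕ,
    (∀ (x : V) (p : Path x a), n ≤ (p.comp β.toPath).length → HasSubpathIn P (p.comp β.toPath)) ∧
    (∀ (y : V) (q : Path b y), n ≤ (β.toPath.comp q).length → HasSubpathIn P (β.toPath.comp q))
  /-- For each arrow `β` there is at most one arrow `α` with `β α` a path in `P`. -/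
  pred_mem : ∀ {b c : V} (β : b ⟶ c), {α : Σ a : V, a ⟶ b | twoPath α.2 β ∈ P}.Subsingleton
  /-- For each arrow `β` there is at most one arrow `γ` with `γ β` a path in `P`. -/
  succ_mem : ∀ {a b : V} (β : a ⟶ b), {γ : Σ c : V, b ⟶ c | twoPath β γ.2 ∈ P}.Subsingleton

variable (V)

/-- The quiver is connected: it is nonempty and its underlying undirected graph is connected. -/
def QuiverConnected : Prop :=
  Nonempty V ∧ ∀ a b : V, Nonempty (@Path (Symmetrify V) _ a b)

/-- The Kronecker quiver: two vertices, and exactly two arrows, both from the first vertex to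
the second. -/
def IsKroneckerQuiver : Prop :=
  ∃ a b : V, a ≠ b ∧ (∀ c : V, c = a ∨ c = b) ∧ Nat.card (a ⟶ b) = 2 ∧
    IsEmpty (b ⟶ a) ∧ IsEmpty (a ⟶ a) ∧ IsEmpty (b ⟶ b)

/-- The number of cycles `c(Q) = #Q₁ - #Q₀ + 1` of a finite connected quiver (for which
`#Q₀ ≤ #Q₁ + 1`, so that the subtraction does not truncate). -/
def cycleNumber : ℕ := Nat.card (Σ a b : V, a ⟶ b) + 1 - Nat.card V

end Gentle

/-- The ideal of the path algebra generated by the paths in `P`. -/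
def relIdeal (k : Type w) [Field k] {V : Type u} [Quiver.{v} V] [Fintype V]
    (P : Set (QPath V)) : TwoSidedIdeal (PathAlgebra k V) :=
  TwoSidedIdeal.span (PathAlgebra.of k '' P)

/-- The algebra `kQ / ⟨P⟩`. -/
abbrev QuiverAlgebra (k : Type w) [Field k] {V : Type u} [Quiver.{v} V] [Fintype V]
    (P : Set (QPath V)) : Type (max u v w) :=
  (relIdeal k P).ringCon.Quotient

/-! ## Affine algebraic groups over an algebraically closed field

An affine algebraic group is an abstract group `G` together with its `k`-algebra of regular
functions, a subalgebra of the algebra of all functions `G → k`. -/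

section AffineGroups

variable {k : Type w} [Field k]

/-- The Zariski topology determined by an algebra of regular functions: the basic open sets are
the sets where a regular function does not vanish. -/
@[reducible]
def zariskiTopology {G : Type*} (R : Subalgebra k (G → k)) : TopologicalSpace G :=
  TopologicalSpace.generateFrom {U | ∃ F ∈ R, U = {g | F g ≠ 0}}

/-- Pullback of functions along a map. -/
def pullback (k : Type w) [Field k] {G H : Type*} (f : G → H) : (H → k) →ₐ[k] (G → k) where
  toFun F := F ∘ f
  map_one' := rfl
  map_mul' _ _ := rfl
  map_zero' := rfl
  map_add' _ _ := rfl
  commutes' _ := rfl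

/-- The regular functions on a closed subgroup: the restrictions of regular functions. -/
def restrictRegular {G : Type*} [Group G] (R : Subalgebra k (G → k)) (H : Subgroup G) :
    Subalgebra k (H → k) :=
  R.map (pullback k (Subtype.val : H → G))

/-- The regular functions on a quotient by a normal subgroup: the functions whose pullback is
regular, that is, the regular functions invariant under the subgroup. -/
def quotientRegular {G : Type*} [Group G] (R : Subalgebra k (G → k)) (N : Subgroup G) :
    Subalgebra k (G ⧸ N → k) :=
  R.comap (pullback k (QuotientGroup.mk : G → G ⧸ N))

/-- The group isomorphism `e` is an isomorphism of affine algebraic groups: both it and its inverse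
carry regular functions to regular functions. -/
def IsRegularIso {G H : Type*} [Group G] [Group H] (R : Subalgebra k (G → k))
    (R' : Subalgebra k (H → k)) (e : G ≃* H) : Prop :=
  ∀ F : H → k, F ∈ R' ↔ F ∘ e ∈ R

variable (k)

/-- The regular functions on `GL n k`: polynomials in the entries of a matrix and of its inverse. -/
def glRegular (n : ℕ) : Subalgebra k (GL (Fin n) k → k) :=
  Algebra.adjoin k
    ({F | ∃ i j, F = fun g : GL (Fin n) k => (g : Matrix (Fin n) (Fin n) k) i j} ∪
      {F | ∃ i j, F = fun g : GL (Fin n) k => ((g⁻¹ : GL (Fin n) k) : Matrix (Fin n) (Fin n) k) i j})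

/-- The regular functions on the torus `(kˣ)ⁿ`: Laurent polynomials in the coordinates. -/
def torusRegular (n : ℕ) : Subalgebra k ((Fin n → kˣ) → k) :=
  Algebra.adjoin k
    ({F | ∃ i, F = fun t : Fin n → kˣ => (t i : k)} ∪ {F | ∃ i, F = fun t : Fin n → kˣ => (((t i)⁻¹ : kˣ) : k)})

variable {k}

/-- The subgroup `T` is a torus of rank `n`: it is closed and, as an algebraic group, isomorphic to
`(kˣ)ⁿ`. -/
def IsTorusOfRank {G : Type*} [Group G] (R : Subalgebra k (G → k)) (T : Subgroup G) (n : ℕ) :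
    Prop :=
  IsClosed[zariskiTopology R] (T : Set G) ∧
    ∃ e : (Fin n → kˣ) ≃* T, IsRegularIso (torusRegular k n) (restrictRegular R T) e

/-- The subgroup `T` is a torus of rank `n` that is not properly contained in any torus. -/
def IsMaximalTorusOfRank {G : Type*} [Group G] (R : Subalgebra k (G → k)) (T : Subgroup G)
    (n : ℕ) : Prop :=
  IsTorusOfRank R T n ∧ ∀ (T' : Subgroup G) (m : ℕ), IsTorusOfRank R T' m → T ≤ T' → T' = T

end AffineGroups

/-! ## Outer automorphisms of an algebra -/

section Outer

variable (k : Type w) [Field k] (A : Type u) [Ring A] [Algebra k A]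

/-- The regular functions on `Aut(A)`, a closed subgroup of `GL(A)` when `A` is
finite-dimensional: polynomials in the matrix coefficients of `f` and of `f⁻¹`. -/
def autRegular : Subalgebra k ((A ≃ₐ[k] A) → k) :=
  Algebra.adjoin k
    ({F | ∃ (φ : A →ₗ[k] k) (a : A), F = fun f => φ (f a)} ∪
      {F | ∃ (φ : A →ₗ[k] k) (a : A), F = fun f => φ (f⁻¹ a)})

/-- The group of inner automorphisms `a ↦ x a x⁻¹`, for `x` a unit of `A`. -/
def Inn : Subgroup (A ≃ₐ[k] A) := (MulSemiringAction.toAlgAut (ConjAct Aˣ) k A).range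

instance : (Inn k A).Normal where
  conj_mem := by
    rintro _ ⟨x, rfl⟩ g
    refine ⟨ConjAct.toConjAct (Units.map (g : A →* A) (ConjAct.ofConjAct x)), ?_⟩
    ext a
    simp [ConjAct.units_smul_def]

/-- The outer automorphism group `Out(A) = Aut(A) / Inn(A)`. -/
abbrev Out : Type u := (A ≃ₐ[k] A) ⧸ Inn k A

/-- The topology on `Out(A)`: the quotient of the Zariski topology on `Aut(A)`. -/
@[reducible]
def outTopology : TopologicalSpace (Out k A) :=
  TopologicalSpace.coinduced (QuotientGroup.mk : (A ≃ₐ[k] A) → Out k A)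
    (zariskiTopology (autRegular k A))

/-- The regular functions on `Out(A)`. -/
def outRegular : Subalgebra k (Out k A → k) := quotientRegular (autRegular k A) (Inn k A)

variable {k A}

theorem autRegular_translate (g : A ≃ₐ[k] A) {F : (A ≃ₐ[k] A) → k} (hF : F ∈ autRegular k A) :
    (fun f => F (g * f)) ∈ autRegular k A := by
  have h : autRegular k A ≤ (autRegular k A).comap (pullback k fun f => g * f) := by
    refine Algebra.adjoin_le ?_
    rintro _ (⟨φ, a, rfl⟩ | ⟨φ, a, rfl⟩)
    · exact Algebra.subset_adjoin (Or.inl ⟨φ.comp g.toLinearMap, a, rfl⟩)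
    · refine Algebra.subset_adjoin (Or.inr ⟨φ, g⁻¹ a, ?_⟩)
      rfl
  exact h hF

theorem continuous_aut_translate (g : A ≃ₐ[k] A) :
    @Continuous _ _ (zariskiTopology (autRegular k A)) (zariskiTopology (autRegular k A))
      (fun f => g * f) := by
  let := zariskiTopology (autRegular k A)
  refine continuous_generateFrom_iff.2 ?_
  rintro _ ⟨F, hF, rfl⟩
  exact TopologicalSpace.isOpen_generateFrom_of_mem ⟨_, autRegular_translate g hF, rfl⟩

theorem continuous_out_translate (x : Out k A) :
    @Continuous _ _ (outTopology k A) (outTopology k A) (fun y => x * y) := by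
  let := zariskiTopology (autRegular k A)
  let := outTopology k A
  obtain ⟨g, rfl⟩ := QuotientGroup.mk_surjective x
  refine continuous_coinduced_dom.2 ?_
  exact (continuous_coinduced_rng (f := (QuotientGroup.mk : (A ≃ₐ[k] A) → Out k A))).comp
    (continuous_aut_translate g)

variable (k A)

/-- The neutral component of `Out(A)`: the connected component of the identity. -/
def OutNeutral : Subgroup (Out k A) :=
  letI := outTopology k A
  have key : ∀ x ∈ connectedComponent (1 : Out k A), ∀ y ∈ connectedComponent (1 : Out k A),
      x⁻¹ * y ∈ connectedComponent (1 : Out k A) := fun x hx y hy =>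
    (isPreconnected_connectedComponent.image (fun z => x⁻¹ * z)
      (continuous_out_translate x⁻¹).continuousOn).subset_connectedComponent
      ⟨x, hx, inv_mul_cancel x⟩ ⟨y, hy, rfl⟩
  have hinv : ∀ x ∈ connectedComponent (1 : Out k A), x⁻¹ ∈ connectedComponent (1 : Out k A) :=
    fun x hx => by simpa using key x hx 1 mem_connectedComponent
  { carrier := connectedComponent (1 : Out k A)
    one_mem' := mem_connectedComponent
    mul_mem' := fun {x y} hx hy => by simpa using key x⁻¹ (hinv x hx) y hy
    inv_mem' := fun {x} hx => hinv x hx }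

/-- The regular functions on the neutral component of `Out(A)`. -/
def outNeutralRegular : Subalgebra k (OutNeutral k A → k) :=
  restrictRegular (outRegular k A) (OutNeutral k A)

end Outer

end

/-!
Gentleness makes the nonzero paths rigid: a vertex `a` lies on at most one nonzero cycle `c a`, and
an arrow `α` has at most one detour `d α`, a nonzero path parallel to `α` that neither begins nor
ends with `α`. The nonzero paths parallel to `α : a → b` are therefore among `α`, `c b * α`,
`α * c a` and `d α`.

An automorphism in `Out^o(A)` has a representative that fixes the vertices. The relations force the
coefficients of `c b * α` and `α * c a` in the image of `α` to come from scalars attached to the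
vertices, and conjugation by `1 + ∑ a, ζ a • c a`, where the sum has square zero, removes them. They
also force the coefficient of `d α` to vanish unless `α` is free, i.e. occurs in no relation. What
remains is `α ↦ t α • (α + n α • d α)`, and the conjugations by units of the span of the vertices
normalize `t` to be trivial on a spanning tree, whose complement has `c(Q)` elements.

If `α` is free, then `d α` is annihilated by all arrows, and it is not itself a free arrow unless
`Q` is the Kronecker quiver. So these automorphisms only rescale the detours of free arrows, and the
scalars `n` form a vector group on which the torus of the `t` acts by nontrivial characters. The
semidirect product is connected, and its image is open and closed in `Out(A)`.
-/

noncomputable section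

/-! ## Regular functions and the Zariski topology -/

section Zariski

variable {k : Type w} [Field k]

section

variable {X Y : Type*} {R : Subalgebra k (X → k)} {R' : Subalgebra k (Y → k)}

theorem isClosed_zariski_setOf_eq {F F' : X → k} (hF : F ∈ R) (hF' : F' ∈ R) :
    IsClosed[zariskiTopology R] {x | F x = F' x} := by
  let := zariskiTopology R
  refine ⟨TopologicalSpace.isOpen_generateFrom_of_mem ⟨F - F', R.sub_mem hF hF', ?_⟩⟩
  ext x
  simp [sub_eq_zero]

theorem isClosed_zariski_setOf_forall {ι : Sort*} {p : ι → X → Prop}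
    (h : ∀ i, IsClosed[zariskiTopology R] {x | p i x}) :
    IsClosed[zariskiTopology R] {x | ∀ i, p i x} := by
  let := zariskiTopology R
  rw [Set.ofPred_forall]
  exact isClosed_iInter h

theorem exists_ne_zero_of_isOpen_zariski {U : Set X} (hU : IsOpen[zariskiTopology R] U) {x : X}
    (hx : x ∈ U) : ∃ F ∈ R, F x ≠ 0 ∧ ∀ y, F y ≠ 0 → y ∈ U := by
  induction hU with
  | basic U h =>
    obtain ⟨F, hF, rfl⟩ := h
    exact ⟨F, hF, hx, fun _ h => h⟩
  | univ => exact ⟨1, one_mem _, one_ne_zero, fun _ _ => trivial⟩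
  | inter U U' _ _ h h' =>
    obtain ⟨F, hF, hFx, hFU⟩ := h hx.1
    obtain ⟨F', hF', hFx', hFU'⟩ := h' hx.2
    exact ⟨F * F', mul_mem hF hF', mul_ne_zero hFx hFx',
      fun y hy => ⟨hFU y (left_ne_zero_of_mul hy), hFU' y (right_ne_zero_of_mul hy)⟩⟩
  | sUnion S _ h =>
    obtain ⟨U, hU, hx⟩ := hx
    obtain ⟨F, hF, hFx, hFU⟩ := h U hU hx
    exact ⟨F, hF, hFx, fun y hy => ⟨U, hU, hFU y hy⟩⟩

theorem continuous_zariski {f : X → Y} (hf : R' ≤ R.comap (pullback k f)) :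
    Continuous[zariskiTopology R, zariskiTopology R'] f := by
  let := zariskiTopology R
  refine continuous_generateFrom_iff.2 ?_
  rintro _ ⟨F, hF, rfl⟩
  exact TopologicalSpace.isOpen_generateFrom_of_mem ⟨_, hf hF, rfl⟩

variable (R) in
/-- The group of the invertible elements of an algebra `R` of functions, as functions with values
in `kˣ`. -/
def regularUnits : Subgroup (X → kˣ) where
  carrier := {u | (fun x => (u x : k)) ∈ R ∧ (fun x => ((u x)⁻¹ : k)) ∈ R}
  one_mem' := by
    simp only [Set.mem_ofPred_eq, Pi.one_apply, Units.val_one, inv_one, and_self]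
    exact one_mem R
  mul_mem' {u v} hu hv := by
    refine ⟨mul_mem hu.1 hv.1, ?_⟩
    simp only [Pi.mul_apply, Units.val_mul, mul_inv]
    exact mul_mem hu.2 hv.2
  inv_mem' {u} hu := by simpa using And.symm hu

end

namespace IsRegularIso

variable {G H K : Type*} [Group G] [Group H] [Group K]
  {R : Subalgebra k (G → k)} {R' : Subalgebra k (H → k)} {R'' : Subalgebra k (K → k)}

theorem trans {e : G ≃* H} {e' : H ≃* K} (h : IsRegularIso R R' e) (h' : IsRegularIso R' R'' e') :
    IsRegularIso R R'' (e.trans e') :=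
  fun F => (h' F).trans (h (F ∘ e'))

theorem le_comap {e : G ≃* H} (h : IsRegularIso R R' e) : R' ≤ R.comap (pullback k e) :=
  fun F => (h F).1

theorem le_comap_symm {e : G ≃* H} (h : IsRegularIso R R' e) :
    R ≤ R'.comap (pullback k e.symm) := fun F hF =>
  (h (F ∘ e.symm)).2 (by simpa [Function.comp_assoc] using hF)

end IsRegularIso

section ClosedEmbedding

variable {G H : Type*} [Group G] [Group H] {R : Subalgebra k (G → k)} {R' : Subalgebra k (H → k)}
  {f : G →* H} {r : H → G} {Y : Set H}

/- The map `r` need not be regular: outside of `Y` it may take junk values. -/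
theorem isClosed_range_of_leftInverse (hr : Function.LeftInverse r f)
    (hY : IsClosed[zariskiTopology R'] Y) (hfY : ∀ x, f x ∈ Y)
    (hsep : ∀ h h' : H, (∀ F ∈ R', F h = F h') → h = h') (hf : R' ≤ R.comap (pullback k f))
    (hrY : R ≤ (R'.map (pullback k (Subtype.val : Y → H))).comap (pullback k fun y : Y => r y)) :
    IsClosed[zariskiTopology R'] (f.range : Set H) := by
  choose! F' hF' heq using fun F (hF : F ∈ R') => hrY (hf hF)
  have hrange : (f.range : Set H) = Y ∩ {h | ∀ F : R', F' F h = (F : H → k) h} := by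
    ext h
    constructor
    · rintro ⟨x, rfl⟩
      refine ⟨hfY x, fun F => (congrFun (heq F F.2) ⟨f x, hfY x⟩).trans ?_⟩
      exact congrArg (fun x => (F : H → k) (f x)) (hr x)
    · rintro ⟨hhY, hh⟩
      exact ⟨r h, hsep _ _ fun F hF =>
        (congrFun (heq F hF) ⟨h, hhY⟩).symm.trans (hh ⟨F, hF⟩)⟩
  rw [hrange]
  let := zariskiTopology R'
  exact hY.inter <| isClosed_zariski_setOf_forall fun F =>
    isClosed_zariski_setOf_eq (hF' F F.2) F.2

theorem isRegularIso_ofInjective (hr : Function.LeftInverse r f) (hfY : ∀ x, f x ∈ Y)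
    (hf : R' ≤ R.comap (pullback k f))
    (hrY : R ≤ (R'.map (pullback k (Subtype.val : Y → H))).comap (pullback k fun y : Y => r y)) :
    IsRegularIso R (restrictRegular R' f.range) (MonoidHom.ofInjective hr.injective) := by
  refine fun F => ⟨?_, fun hF => ?_⟩
  · rintro ⟨F, hF, rfl⟩
    exact hf hF
  · obtain ⟨F', hF', heq⟩ := hrY hF
    refine ⟨F', hF', funext fun h => ?_⟩
    obtain ⟨x, rfl⟩ := (MonoidHom.ofInjective hr.injective).surjective h
    refine (congrFun heq ⟨f x, hfY x⟩).trans ?_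
    exact congrArg (fun x => F (MonoidHom.ofInjective hr.injective x)) (hr x)

end ClosedEmbedding

/-! ### Rational curves -/

section RationalCurve

open Polynomial

variable {X : Type*}

/-- The functions `F` for which `F ∘ γ` agrees, outside of the zeros of `d`, with a rational
function whose denominator is a power of `d`. -/
def rationalAlong (γ : k → X) (d : k[X]) : Subalgebra k (X → k) where
  carrier := {F | ∃ (p : k[X]) (N : ℕ), ∀ s, d.eval s ≠ 0 → F (γ s) * d.eval s ^ N = p.eval s}
  algebraMap_mem' c := ⟨C c, 0, fun s _ => by simp⟩
  add_mem' := by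
    rintro F G ⟨p, N, hp⟩ ⟨q, M, hq⟩
    refine ⟨p * d ^ M + q * d ^ N, N + M, fun s hs => ?_⟩
    simp only [eval_add, eval_mul, eval_pow, Pi.add_apply, ← hp s hs, ← hq s hs]
    ring
  mul_mem' := by
    rintro F G ⟨p, N, hp⟩ ⟨q, M, hq⟩
    refine ⟨p * q, N + M, fun s hs => ?_⟩
    simp only [eval_mul, Pi.mul_apply, ← hp s hs, ← hq s hs]
    ring

theorem isPreconnected_image_of_le_rationalAlong [Infinite k] {R : Subalgebra k (X → k)}
    {γ : k → X} {d : k[X]} (hγ : R ≤ rationalAlong γ d) :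
    @IsPreconnected _ (zariskiTopology R) (γ '' {s | d.eval s ≠ 0}) := by
  let := zariskiTopology R
  have numerator_ne_zero {F : X → k} {p : k[X]} {N : ℕ} {s : k} (hs : d.eval s ≠ 0)
      (hF : F (γ s) ≠ 0) (hp : ∀ s, d.eval s ≠ 0 → F (γ s) * d.eval s ^ N = p.eval s) : p ≠ 0 := by
    rintro rfl
    exact mul_ne_zero hF (pow_ne_zero N hs) (by simpa using hp s hs)
  refine IsPreirreducible.isPreconnected ?_
  rintro U U' hU hU' ⟨_, ⟨s, hs, rfl⟩, hsU⟩ ⟨_, ⟨s', hs', rfl⟩, hsU'⟩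
  obtain ⟨F, hF, hFs, hFU⟩ := exists_ne_zero_of_isOpen_zariski hU hsU
  obtain ⟨F', hF', hFs', hFU'⟩ := exists_ne_zero_of_isOpen_zariski hU' hsU'
  obtain ⟨p, N, hp⟩ := hγ hF
  obtain ⟨p', N', hp'⟩ := hγ hF'
  have hd : d ≠ 0 := by
    rintro rfl
    exact hs eval_zero
  obtain ⟨r, hr⟩ : ∃ r, (p * p' * d).eval r ≠ 0 := by
    by_contra! h
    exact mul_ne_zero (mul_ne_zero (numerator_ne_zero hs hFs hp) (numerator_ne_zero hs' hFs' hp'))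
      hd (Polynomial.funext fun r => by simp [h r])
  simp only [eval_mul, mul_ne_zero_iff] at hr
  obtain ⟨⟨hpr, hpr'⟩, hdr⟩ := hr
  refine ⟨γ r, ⟨r, hdr, rfl⟩, hFU _ fun h => hpr ?_, hFU' _ fun h => hpr' ?_⟩
  · rw [← hp r hdr, h, zero_mul]
  · rw [← hp' r hdr, h, zero_mul]

end RationalCurve

end Zariski

/-! ## Laurent monomials -/

section Laurent

variable (k : Type w) [Field k] (κ : Type*)

/-- The group of Laurent monomials, as functions on the torus `κ → kˣ`. -/
def laurentMonomials : Subgroup ((κ → kˣ) → kˣ) :=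
  Subgroup.closure (Set.range fun i t => t i)

variable {k κ}

theorem coord_mem_laurentMonomials (i : κ) :
    (fun t : κ → kˣ => t i) ∈ laurentMonomials k κ :=
  Subgroup.subset_closure ⟨i, rfl⟩

theorem comp_mem_of_mem_laurentMonomials {X : Type*} {S : Subgroup (X → kˣ)} {t : X → κ → kˣ}
    (ht : ∀ i, (fun x => t x i) ∈ S) {μ : (κ → kˣ) → kˣ} (hμ : μ ∈ laurentMonomials k κ) :
    (fun x => μ (t x)) ∈ S := by
  induction hμ using Subgroup.closure_induction with
  | mem _ h =>
    obtain ⟨i, rfl⟩ := h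
    exact ht i
  | one => exact one_mem _
  | mul _ _ _ _ h h' => exact mul_mem h h'
  | inv _ _ h => exact inv_mem h

end Laurent

/-! ## The semidirect product of a vector group and a torus -/

section TorusVector

variable {k : Type w} [Field k] {ι κ : Type*}

/-- The semidirect product of the vector group `ι → k` and the torus `κ → kˣ`, which acts on the
`j`-th coordinate by the character `χ j`. -/
@[ext]
structure TorusVector (χ : ι → ((κ → kˣ) →* kˣ)) where
  /-- The component in the vector group. -/
  vec : ι → k
  /-- The component in the torus. -/
  tor : κ → kˣ

namespace TorusVector

variable {χ : ι → ((κ → kˣ) →* kˣ)}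

instance : Mul (TorusVector χ) :=
  ⟨fun x y => ⟨fun j => x.vec j + χ j x.tor * y.vec j, x.tor * y.tor⟩⟩

instance : One (TorusVector χ) := ⟨⟨0, 1⟩⟩

instance : Inv (TorusVector χ) := ⟨fun x => ⟨fun j => -((χ j x.tor)⁻¹ * x.vec j), x.tor⁻¹⟩⟩

@[simp] theorem mul_vec (x y : TorusVector χ) (j : ι) :
    (x * y).vec j = x.vec j + χ j x.tor * y.vec j := rfl

@[simp] theorem mul_tor (x y : TorusVector χ) : (x * y).tor = x.tor * y.tor := rfl

@[simp] theorem one_vec : (1 : TorusVector χ).vec = 0 := rfl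

@[simp] theorem one_tor : (1 : TorusVector χ).tor = 1 := rfl

@[simp] theorem inv_vec (x : TorusVector χ) (j : ι) :
    x⁻¹.vec j = -((χ j x.tor : k)⁻¹ * x.vec j) := by
  rw [← Units.val_inv_eq_inv_val]
  rfl

@[simp] theorem inv_tor (x : TorusVector χ) : x⁻¹.tor = x.tor⁻¹ := rfl

instance : Group (TorusVector χ) :=
  Group.ofLeftAxioms
    (fun x y z => by
      ext j
      · simp only [mul_vec, mul_tor, map_mul, Units.val_mul]
        ring
      · simp only [mul_tor, mul_assoc])
    (fun x => by ext j <;> simp)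
    (fun x => by ext j <;> simp)

variable (χ) in
/-- The regular functions on the semidirect product: polynomials in the coordinates and in the
inverses of the coordinates of the torus. -/
def regular : Subalgebra k (TorusVector χ → k) :=
  Algebra.adjoin k
    ((Set.range fun j x => x.vec j) ∪ (Set.range fun i x => (x.tor i : k)) ∪
      (Set.range fun i x => ((x.tor i)⁻¹ : k)))

theorem vec_mem_regular (j : ι) : (fun x : TorusVector χ => x.vec j) ∈ regular χ :=
  Algebra.subset_adjoin (Or.inl (Or.inl ⟨j, rfl⟩))

theorem tor_mem_regularUnits (i : κ) :
    (fun x : TorusVector χ => x.tor i) ∈ regularUnits (regular χ) :=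
  ⟨Algebra.subset_adjoin (Or.inl (Or.inr ⟨i, rfl⟩)), Algebra.subset_adjoin (Or.inr ⟨i, rfl⟩)⟩

theorem monomial_mem_regularUnits {μ : (κ → kˣ) → kˣ} (hμ : μ ∈ laurentMonomials k κ) :
    (fun x : TorusVector χ => μ x.tor) ∈ regularUnits (regular χ) :=
  comp_mem_of_mem_laurentMonomials tor_mem_regularUnits hμ

theorem regular_le_comap_pullback {X : Type*} {R : Subalgebra k (X → k)} {f : X → TorusVector χ}
    (hvec : ∀ j, (fun x => (f x).vec j) ∈ R) (htor : ∀ i, (fun x => ((f x).tor i : k)) ∈ R)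
    (htor_inv : ∀ i, (fun x => (((f x).tor i)⁻¹ : k)) ∈ R) :
    regular χ ≤ R.comap (pullback k f) := by
  refine Algebra.adjoin_le ?_
  rintro _ ((⟨j, rfl⟩ | ⟨i, rfl⟩) | ⟨i, rfl⟩)
  exacts [hvec j, htor i, htor_inv i]

theorem regular_le_comap_inv (hχ : ∀ j, ⇑(χ j) ∈ laurentMonomials k κ) :
    regular χ ≤ (regular χ).comap (pullback k fun x => x⁻¹) := by
  refine regular_le_comap_pullback (fun j => ?_) (fun i => ?_) fun i => ?_
  · simp only [inv_vec]
    exact neg_mem (mul_mem (monomial_mem_regularUnits (hχ j)).2 (vec_mem_regular j))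
  · simpa using (tor_mem_regularUnits i).2
  · simpa using (tor_mem_regularUnits i).1

/-! ### The embedding into lower triangular matrices -/

section Triangular

variable {r : ℕ}

/-- The lower triangular matrix with first column `(1, ν)`, diagonal `(1, ψ)` and zeros
elsewhere. -/
def arrowheadMatrix (ν ψ : Fin r → k) : Matrix (Fin (r + 1)) (Fin (r + 1)) k :=
  Matrix.of (Fin.cons (Fin.cons 1 0) fun i => Fin.cons (ν i) fun j => if i = j then ψ i else 0)

section

variable (ν ψ ν' ψ' : Fin r → k)

@[simp] theorem arrowheadMatrix_zero_zero : arrowheadMatrix ν ψ 0 0 = 1 := rfl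

@[simp] theorem arrowheadMatrix_zero_succ (j : Fin r) : arrowheadMatrix ν ψ 0 j.succ = 0 := rfl

@[simp] theorem arrowheadMatrix_succ_zero (i : Fin r) : arrowheadMatrix ν ψ i.succ 0 = ν i := rfl

@[simp] theorem arrowheadMatrix_succ_succ (i j : Fin r) :
    arrowheadMatrix ν ψ i.succ j.succ = if i = j then ψ i else 0 := rfl

theorem arrowheadMatrix_mul :
    arrowheadMatrix ν ψ * arrowheadMatrix ν' ψ' = arrowheadMatrix (ν + ψ * ν') (ψ * ψ') := by
  ext i j
  rw [Matrix.mul_apply, Fin.sum_univ_succ]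
  cases i using Fin.cases <;> cases j using Fin.cases <;>
    simp only [arrowheadMatrix_zero_zero, arrowheadMatrix_zero_succ, arrowheadMatrix_succ_zero,
      arrowheadMatrix_succ_succ, mul_one, zero_mul, mul_zero, Finset.sum_const_zero, add_zero,
      zero_add, mul_ite, ite_mul, Finset.sum_ite_eq, Finset.sum_ite_eq', Finset.mem_univ, if_true,
      Pi.add_apply, Pi.mul_apply]
  split_ifs with h
  · rw [h]
  · rfl

theorem arrowheadMatrix_zero_one : arrowheadMatrix (0 : Fin r → k) 1 = 1 := by
  ext i j
  cases i using Fin.cases <;> cases j using Fin.cases <;>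
    simp [Matrix.one_apply, (Fin.succ_ne_zero _).symm]

theorem arrowheadMatrix_apply_eq_zero_of_lt {i j : Fin (r + 1)} (h : i < j) :
    arrowheadMatrix ν ψ i j = 0 := by
  cases j using Fin.cases with
  | zero => exact absurd h (Fin.not_lt_zero i)
  | succ j =>
    cases i using Fin.cases with
    | zero => rfl
    | succ i => exact if_neg (Fin.succ_lt_succ_iff.1 h).ne

end

variable (σ : ι ⊕ κ ≃ Fin r)

variable (χ) in
/-- The faithful representation of the semidirect product by lower triangular matrices, for a
numbering `σ` of the coordinates. -/
def toMatrix : TorusVector χ →* Matrix (Fin (r + 1)) (Fin (r + 1)) k where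
  toFun x := arrowheadMatrix (fun a => Sum.elim x.vec 0 (σ.symm a))
    (fun a => Sum.elim (fun j => (χ j x.tor : k)) (fun i => x.tor i) (σ.symm a))
  map_one' := by
    rw [← arrowheadMatrix_zero_one]
    congr 1 <;> ext a <;> rcases σ.symm a with j | i <;> simp
  map_mul' x y := by
    rw [arrowheadMatrix_mul]
    congr 1 <;> ext a <;> simp only [Pi.add_apply, Pi.mul_apply] <;>
      rcases σ.symm a with j | i <;> simp

variable (χ) in
/-- The representation `toMatrix` as a homomorphism to the general linear group. -/
def toGL : TorusVector χ →* GL (Fin (r + 1)) k := (toMatrix χ σ).toHomUnits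

theorem coe_toGL (x : TorusVector χ) :
    (toGL χ σ x : Matrix (Fin (r + 1)) (Fin (r + 1)) k) = toMatrix χ σ x := rfl

theorem toMatrix_apply_vec (x : TorusVector χ) (j : ι) :
    toMatrix χ σ x (σ (Sum.inl j)).succ 0 = x.vec j := by
  simp [toMatrix]

theorem toMatrix_apply_tor (x : TorusVector χ) (i : κ) :
    toMatrix χ σ x (σ (Sum.inr i)).succ (σ (Sum.inr i)).succ = x.tor i := by
  simp [toMatrix]

theorem toMatrix_apply_eq_zero_of_lt (x : TorusVector χ) {a c : Fin (r + 1)} (h : a < c) :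
    toMatrix χ σ x a c = 0 :=
  arrowheadMatrix_apply_eq_zero_of_lt _ _ h

theorem toMatrix_apply_mem_regular (hχ : ∀ j, ⇑(χ j) ∈ laurentMonomials k κ) (a c : Fin (r + 1)) :
    (fun x => toMatrix χ σ x a c) ∈ regular χ := by
  have hconst (z : k) : (fun _ => z) ∈ regular χ := (regular χ).algebraMap_mem z
  simp only [toMatrix, MonoidHom.coe_mk, OneHom.coe_mk]
  cases a using Fin.cases with
  | zero =>
    cases c using Fin.cases with
    | zero => exact hconst 1
    | succ c => exact hconst 0
  | succ a =>
    cases c using Fin.cases with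
    | zero =>
      simp only [arrowheadMatrix_succ_zero]
      rcases σ.symm a with j | _
      exacts [vec_mem_regular j, hconst 0]
    | succ c =>
      simp only [arrowheadMatrix_succ_succ]
      split_ifs
      · rcases σ.symm a with j | i
        exacts [(monomial_mem_regularUnits (hχ j)).1, (tor_mem_regularUnits i).1]
      · exact hconst 0

theorem glRegular_le_comap_toGL (hχ : ∀ j, ⇑(χ j) ∈ laurentMonomials k κ) :
    glRegular k (r + 1) ≤ (regular χ).comap (pullback k (toGL χ σ)) := by
  refine Algebra.adjoin_le ?_
  rintro _ (⟨a, c, rfl⟩ | ⟨a, c, rfl⟩)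
  · exact toMatrix_apply_mem_regular σ hχ a c
  · have h := regular_le_comap_inv hχ (toMatrix_apply_mem_regular σ hχ a c)
    have hinv : pullback k (toGL χ σ) (fun g => g⁻¹.1 a c) =
        pullback k (fun x => x⁻¹) fun x => toMatrix χ σ x a c :=
      funext fun x => congrArg (fun g => g.1 a c) (map_inv (toGL χ σ) x).symm
    exact (congrArg (· ∈ regular χ) hinv).mpr h

open Classical in
/-- The element with the coordinates read off from the first column and from the diagonal of an
invertible matrix, where vanishing diagonal entries are replaced by `1`. -/
def ofGL (g : GL (Fin (r + 1)) k) : TorusVector χ where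
  vec j := g.1 (σ (Sum.inl j)).succ 0
  tor i := if h : g.1 (σ (Sum.inr i)).succ (σ (Sum.inr i)).succ ≠ 0 then Units.mk0 _ h else 1

theorem leftInverse_ofGL_toGL : Function.LeftInverse (ofGL σ) (toGL χ σ) := by
  intro x
  ext i
  · exact toMatrix_apply_vec σ x i
  · simp [ofGL, coe_toGL, toMatrix_apply_tor]

/-- The invertible matrices whose diagonal entries at the coordinates of the torus are inverse to
those of the inverse matrix. On these matrices `ofGL` is given by regular functions. -/
def diagonalInvertible : Set (GL (Fin (r + 1)) k) :=
  {g | ∀ i : κ, g.1 (σ (Sum.inr i)).succ (σ (Sum.inr i)).succ *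
    (g⁻¹).1 (σ (Sum.inr i)).succ (σ (Sum.inr i)).succ = 1}

theorem toGL_mem_diagonalInvertible (x : TorusVector χ) : toGL χ σ x ∈ diagonalInvertible σ := by
  intro i
  rw [← map_inv]
  simp only [coe_toGL, toMatrix_apply_tor, inv_tor, Pi.inv_apply, Units.mul_inv]

theorem entry_mem_glRegular {n : ℕ} (a c : Fin n) :
    (fun g : GL (Fin n) k => (g : Matrix (Fin n) (Fin n) k) a c) ∈ glRegular k n :=
  Algebra.subset_adjoin (Or.inl ⟨a, c, rfl⟩)

theorem inv_entry_mem_glRegular {n : ℕ} (a c : Fin n) :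
    (fun g : GL (Fin n) k => ((g⁻¹ : GL (Fin n) k) : Matrix (Fin n) (Fin n) k) a c) ∈
      glRegular k n :=
  Algebra.subset_adjoin (Or.inr ⟨a, c, rfl⟩)

theorem isClosed_diagonalInvertible :
    IsClosed[zariskiTopology (glRegular k (r + 1))] (diagonalInvertible σ) :=
  isClosed_zariski_setOf_forall fun _ => isClosed_zariski_setOf_eq
    (mul_mem (entry_mem_glRegular _ _) (inv_entry_mem_glRegular _ _)) (one_mem _)

theorem regular_le_comap_ofGL :
    regular χ ≤ ((glRegular k (r + 1)).map
      (pullback k (Subtype.val : diagonalInvertible σ → GL (Fin (r + 1)) k))).comap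
        (pullback k fun g => ofGL σ g.1) := by
  have htor (g : diagonalInvertible (k := k) σ) (i : κ) :
      (((ofGL σ g.1 : TorusVector χ).tor i : kˣ) : k) =
        g.1.1 (σ (Sum.inr i)).succ (σ (Sum.inr i)).succ := by
    simp only [ofGL]
    rw [dif_pos (left_ne_zero_of_mul_eq_one (g.2 i)), Units.val_mk0]
  refine regular_le_comap_pullback (fun j => ⟨_, entry_mem_glRegular (σ (Sum.inl j)).succ 0, rfl⟩)
    (fun i => ?_) fun i => ?_
  · exact ⟨_, entry_mem_glRegular (σ (Sum.inr i)).succ (σ (Sum.inr i)).succ,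
      funext fun g => (htor g i).symm⟩
  · refine ⟨_, inv_entry_mem_glRegular (σ (Sum.inr i)).succ (σ (Sum.inr i)).succ,
      funext fun g => ?_⟩
    rw [htor g i]
    exact eq_inv_of_mul_eq_one_right (g.2 i)

end Triangular

theorem exists_lowerTriangular_embedding [Finite ι] [Finite κ]
    (hχ : ∀ j, ⇑(χ j) ∈ laurentMonomials k κ) :
    ∃ (n : ℕ) (G : Subgroup (GL (Fin n) k)) (e : TorusVector χ ≃* G),
      IsClosed[zariskiTopology (glRegular k n)] (G : Set (GL (Fin n) k)) ∧
      (∀ g ∈ G, ∀ i j : Fin n, i < j → (g : Matrix (Fin n) (Fin n) k) i j = 0) ∧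
      IsRegularIso (regular χ) (restrictRegular (glRegular k n) G) e := by
  let σ := Finite.equivFin (ι ⊕ κ)
  refine ⟨_, (toGL χ σ).range, MonoidHom.ofInjective (leftInverse_ofGL_toGL σ).injective, ?_, ?_,
    isRegularIso_ofInjective (leftInverse_ofGL_toGL σ) (toGL_mem_diagonalInvertible σ)
      (glRegular_le_comap_toGL σ hχ) (regular_le_comap_ofGL σ)⟩
  · exact isClosed_range_of_leftInverse (leftInverse_ofGL_toGL σ) (isClosed_diagonalInvertible σ)
      (toGL_mem_diagonalInvertible σ)
      (fun g g' h => Units.ext <| Matrix.ext fun a c => h _ (entry_mem_glRegular a c))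
      (glRegular_le_comap_toGL σ hχ) (regular_le_comap_ofGL σ)
  · rintro _ ⟨x, rfl⟩ a c h
    exact toMatrix_apply_eq_zero_of_lt σ x h

/-! ### The maximal torus and its complement -/

section Decomposition

variable {G : Type*} [Group G] {R : Subalgebra k (G → k)} (E : G ≃* TorusVector χ)

/-- The embedding of the torus in a group `G ≅ k ^ ι ⋊ (kˣ) ^ κ`, for a numbering `σ` of `κ`. -/
def torusHom {n : ℕ} (σ : κ ≃ Fin n) : (Fin n → kˣ) →* G where
  toFun t := E.symm ⟨0, t ∘ σ⟩
  map_one' := (MulEquiv.symm_apply_eq E).2 (map_one E).symm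
  map_mul' t t' := by
    rw [MulEquiv.symm_apply_eq, map_mul, MulEquiv.apply_symm_apply, MulEquiv.apply_symm_apply]
    ext j <;> simp

/-- The subgroup of a group `G ≅ k ^ ι ⋊ (kˣ) ^ κ` that corresponds to the torus. -/
def torusSubgroup : Subgroup G where
  carrier := {g | (E g).vec = 0}
  one_mem' := by simp
  mul_mem' {x y} hx hy := by
    ext j
    simp [congrFun hx j, congrFun hy j]
  inv_mem' {x} hx := by
    ext j
    simp [congrFun hx j]

/-- The subgroup of a group `G ≅ k ^ ι ⋊ (kˣ) ^ κ` that corresponds to the vector group. -/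
def vectorSubgroup : Subgroup G where
  carrier := {g | (E g).tor = 1}
  one_mem' := by simp
  mul_mem' {x y} hx hy := by
    rw [Set.mem_ofPred_eq] at hx hy ⊢
    rw [map_mul, mul_tor, hx, hy, one_mul]
  inv_mem' {x} hx := by
    rw [Set.mem_ofPred_eq] at hx ⊢
    rw [map_inv, inv_tor, hx, inv_one]

theorem mem_torusSubgroup {g : G} : g ∈ torusSubgroup E ↔ (E g).vec = 0 := Iff.rfl

theorem mem_vectorSubgroup {g : G} : g ∈ vectorSubgroup E ↔ (E g).tor = 1 := Iff.rfl

theorem symm_mk_zero_mem_torusSubgroup (t : κ → kˣ) : E.symm ⟨0, t⟩ ∈ torusSubgroup E := by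
  rw [mem_torusSubgroup, MulEquiv.apply_symm_apply]

theorem range_torusHom {n : ℕ} (σ : κ ≃ Fin n) : (torusHom E σ).range = torusSubgroup E := by
  ext g
  constructor
  · rintro ⟨t, rfl⟩
    exact symm_mk_zero_mem_torusSubgroup E _
  · intro hg
    refine ⟨(E g).tor ∘ σ.symm, (MulEquiv.symm_apply_eq E).2 ?_⟩
    ext j
    · exact (congrFun hg j).symm
    · simp

theorem leftInverse_torusHom {n : ℕ} (σ : κ ≃ Fin n) :
    Function.LeftInverse (fun g i => (E g).tor (σ.symm i)) (torusHom E σ) := fun t => by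
  ext i
  simp [torusHom]

variable {E}

theorem le_comap_torusHom (hE : IsRegularIso R (regular χ) E) {n : ℕ} (σ : κ ≃ Fin n) :
    R ≤ (torusRegular k n).comap (pullback k (torusHom E σ)) := by
  have h : regular χ ≤ (torusRegular k n).comap (pullback k fun t => ⟨0, t ∘ σ⟩) := by
    refine regular_le_comap_pullback (fun _ => zero_mem _)
      (fun i => Algebra.subset_adjoin (Or.inl ⟨σ i, rfl⟩))
      fun i => Algebra.subset_adjoin (Or.inr ⟨σ i, ?_⟩)
    simp only [Units.val_inv_eq_inv_val, Function.comp_apply]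
  exact fun F hF => h (hE.le_comap_symm hF)

theorem torusRegular_le_comap_tor (hE : IsRegularIso R (regular χ) E) {n : ℕ} (σ : κ ≃ Fin n) :
    torusRegular k n ≤ R.comap (pullback k fun g i => (E g).tor (σ.symm i)) := by
  refine Algebra.adjoin_le ?_
  rintro _ (⟨i, rfl⟩ | ⟨i, rfl⟩)
  · exact hE.le_comap (tor_mem_regularUnits (σ.symm i)).1
  · simp only [Units.val_inv_eq_inv_val]
    exact hE.le_comap (tor_mem_regularUnits (σ.symm i)).2

theorem isTorusOfRank_torusSubgroup (hE : IsRegularIso R (regular χ) E) {n : ℕ} (σ : κ ≃ Fin n) :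
    IsTorusOfRank R (torusSubgroup E) n := by
  rw [← range_torusHom E σ]
  refine ⟨?_, _, isRegularIso_ofInjective (Y := Set.univ) (leftInverse_torusHom E σ)
    (fun _ => trivial) (le_comap_torusHom hE σ) ?_⟩
  · rw [range_torusHom]
    have hset : (torusSubgroup E : Set G) = {g | ∀ j, (E g).vec j = 0} :=
      Set.ext fun _ => funext_iff
    rw [hset]
    exact isClosed_zariski_setOf_forall fun j =>
      isClosed_zariski_setOf_eq (hE.le_comap (vec_mem_regular j)) R.zero_mem
  · exact fun F hF => ⟨_, torusRegular_le_comap_tor hE σ hF, rfl⟩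

theorem eq_torusSubgroup_of_le (hχ : ∀ j, ∃ t, χ j t ≠ 1) {T : Subgroup G}
    (hcomm : ∀ x ∈ T, ∀ y ∈ T, x * y = y * x) (hT : torusSubgroup E ≤ T) :
    T = torusSubgroup E := by
  refine le_antisymm (fun g hg => funext fun j => ?_) hT
  obtain ⟨t, ht⟩ := hχ j
  have h := congrArg (fun x => (E x).vec j)
    (hcomm g hg _ (hT (symm_mk_zero_mem_torusSubgroup E t)))
  simp only [map_mul, MulEquiv.apply_symm_apply, mul_vec, Pi.zero_apply, mul_zero, add_zero,
    zero_add] at h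
  have hj : ((χ j t : k) - 1) * (E g).vec j = 0 := by linear_combination -h
  exact (mul_eq_zero.1 hj).resolve_left fun h' => ht (Units.ext (sub_eq_zero.1 h'))

theorem isMaximalTorusOfRank_torusSubgroup (hE : IsRegularIso R (regular χ) E)
    (hχ : ∀ j, ∃ t, χ j t ≠ 1) {n : ℕ} (σ : κ ≃ Fin n) :
    IsMaximalTorusOfRank R (torusSubgroup E) n := by
  refine ⟨isTorusOfRank_torusSubgroup hE σ, ?_⟩
  rintro T m ⟨-, e, -⟩ hT
  refine eq_torusSubgroup_of_le hχ (fun x hx y hy => ?_) hT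
  have h := mul_comm (e.symm ⟨x, hx⟩) (e.symm ⟨y, hy⟩)
  rw [← map_mul, ← map_mul] at h
  exact congrArg Subtype.val (e.symm.injective h)

variable (E) in
theorem vectorSubgroup_normal : (vectorSubgroup E).Normal where
  conj_mem x hx g := by
    rw [mem_vectorSubgroup] at hx ⊢
    simp [hx]

theorem isClosed_vectorSubgroup (hE : IsRegularIso R (regular χ) E) :
    IsClosed[zariskiTopology R] (vectorSubgroup E : Set G) := by
  have hset : (vectorSubgroup E : Set G) = {g | ∀ i, ((E g).tor i : k) = 1} := by
    ext g
    simp [mem_vectorSubgroup, funext_iff]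
  rw [hset]
  exact isClosed_zariski_setOf_forall fun i =>
    isClosed_zariski_setOf_eq (hE.le_comap (tor_mem_regularUnits i).1) R.one_mem

variable (E)

theorem isNilpotent_vectorSubgroup : Group.IsNilpotent (vectorSubgroup E) := by
  let : CommGroup (vectorSubgroup E) :=
    { (inferInstance : Group (vectorSubgroup E)) with
      mul_comm := by
        rintro ⟨x, hx⟩ ⟨y, hy⟩
        rw [mem_vectorSubgroup] at hx hy
        apply Subtype.ext
        apply E.injective
        ext j <;> simp [hx, hy, add_comm] }
  exact CommGroup.isNilpotent

theorem isComplement'_torusSubgroup_vectorSubgroup :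
    (torusSubgroup E).IsComplement' (vectorSubgroup E) := by
  refine Subgroup.isComplement'_of_disjoint_and_mul_eq_univ ?_ ?_
  · rw [Subgroup.disjoint_def]
    intro x hvec htor
    exact E.injective (by rw [map_one]; exact TorusVector.ext hvec htor)
  · refine Set.eq_univ_of_forall fun g => Set.mem_mul.2
      ⟨_, symm_mk_zero_mem_torusSubgroup E (E g).tor, (E.symm ⟨0, (E g).tor⟩)⁻¹ * g, ?_, by simp⟩
    rw [SetLike.mem_coe, mem_vectorSubgroup]
    simp

end Decomposition

/-! ### Connectedness -/

open Polynomial in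
open Classical in
theorem exists_isPreconnected_one_mem [Infinite k] [Finite κ] (x : TorusVector χ) :
    ∃ S : Set (TorusVector χ),
      @IsPreconnected _ (zariskiTopology (regular χ)) S ∧ 1 ∈ S ∧ x ∈ S := by
  have := Fintype.ofFinite κ
  let L (i : κ) : k[X] := 1 + X * C ((x.tor i : k) - 1)
  let d : k[X] := ∏ i, L i
  let γ (s : k) : TorusVector χ :=
    ⟨fun j => s * x.vec j, fun i => if h : (L i).eval s ≠ 0 then Units.mk0 _ h else 1⟩
  have hd {s : k} : d.eval s ≠ 0 ↔ ∀ i, (L i).eval s ≠ 0 := by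
    simp [d, Polynomial.eval_prod, Finset.prod_ne_zero_iff]
  have htor {s : k} (hs : d.eval s ≠ 0) (i : κ) : ((γ s).tor i : k) = (L i).eval s := by
    simp only [γ]
    rw [dif_pos (hd.1 hs i), Units.val_mk0]
  have hrational : regular χ ≤ rationalAlong γ d := by
    refine Algebra.adjoin_le ?_
    rintro _ ((⟨j, rfl⟩ | ⟨i, rfl⟩) | ⟨i, rfl⟩)
    · exact ⟨X * C (x.vec j), 0, fun s _ => by simp [γ, mul_comm s]⟩
    · exact ⟨L i, 0, fun s hs => by simp only [htor hs, pow_zero, mul_one]⟩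
    · refine ⟨∏ i' ∈ Finset.univ.erase i, L i', 1, fun s hs => ?_⟩
      have hprod : d = L i * ∏ i' ∈ Finset.univ.erase i, L i' :=
        (Finset.mul_prod_erase _ _ (Finset.mem_univ i)).symm
      simp only [htor hs, pow_one]
      rw [hprod, eval_mul, inv_mul_cancel_left₀ (hd.1 hs i)]
  refine ⟨_, isPreconnected_image_of_le_rationalAlong hrational,
    ⟨0, hd.2 fun i => by simp [L], ?_⟩, ⟨1, hd.2 fun i => by simp [L], ?_⟩⟩
  all_goals ext j <;> simp [γ, L]

end TorusVector

end TorusVector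

/-! ## The combinatorics of gentle quivers -/

/-- The combinatorial data of a connected gentle quiver with relations that is not the Kronecker
quiver, with set of vertices `V` and set of arrows `E`. The condition `parallel_free` excludes the
Kronecker quiver. -/
structure GentleDatum (V E : Type*) where
  /-- The start of an arrow. -/
  src : E → V
  /-- The end of an arrow. -/
  tgt : E → V
  /-- `β α` (first `α`, then `β`) is a path that is not a relation. -/
  NonRel : E → E → Prop
  tgt_eq_src : ∀ {β α}, NonRel β α → tgt α = src β
  nonRel_right_unique : ∀ {β α α'}, NonRel β α → NonRel β α' → α = α'
  nonRel_left_unique : ∀ {β β' α}, NonRel β α → NonRel β' α → β = β'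
  rel_right_unique : ∀ {β α α'},
    tgt α = src β → ¬ NonRel β α → tgt α' = src β → ¬ NonRel β α' → α = α'
  rel_left_unique : ∀ {β β' α},
    tgt α = src β → ¬ NonRel β α → tgt α = src β' → ¬ NonRel β' α → β = β'
  bounded : ∃ L : ℕ, ∀ l : List E, l.IsChain NonRel → l.length ≤ L
  out_le_two : ∀ {α β γ}, src α = src β → src α = src γ → α = β ∨ α = γ ∨ β = γ
  in_le_two : ∀ {α β γ}, tgt α = tgt β → tgt α = tgt γ → α = β ∨ α = γ ∨ β = γ
  connected : ∀ W : Set V, W.Nonempty → (∀ α, src α ∈ W ↔ tgt α ∈ W) → W = Set.univ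
  parallel_free : ∀ {α α'}, src α = src α' → tgt α = tgt α' →
    (∀ β, (tgt β = src α → NonRel α β) ∧ (tgt α = src β → NonRel β α)) →
    (∀ β, (tgt β = src α' → NonRel α' β) ∧ (tgt α' = src β → NonRel β α')) → α = α'

namespace GentleDatum

variable {V E : Type*} (D : GentleDatum V E)

/-- The word `l` encodes a nonzero path of positive length. The letters are the arrows of the path
in the order in which they are multiplied: the first letter is the last arrow. -/
def Good (l : List E) : Prop := l ≠ [] ∧ l.IsChain D.NonRel

/-- The arrow `α` is not part of any relation. -/
def Free (α : E) : Prop :=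
  ∀ β, (D.tgt β = D.src α → D.NonRel α β) ∧ (D.tgt α = D.src β → D.NonRel β α)

/-- The path encoded by the word `l` starts in `a`. -/
def StartsAt (l : List E) (a : V) : Prop := ∀ α ∈ l.getLast?, D.src α = a

/-- The path encoded by the word `l` ends in `b`. -/
def EndsAt (l : List E) (b : V) : Prop := ∀ α ∈ l.head?, D.tgt α = b

/-- The word `l` encodes a nonzero path of positive length from `a` to `a`. -/
def IsCycle (a : V) (l : List E) : Prop := D.Good l ∧ D.StartsAt l a ∧ D.EndsAt l a

/-- The word `l` encodes a nonzero path parallel to `α` that neither begins nor ends with `α`. -/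
def IsDetour (α : E) (l : List E) : Prop :=
  D.Good l ∧ D.StartsAt l (D.src α) ∧ D.EndsAt l (D.tgt α) ∧ α ∉ l.head? ∧ α ∉ l.getLast?

variable {D} {l m n : List E} {α β : E} {a b : V}

@[simp] theorem startsAt_concat : D.StartsAt (l ++ [α]) a ↔ D.src α = a := by simp [StartsAt]

@[simp] theorem startsAt_singleton : D.StartsAt [α] a ↔ D.src α = a := by simp [StartsAt]

@[simp] theorem endsAt_cons : D.EndsAt (α :: l) b ↔ D.tgt α = b := by simp [EndsAt]

theorem startsAt_append (hm : m ≠ []) : D.StartsAt (l ++ m) a ↔ D.StartsAt m a := by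
  rw [StartsAt, List.getLast?_append_of_ne_nil _ hm, StartsAt]

theorem endsAt_append (hl : l ≠ []) : D.EndsAt (l ++ m) b ↔ D.EndsAt l b := by
  rw [EndsAt, List.head?_append_of_ne_nil _ hl, EndsAt]

namespace Good

theorem singleton (α : E) : D.Good [α] := ⟨List.cons_ne_nil _ _, List.isChain_singleton _⟩

theorem left (h : D.Good (l ++ m)) (hl : l ≠ []) : D.Good l := ⟨hl, h.2.left_of_append⟩

theorem right (h : D.Good (l ++ m)) (hm : m ≠ []) : D.Good m := ⟨hm, h.2.right_of_append⟩

theorem exists_mem_head? (h : D.Good l) : ∃ α, α ∈ l.head? := ⟨_, List.head?_eq_some_head h.1⟩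

theorem exists_mem_getLast? (h : D.Good l) : ∃ α, α ∈ l.getLast? :=
  ⟨_, List.getLast?_eq_some_getLast h.1⟩

end Good

theorem good_append_iff (hβ : β ∈ l.getLast?) (hα : α ∈ m.head?) :
    D.Good (l ++ m) ↔ D.Good l ∧ D.Good m ∧ D.NonRel β α := by
  have hl : l ≠ [] := by rintro rfl; simp at hβ
  have hm : m ≠ [] := by rintro rfl; simp at hα
  rw [Option.mem_def] at hα hβ
  simp [Good, List.isChain_append, hl, hm, hα, hβ]

theorem good_cons_iff (hβ : β ∈ l.head?) : D.Good (α :: l) ↔ D.Good l ∧ D.NonRel α β := by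
  simpa [Good.singleton] using good_append_iff (D := D) (l := [α]) rfl hβ

theorem Good.append_of_overlap (h : D.Good (l ++ m)) (h' : D.Good (m ++ n)) (hm : m ≠ []) :
    D.Good (l ++ m ++ n) :=
  ⟨by simp [hm], h.2.append_overlap h'.2 hm⟩

theorem not_transGen_nonRel (α : E) : ¬ Relation.TransGen D.NonRel α α := by
  intro h
  obtain ⟨L, hL⟩ := D.bounded
  obtain ⟨β, hαβ, hβ⟩ := Relation.TransGen.tail'_iff.1 h
  obtain ⟨l, hl, hlast⟩ := List.exists_isChain_cons_of_relationReflTransGen hαβ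
  have exists_long_chain (n : ℕ) : ∃ m : List E, (α :: m).IsChain D.NonRel ∧ n ≤ m.length := by
    induction n with
    | zero => exact ⟨[], List.isChain_singleton α, zero_le⟩
    | succ n ih =>
      obtain ⟨m, hm, hn⟩ := ih
      refine ⟨l ++ α :: m, hl.append hm ?_, by simp; omega⟩
      rw [List.getLast?_eq_some_getLast (List.cons_ne_nil _ _), hlast]
      rintro _ ⟨⟩ _ ⟨⟩
      exact hβ
  obtain ⟨m, hm, hn⟩ := exists_long_chain L
  have := hL _ hm
  rw [List.length_cons] at this
  omega

theorem Good.nodup (h : D.Good l) : l.Nodup :=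
  (h.2.imp fun _ _ => Relation.TransGen.single).pairwise.imp fun {α _} hαβ => by
    rintro rfl
    exact not_transGen_nonRel α hαβ

theorem prefix_or_prefix_of_head?_eq (hl : l.IsChain D.NonRel) (hm : m.IsChain D.NonRel)
    (h : l.head? = m.head?) : l <+: m ∨ m <+: l := by
  induction l generalizing m with
  | nil => exact Or.inl List.nil_prefix
  | cons α l ih =>
    obtain _ | ⟨α', m⟩ := m
    · exact Or.inr List.nil_prefix
    obtain rfl : α = α' := by simpa using h
    simp only [List.cons_prefix_cons, true_and]
    obtain _ | ⟨β, l⟩ := l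
    · exact Or.inl List.nil_prefix
    obtain _ | ⟨β', m⟩ := m
    · exact Or.inr List.nil_prefix
    rw [List.isChain_cons_cons] at hl hm
    obtain rfl := D.nonRel_right_unique hl.1 hm.1
    exact ih hl.2 hm.2 rfl

theorem Good.eq_of_prefix (hl : D.Good l) (hm : D.Good m) (h : l <+: m)
    (h' : l.getLast? = m.getLast?) : l = m := by
  obtain ⟨n, rfl⟩ := h
  obtain rfl | hn := eq_or_ne n []
  · exact (List.append_nil l).symm
  obtain ⟨α, hα⟩ := hl.exists_mem_getLast?
  rw [List.getLast?_append_of_ne_nil _ hn] at h'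
  exact (List.disjoint_of_nodup_append hm.nodup (List.mem_of_getLast? hα)
    (List.mem_of_getLast? (h' ▸ hα))).elim

theorem Good.ext (hl : D.Good l) (hm : D.Good m) (h : l.head? = m.head?)
    (h' : l.getLast? = m.getLast?) : l = m := by
  obtain hlm | hml := prefix_or_prefix_of_head?_eq hl.2 hm.2 h
  · exact hl.eq_of_prefix hm hlm h'
  · exact (hm.eq_of_prefix hl hml h'.symm).symm

theorem not_good_append_self (l : List E) : ¬ D.Good (l ++ l) := by
  intro h
  obtain ⟨α, hα⟩ := List.exists_mem_of_ne_nil l (by simpa using h.1)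
  exact List.disjoint_of_nodup_append h.nodup hα hα

/- Two different cycles at `a` could be composed in both orders, since by gentleness the first arrow
of one composes to zero with the last arrow of at most one of them. -/
theorem IsCycle.unique (h : D.IsCycle a l) (h' : D.IsCycle a m) : l = m := by
  obtain ⟨hl, hs, ht⟩ := h
  obtain ⟨hm, hs', ht'⟩ := h'
  obtain ⟨β, hβ⟩ := hl.exists_mem_getLast?
  obtain ⟨α, hα⟩ := hl.exists_mem_head?
  obtain ⟨β', hβ'⟩ := hm.exists_mem_getLast?
  obtain ⟨α', hα'⟩ := hm.exists_mem_head?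
  have hβα : ¬ D.NonRel β α := fun h =>
    not_good_append_self l ((good_append_iff hβ hα).2 ⟨hl, hl, h⟩)
  have hβα' : ¬ D.NonRel β' α' := fun h =>
    not_good_append_self m ((good_append_iff hβ' hα').2 ⟨hm, hm, h⟩)
  have src_β := hs β hβ
  have src_β' := hs' β' hβ'
  have tgt_α := ht α hα
  have tgt_α' := ht' α' hα'
  by_cases hαα' : α = α'
  · subst hαα'
    obtain rfl : β = β' := D.rel_left_unique (tgt_α.trans src_β.symm) hβα
      (tgt_α.trans src_β'.symm) hβα'
    exact hl.ext hm (hα.trans hα'.symm) (hβ.trans hβ'.symm)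
  · have hlm : D.Good (l ++ m) := by
      refine (good_append_iff hβ hα').2 ⟨hl, hm, by_contra fun h => hαα' ?_⟩
      exact D.rel_right_unique (tgt_α.trans src_β.symm) hβα (tgt_α'.trans src_β.symm) h
    have hml : D.Good (m ++ l) := by
      refine (good_append_iff hβ' hα).2 ⟨hm, hl, by_contra fun h => hαα' ?_⟩
      exact D.rel_right_unique (tgt_α.trans src_β'.symm) h (tgt_α'.trans src_β'.symm) hβα'
    have hlml := (hlm.append_of_overlap hml hm.1).nodup
    exact (List.disjoint_of_nodup_append hlml (List.mem_append_left _ (List.mem_of_mem_head? hα))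
      (List.mem_of_mem_head? hα)).elim

theorem IsDetour.unique (h : D.IsDetour α l) (h' : D.IsDetour α m) : l = m := by
  obtain ⟨hl, hs, ht, hhead, hlast⟩ := h
  obtain ⟨hm, hs', ht', hhead', hlast'⟩ := h'
  obtain ⟨β, hβ⟩ := hl.exists_mem_head?
  obtain ⟨β', hβ'⟩ := hm.exists_mem_head?
  obtain ⟨γ, hγ⟩ := hl.exists_mem_getLast?
  obtain ⟨γ', hγ'⟩ := hm.exists_mem_getLast?
  have hββ' : β = β' := by
    obtain rfl | rfl | h := D.in_le_two (ht β hβ).symm (ht' β' hβ').symm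
    exacts [absurd hβ hhead, absurd hβ' hhead', h]
  have hγγ' : γ = γ' := by
    obtain rfl | rfl | h := D.out_le_two (hs γ hγ).symm (hs' γ' hγ').symm
    exacts [absurd hγ hlast, absurd hγ' hlast', h]
  subst hββ' hγγ'
  exact hl.ext hm (hβ.trans hβ'.symm) (hγ.trans hγ'.symm)

theorem isCycle_of_good_append_singleton (h : D.Good (l ++ [α])) (hl : l ≠ [])
    (ht : D.EndsAt (l ++ [α]) (D.tgt α)) : D.IsCycle (D.tgt α) l :=
  ⟨h.left hl, fun _ hβ => (D.tgt_eq_src ((good_append_iff hβ rfl).1 h).2.2).symm,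
    (endsAt_append hl).1 ht⟩

theorem isCycle_of_good_cons (h : D.Good (α :: l)) (hl : l ≠ [])
    (hs : D.StartsAt (α :: l) (D.src α)) : D.IsCycle (D.src α) l :=
  ⟨h.right (l := [α]) hl, (startsAt_append (l := [α]) hl).1 hs,
    fun _ hβ => D.tgt_eq_src ((good_cons_iff hβ).1 h).2⟩

theorem Good.parallel_cases (h : D.Good l) (hs : D.StartsAt l (D.src α))
    (ht : D.EndsAt l (D.tgt α)) : l = [α] ∨ (∃ u, D.IsCycle (D.tgt α) u ∧ l = u ++ [α]) ∨
      (∃ v, D.IsCycle (D.src α) v ∧ l = α :: v) ∨ D.IsDetour α l := by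
  by_cases hlast : α ∈ l.getLast?
  · obtain ⟨u, rfl⟩ := List.getLast?_eq_some_iff.1 hlast
    obtain rfl | hu := eq_or_ne u []
    · exact Or.inl rfl
    · exact Or.inr (Or.inl ⟨u, isCycle_of_good_append_singleton h hu ht, rfl⟩)
  by_cases hhead : α ∈ l.head?
  · obtain ⟨v, rfl⟩ := List.head?_eq_some_iff.1 hhead
    obtain rfl | hv := eq_or_ne v []
    · exact Or.inl rfl
    · exact Or.inr (Or.inr (Or.inl ⟨v, isCycle_of_good_cons h hv hs, rfl⟩))
  exact Or.inr (Or.inr (Or.inr ⟨h, hs, ht, hhead, hlast⟩))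

theorem IsDetour.not_good_append (hα : D.Free α) (h : D.IsDetour α l) (hm : m ≠ []) :
    ¬ D.Good (l ++ m) := by
  intro hlm
  obtain ⟨γ, hγ⟩ := h.1.exists_mem_getLast?
  obtain ⟨β, hβ⟩ := (hlm.right hm).exists_mem_head?
  have hγβ := ((good_append_iff hγ hβ).1 hlm).2.2
  have hαβ := (hα β).1 ((D.tgt_eq_src hγβ).trans (h.2.1 γ hγ))
  exact h.2.2.2.2 (D.nonRel_left_unique hγβ hαβ ▸ hγ)

theorem IsDetour.not_good_prepend (hα : D.Free α) (h : D.IsDetour α l) (hm : m ≠ []) :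
    ¬ D.Good (m ++ l) := by
  intro hml
  obtain ⟨β, hβ⟩ := (hml.left hm).exists_mem_getLast?
  obtain ⟨γ, hγ⟩ := h.1.exists_mem_head?
  have hβγ := ((good_append_iff hβ hγ).1 hml).2.2
  have hβα := (hα β).2 ((h.2.2.1 γ hγ).symm.trans (D.tgt_eq_src hβγ))
  exact h.2.2.2.1 (D.nonRel_right_unique hβγ hβα ▸ hγ)

theorem IsCycle.isDetour (hl : D.IsCycle (D.tgt α) l) (hm : D.IsCycle (D.src α) m)
    (h : D.Good (l ++ α :: m)) : D.IsDetour α (l ++ α :: m) := by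
  have hnodup := h.nodup
  refine ⟨h, ?_, (endsAt_append hl.1.1).2 hl.2.2, fun hα => ?_, fun hα => ?_⟩
  · rw [List.append_cons, startsAt_append hm.1.1]
    exact hm.2.1
  · rw [List.head?_append_of_ne_nil _ hl.1.1] at hα
    exact List.disjoint_of_nodup_append hnodup (List.mem_of_mem_head? hα) List.mem_cons_self
  · rw [List.append_cons] at hα hnodup
    rw [List.getLast?_append_of_ne_nil _ hm.1.1] at hα
    exact List.disjoint_of_nodup_append hnodup (by simp) (List.mem_of_getLast? hα)

variable (D)

open Classical in
/-- The word of the nonzero path of positive length from `a` to `a`, and the empty word if there is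
no such path. -/
def cycle (a : V) : List E := if h : ∃ l, D.IsCycle a l then h.choose else []

open Classical in
/-- The word of the nonzero path parallel to `α` that neither begins nor ends with `α`, and the
empty word if there is no such path. -/
def detour (α : E) : List E := if h : ∃ l, D.IsDetour α l then h.choose else []

variable {D}

theorem IsCycle.eq_cycle (h : D.IsCycle a l) : l = D.cycle a := by
  have h' : ∃ l, D.IsCycle a l := ⟨l, h⟩
  rw [cycle, dif_pos h']
  exact h.unique h'.choose_spec

theorem IsDetour.eq_detour (h : D.IsDetour α l) : l = D.detour α := by
  have h' : ∃ l, D.IsDetour α l := ⟨l, h⟩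
  rw [detour, dif_pos h']
  exact h.unique h'.choose_spec

theorem isCycle_cycle (h : D.cycle a ≠ []) : D.IsCycle a (D.cycle a) := by
  have h' : ∃ l, D.IsCycle a l := by_contra fun h' => h (dif_neg h')
  rw [cycle, dif_pos h']
  exact h'.choose_spec

theorem isDetour_detour (h : D.detour α ≠ []) : D.IsDetour α (D.detour α) := by
  have h' : ∃ l, D.IsDetour α l := by_contra fun h' => h (dif_neg h')
  rw [detour, dif_pos h']
  exact h'.choose_spec

theorem finite_good [Finite E] : Finite {l : List E // D.Good l} := by
  obtain ⟨L, hL⟩ := D.bounded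
  exact ((List.finite_length_le E L).subset fun l hl => hL l hl.2).to_subtype

/-! ### Spanning trees -/

section SpanningTree

variable {k : Type*} [Field k]

/-- The coboundary of a function on the vertices. -/
def coboundary (D : GentleDatum V E) (x : V → kˣ) (α : E) : kˣ := x (D.tgt α) / x (D.src α)

variable (D) in
/-- The arrow `α` joins the vertices `c` and `d`, in one of the two directions. -/
def Joins (α : E) (c d : V) : Prop :=
  D.src α = c ∧ D.tgt α = d ∨ D.tgt α = c ∧ D.src α = d

theorem Joins.exists_monomial {c d : V} (h : D.Joins α c d) {ν : (E → kˣ) → kˣ}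
    (hν : ν ∈ laurentMonomials k E) :
    ∃ μ ∈ laurentMonomials k E, ∀ (t : E → kˣ) (x : V → kˣ), x c = ν t → x d = μ t →
      t α * D.coboundary x α = 1 := by
  have hα := coord_mem_laurentMonomials (k := k) α
  obtain ⟨rfl, rfl⟩ | ⟨rfl, rfl⟩ := h
  · refine ⟨ν * (fun t => t α)⁻¹, mul_mem hν (inv_mem hα), fun t x hc hd => ?_⟩
    simp [coboundary, hc, hd]
  · refine ⟨ν * fun t => t α, mul_mem hν hα, fun t x hc hd => ?_⟩
    simp [coboundary, hc, hd]

variable (D k) in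
/-- The arrows `T` form a tree with set of vertices `W`. The existence of a potential, a function
on the vertices by which any function on the arrows can be normalized to be trivial on `T`,
expresses that `T` has no cycles, and `eq_of_mem` that it is connected. -/
structure IsSubtree (W : Finset V) (T : Finset E) : Prop where
  src_mem : ∀ α ∈ T, D.src α ∈ W
  tgt_mem : ∀ α ∈ T, D.tgt α ∈ W
  card_eq : W.card = T.card + 1
  exists_potential : ∃ s : V → (E → kˣ) → kˣ, (∀ a, s a ∈ laurentMonomials k E) ∧
    ∀ α ∈ T, ∀ t, t α * D.coboundary (fun a => s a t) α = 1
  eq_of_mem : ∀ x : V → kˣ, (∀ α ∈ T, x (D.tgt α) = x (D.src α)) → ∀ a ∈ W, ∀ b ∈ W, x a = x b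

theorem isSubtree_singleton (a : V) : D.IsSubtree k {a} ∅ where
  src_mem := by simp
  tgt_mem := by simp
  card_eq := by simp
  exists_potential := ⟨1, fun _ => one_mem _, by simp⟩
  eq_of_mem := by simp

open Classical in
theorem IsSubtree.exists_potential_insert {W : Finset V} {T : Finset E} (h : D.IsSubtree k W T)
    {c d : V} (hα : D.Joins α c d) (hc : c ∈ W) (hd : d ∉ W) :
    ∃ s : V → (E → kˣ) → kˣ, (∀ a, s a ∈ laurentMonomials k E) ∧
      ∀ β ∈ insert α T, ∀ t, t β * D.coboundary (fun a => s a t) β = 1 := by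
  obtain ⟨s, hs, hsT⟩ := h.exists_potential
  obtain ⟨μ, hμ, hμα⟩ := hα.exists_monomial (hs c)
  have hcd : c ≠ d := fun h => hd (h ▸ hc)
  refine ⟨Function.update s d μ, fun a => ?_, fun β hβ t => ?_⟩
  · obtain rfl | had := eq_or_ne a d
    · rwa [Function.update_self]
    · rw [Function.update_of_ne had]
      exact hs a
  · obtain rfl | hβ := Finset.mem_insert.1 hβ
    · exact hμα t _ (by rw [Function.update_of_ne hcd]) (by rw [Function.update_self])
    · have hsrc : D.src β ≠ d := fun h' => hd (h' ▸ h.src_mem β hβ)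
      have htgt : D.tgt β ≠ d := fun h' => hd (h' ▸ h.tgt_mem β hβ)
      simpa [coboundary, hsrc, htgt] using hsT β hβ t

open Classical in
theorem IsSubtree.insert {W : Finset V} {T : Finset E} (h : D.IsSubtree k W T) {c d : V}
    (hα : D.Joins α c d) (hc : c ∈ W) (hd : d ∉ W) :
    D.IsSubtree k (insert d W) (insert α T) where
  src_mem := by
    rintro β hβ
    obtain rfl | hβ := Finset.mem_insert.1 hβ
    · obtain ⟨rfl, -⟩ | ⟨-, rfl⟩ := hα <;> simp [hc]
    · exact Finset.mem_insert_of_mem (h.src_mem β hβ)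
  tgt_mem := by
    rintro β hβ
    obtain rfl | hβ := Finset.mem_insert.1 hβ
    · obtain ⟨-, rfl⟩ | ⟨rfl, -⟩ := hα <;> simp [hc]
    · exact Finset.mem_insert_of_mem (h.tgt_mem β hβ)
  card_eq := by
    have hαT : α ∉ T := fun hαT => hd <| by
      obtain ⟨-, rfl⟩ | ⟨-, rfl⟩ := hα
      exacts [h.tgt_mem α hαT, h.src_mem α hαT]
    rw [Finset.card_insert_of_notMem hd, Finset.card_insert_of_notMem hαT, h.card_eq]
  exists_potential := h.exists_potential_insert hα hc hd
  eq_of_mem x hx := by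
    have hcd : x d = x c := by
      have hxα := hx α (Finset.mem_insert_self _ _)
      obtain ⟨rfl, rfl⟩ | ⟨rfl, rfl⟩ := hα
      exacts [hxα, hxα.symm]
    have hW (a : V) (ha : a ∈ Insert.insert d W) : x a = x c := by
      obtain rfl | ha := Finset.mem_insert.1 ha
      · exact hcd
      · exact h.eq_of_mem x (fun β hβ => hx β (Finset.mem_insert_of_mem hβ)) a ha c hc
    exact fun a ha b hb => (hW a ha).trans (hW b hb).symm

theorem exists_joins_of_ne_univ {W : Set V} (hW : W.Nonempty) (hW' : W ≠ Set.univ) :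
    ∃ α, ∃ c ∈ W, ∃ d ∉ W, D.Joins α c d := by
  obtain ⟨α, hα⟩ : ∃ α, ¬ (D.src α ∈ W ↔ D.tgt α ∈ W) := by
    by_contra! h
    exact hW' (D.connected W hW h)
  by_cases h : D.src α ∈ W
  · exact ⟨α, _, h, _, fun h' => hα (iff_of_true h h'), Or.inl ⟨rfl, rfl⟩⟩
  · exact ⟨α, _, by_contra fun h' => hα (iff_of_false h h'), _, h, Or.inr ⟨rfl, rfl⟩⟩

variable (D k) in
theorem exists_isSubtree_univ [Fintype V] [Nonempty V] :
    ∃ T : Finset E, D.IsSubtree k Finset.univ T := by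
  classical
  have exists_isSubtree (n : ℕ) (hn : n < Fintype.card V) :
      ∃ (W : Finset V) (T : Finset E), W.card = n + 1 ∧ D.IsSubtree k W T := by
    induction n with
    | zero => exact ⟨_, _, Finset.card_singleton _, isSubtree_singleton (Classical.arbitrary V)⟩
    | succ n ih =>
      obtain ⟨W, T, hW, hT⟩ := ih (by omega)
      obtain ⟨α, c, hc, d, hd, hα⟩ := exists_joins_of_ne_univ (D := D) (W := W)
        (Finset.coe_nonempty.2 (Finset.card_pos.1 (by omega))) fun h => by
          rw [Finset.coe_eq_univ.1 h, Finset.card_univ] at hW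
          omega
      exact ⟨_, _, by rw [Finset.card_insert_of_notMem hd, hW], hT.insert hα hc hd⟩
  have hpos := Fintype.card_pos (α := V)
  obtain ⟨W, T, hW, hT⟩ := exists_isSubtree (Fintype.card V - 1) (by omega)
  obtain rfl := (Finset.card_eq_iff_eq_univ W).1 (by omega)
  exact ⟨T, hT⟩

theorem prod_map_coboundary (x : V → kˣ) (h : D.Good l) (hs : D.StartsAt l a)
    (ht : D.EndsAt l b) : (l.map (D.coboundary x)).prod = x b / x a := by
  induction l generalizing b with
  | nil => exact absurd rfl h.1
  | cons α l ih =>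
    obtain rfl : D.tgt α = b := endsAt_cons.1 ht
    obtain rfl | hl := eq_or_ne l []
    · obtain rfl : D.src α = a := startsAt_singleton.1 hs
      simp [coboundary]
    · have hl' : D.Good l := h.right (l := [α]) hl
      have ht' : D.EndsAt l (D.src α) := fun _ hβ => D.tgt_eq_src ((good_cons_iff hβ).1 h).2
      rw [List.map_cons, List.prod_cons, ih hl' ((startsAt_append (l := [α]) hl).1 hs) ht',
        coboundary, div_mul_div_cancel]

end SpanningTree

end GentleDatum

/-! ## Algebras with a basis of paths -/

/-- A basis of the algebra `A` that consists of the vertices and the good words of the gentle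
datum `D`, multiplied as paths. -/
structure PathBasis {V E : Type*} [Fintype V] (D : GentleDatum V E) (k A : Type*) [Field k] [Ring A]
    [Algebra k A] where
  /-- The basis. -/
  basis : Module.Basis (V ⊕ {l : List E // D.Good l}) k A
  sum_vertices : ∑ a, basis (Sum.inl a) = 1
  vertex_mul_self : ∀ a, basis (Sum.inl a) * basis (Sum.inl a) = basis (Sum.inl a)
  vertex_mul_of_ne : ∀ a b, a ≠ b → basis (Sum.inl a) * basis (Sum.inl b) = 0
  word_mul_word_of_good : ∀ l m (h : D.Good (l.1 ++ m.1)),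
    basis (Sum.inr l) * basis (Sum.inr m) = basis (Sum.inr ⟨l.1 ++ m.1, h⟩)
  word_mul_word_of_not_good : ∀ l m, ¬ D.Good (l.1 ++ m.1) →
    basis (Sum.inr l) * basis (Sum.inr m) = 0
  vertex_mul_word : ∀ a l, D.EndsAt l.1 a →
    basis (Sum.inl a) * basis (Sum.inr l) = basis (Sum.inr l)
  vertex_mul_word_of_not : ∀ a l, ¬ D.EndsAt l.1 a → basis (Sum.inl a) * basis (Sum.inr l) = 0
  word_mul_vertex : ∀ a l, D.StartsAt l.1 a →
    basis (Sum.inr l) * basis (Sum.inl a) = basis (Sum.inr l)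
  word_mul_vertex_of_not : ∀ a l, ¬ D.StartsAt l.1 a → basis (Sum.inr l) * basis (Sum.inl a) = 0

namespace PathBasis

open GentleDatum

section Basis

variable {V E : Type*} [Fintype V] {D : GentleDatum V E} {k A : Type*} [Field k] [Ring A]
  [Algebra k A] (B : PathBasis D k A) {a b : V} {α : E} {l m : List E}

/-- The idempotent of a vertex. -/
def vertex (a : V) : A := B.basis (Sum.inl a)

open Classical in
/-- The element given by a word, which is zero if the word is not good. -/
def word (l : List E) : A := if h : D.Good l then B.basis (Sum.inr ⟨l, h⟩) else 0

open Classical in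
/-- The coefficient of a word, which is zero if the word is not good. -/
def coeff (l : List E) : A →ₗ[k] k := if h : D.Good l then B.basis.coord (Sum.inr ⟨l, h⟩) else 0

theorem word_of_good (h : D.Good l) : B.word l = B.basis (Sum.inr ⟨l, h⟩) := dif_pos h

theorem word_of_not_good (h : ¬ D.Good l) : B.word l = 0 := dif_neg h

@[simp] theorem word_nil : B.word [] = 0 := B.word_of_not_good fun h => h.1 rfl

@[simp] theorem coeff_vertex : B.coeff l (B.vertex a) = 0 := by
  unfold coeff
  split_ifs <;> simp [vertex]

theorem coeff_word_self (h : D.Good l) : B.coeff l (B.word l) = 1 := by simp [coeff, word, h]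

theorem coeff_word_of_ne (h : l ≠ m) : B.coeff l (B.word m) = 0 := by
  unfold coeff word
  split_ifs <;> simp [h.symm]

theorem completeOrthogonalIdempotents_vertex : CompleteOrthogonalIdempotents B.vertex where
  idem := B.vertex_mul_self
  ortho _ _ h := B.vertex_mul_of_ne _ _ h
  complete := B.sum_vertices

@[simp] theorem vertex_mul_vertex_self : B.vertex a * B.vertex a = B.vertex a :=
  B.vertex_mul_self a

theorem vertex_mul_vertex_of_ne (h : a ≠ b) : B.vertex a * B.vertex b = 0 :=
  B.vertex_mul_of_ne a b h

theorem word_mul (hl : l ≠ []) (hm : m ≠ []) : B.word l * B.word m = B.word (l ++ m) := by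
  by_cases h : D.Good (l ++ m)
  · rw [B.word_of_good h, B.word_of_good (h.left hl), B.word_of_good (h.right hm),
      B.word_mul_word_of_good _ _ h]
  by_cases h₁ : D.Good l
  · by_cases h₂ : D.Good m
    · rw [B.word_of_not_good h, B.word_of_good h₁, B.word_of_good h₂,
        B.word_mul_word_of_not_good _ _ h]
    · rw [B.word_of_not_good h, B.word_of_not_good h₂, mul_zero]
  · rw [B.word_of_not_good h, B.word_of_not_good h₁, zero_mul]

theorem word_cons (hl : l ≠ []) : B.word (α :: l) = B.word [α] * B.word l :=
  (B.word_mul (List.cons_ne_nil α []) hl).symm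

theorem vertex_mul_word_of_endsAt (h : D.EndsAt l a) : B.vertex a * B.word l = B.word l := by
  by_cases hl : D.Good l
  · rw [B.word_of_good hl]
    exact B.vertex_mul_word a ⟨l, hl⟩ h
  · rw [B.word_of_not_good hl, mul_zero]

theorem vertex_mul_word_of_not_endsAt (h : ¬ D.EndsAt l a) : B.vertex a * B.word l = 0 := by
  by_cases hl : D.Good l
  · rw [B.word_of_good hl]
    exact B.vertex_mul_word_of_not a ⟨l, hl⟩ h
  · rw [B.word_of_not_good hl, mul_zero]

theorem word_mul_vertex_of_startsAt (h : D.StartsAt l a) : B.word l * B.vertex a = B.word l := by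
  by_cases hl : D.Good l
  · rw [B.word_of_good hl]
    exact B.word_mul_vertex a ⟨l, hl⟩ h
  · rw [B.word_of_not_good hl, zero_mul]

theorem word_mul_vertex_of_not_startsAt (h : ¬ D.StartsAt l a) : B.word l * B.vertex a = 0 := by
  by_cases hl : D.Good l
  · rw [B.word_of_good hl]
    exact B.word_mul_vertex_of_not a ⟨l, hl⟩ h
  · rw [B.word_of_not_good hl, zero_mul]

theorem hom_ext {M : Type*} [AddCommMonoid M] [Module k M] {f g : A →ₗ[k] M}
    (vertex : ∀ a, f (B.vertex a) = g (B.vertex a))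
    (word : ∀ l, D.Good l → f (B.word l) = g (B.word l)) : f = g := by
  refine B.basis.ext ?_
  rintro (a | l)
  · exact vertex a
  · rw [← B.word_of_good l.2]
    exact word l.1 l.2

theorem hom_ext₂ {M : Type*} [AddCommMonoid M] [Module k M] {f g : A →ₗ[k] A →ₗ[k] M}
    (vertex_vertex : ∀ a b, f (B.vertex a) (B.vertex b) = g (B.vertex a) (B.vertex b))
    (vertex_word : ∀ a l, D.Good l → f (B.vertex a) (B.word l) = g (B.vertex a) (B.word l))
    (word_vertex : ∀ l a, D.Good l → f (B.word l) (B.vertex a) = g (B.word l) (B.vertex a))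
    (word_word : ∀ l m, D.Good l → D.Good m → f (B.word l) (B.word m) = g (B.word l) (B.word m)) :
    f = g :=
  B.hom_ext (fun a => B.hom_ext (vertex_vertex a) (vertex_word a)) fun l hl =>
    B.hom_ext (fun a => word_vertex l a hl) fun m hm => word_word l m hl hm

theorem algHom_ext {M : Type*} [Ring M] [Algebra k M] {f g : A →ₐ[k] M}
    (vertex : ∀ a, f (B.vertex a) = g (B.vertex a))
    (arrow : ∀ α, f (B.word [α]) = g (B.word [α])) : f = g := by
  suffices hword : ∀ l, f (B.word l) = g (B.word l) from
    AlgHom.toLinearMap_injective (B.hom_ext vertex fun l _ => hword l)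
  intro l
  induction l with
  | nil => simp
  | cons α l ih =>
    obtain rfl | hl := eq_or_ne l []
    · exact arrow α
    · rw [B.word_cons hl, map_mul, map_mul, ih, arrow]

end Basis

/-! ## The universal property -/

section Lift

variable {V E : Type*} [Fintype V] {k A M : Type*} [Field k] [Ring A] [Algebra k A] [Ring M]
  [Algebra k M]

variable (D : GentleDatum V E) (e : V → M) (x : E → M) in
/-- The relations that the images `e` of the vertices and `x` of the arrows have to satisfy for a
homomorphism of algebras to exist. -/
structure IsRepresentation : Prop where
  vertex : CompleteOrthogonalIdempotents e
  vertex_mul_arrow : ∀ α, e (D.tgt α) * x α = x α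
  arrow_mul_vertex : ∀ α, x α * e (D.src α) = x α
  arrow_mul_arrow : ∀ β α, ¬ D.NonRel β α → x β * x α = 0

variable {D : GentleDatum V E} (B : PathBasis D k A) {e : V → M} {x : E → M} {a : V} {l : List E}

namespace IsRepresentation

theorem prod_eq_zero (h : IsRepresentation D e x) (hl : l ≠ []) (hl' : ¬ D.Good l) :
    (l.map x).prod = 0 := by
  induction l with
  | nil => exact absurd rfl hl
  | cons α l ih =>
    cases l with
    | nil => exact absurd (Good.singleton α) hl'
    | cons β l =>
      rw [good_cons_iff (l := β :: l) rfl, not_and_or] at hl'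
      obtain hl' | hl' := hl'
      · rw [List.map_cons, List.prod_cons, ih (List.cons_ne_nil β l) hl', mul_zero]
      · rw [List.map_cons, List.prod_cons, List.map_cons, List.prod_cons, ← mul_assoc,
          h.arrow_mul_arrow α β hl', zero_mul]

theorem vertex_mul_prod (h : IsRepresentation D e x) (hl : l ≠ []) :
    (D.EndsAt l a → e a * (l.map x).prod = (l.map x).prod) ∧
      (¬ D.EndsAt l a → e a * (l.map x).prod = 0) := by
  obtain ⟨α, l, rfl⟩ := List.exists_cons_of_ne_nil hl
  rw [endsAt_cons, List.map_cons, List.prod_cons, ← mul_assoc, ← h.vertex_mul_arrow α, ← mul_assoc]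
  exact ⟨fun ha => by rw [ha, (h.vertex.idem a).eq],
    fun ha => by rw [h.vertex.ortho (Ne.symm ha), zero_mul, zero_mul]⟩

theorem prod_mul_vertex (h : IsRepresentation D e x) (hl : l ≠ []) :
    (D.StartsAt l a → (l.map x).prod * e a = (l.map x).prod) ∧
      (¬ D.StartsAt l a → (l.map x).prod * e a = 0) := by
  obtain ⟨l, α, rfl⟩ := (List.eq_nil_or_concat' l).resolve_left hl
  rw [startsAt_concat, List.map_append, List.prod_append, List.map_singleton, List.prod_singleton,
    mul_assoc, ← h.arrow_mul_vertex α, mul_assoc (x α)]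
  exact ⟨fun ha => by rw [ha, (h.vertex.idem a).eq],
    fun ha => by rw [h.vertex.ortho (Ne.symm (Ne.symm ha)), mul_zero, mul_zero]⟩

end IsRepresentation

variable (e x) in
/-- The linear map underlying `lift`. -/
def liftLinear : A →ₗ[k] M := B.basis.constr k (Sum.elim e fun l => (l.1.map x).prod)

theorem liftLinear_vertex : B.liftLinear e x (B.vertex a) = e a := by simp [liftLinear, vertex]

theorem liftLinear_word (h : IsRepresentation D e x) (hl : l ≠ []) :
    B.liftLinear e x (B.word l) = (l.map x).prod := by
  by_cases hl' : D.Good l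
  · simp [liftLinear, B.word_of_good hl']
  · rw [B.word_of_not_good hl', map_zero, h.prod_eq_zero hl hl']

theorem liftLinear_mul (h : IsRepresentation D e x) (y z : A) :
    B.liftLinear e x (y * z) = B.liftLinear e x y * B.liftLinear e x z := by
  suffices (LinearMap.mul k A).compr₂ (B.liftLinear e x) =
      (LinearMap.mul k M).compl₁₂ (B.liftLinear e x) (B.liftLinear e x) from
    LinearMap.congr_fun₂ this y z
  refine B.hom_ext₂ (fun a b => ?_) (fun a l hl => ?_) (fun l a hl => ?_) fun l m hl hm => ?_
  all_goals simp only [LinearMap.compr₂_apply, LinearMap.compl₁₂_apply, LinearMap.mul_apply',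
    liftLinear_vertex]
  · obtain rfl | hab := eq_or_ne a b
    · rw [vertex_mul_vertex_self, liftLinear_vertex, (h.vertex.idem a).eq]
    · rw [B.vertex_mul_vertex_of_ne hab, map_zero, h.vertex.ortho hab]
  · by_cases ha : D.EndsAt l a
    · rw [B.vertex_mul_word_of_endsAt ha, B.liftLinear_word h hl.1, (h.vertex_mul_prod hl.1).1 ha]
    · rw [B.vertex_mul_word_of_not_endsAt ha, map_zero, B.liftLinear_word h hl.1,
        (h.vertex_mul_prod hl.1).2 ha]
  · by_cases ha : D.StartsAt l a
    · rw [B.word_mul_vertex_of_startsAt ha, B.liftLinear_word h hl.1, (h.prod_mul_vertex hl.1).1 ha]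
    · rw [B.word_mul_vertex_of_not_startsAt ha, map_zero, B.liftLinear_word h hl.1,
        (h.prod_mul_vertex hl.1).2 ha]
  · rw [B.word_mul hl.1 hm.1, B.liftLinear_word h (by simp [hl.1]), B.liftLinear_word h hl.1,
      B.liftLinear_word h hm.1, List.map_append, List.prod_append]

/-- The homomorphism of algebras with given values on the vertices and the arrows. -/
def lift (h : IsRepresentation D e x) : A →ₐ[k] M :=
  AlgHom.ofLinearMap (B.liftLinear e x)
    (by rw [← B.completeOrthogonalIdempotents_vertex.complete, map_sum, ← h.vertex.complete]
        exact Finset.sum_congr rfl fun a _ => B.liftLinear_vertex)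
    (B.liftLinear_mul h)

@[simp] theorem lift_vertex (h : IsRepresentation D e x) : B.lift h (B.vertex a) = e a :=
  B.liftLinear_vertex

theorem lift_word (h : IsRepresentation D e x) (hl : l ≠ []) :
    B.lift h (B.word l) = (l.map x).prod :=
  B.liftLinear_word h hl

end Lift

/-! ## Coefficients of products -/

section Coeff

variable {V E : Type*} [Fintype V] {D : GentleDatum V E} {k A : Type*} [Field k] [Ring A]
  [Algebra k A] (B : PathBasis D k A) {a b : V} {α β : E} {l m : List E} {x y : A}

open Classical in
variable (D k) in
theorem isRepresentation_single (a : V) :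
    IsRepresentation D (fun b => Pi.single (M := fun _ => k) b 1 a) 0 where
  vertex := (CompleteOrthogonalIdempotents.single fun _ : V => k).map
    (Pi.evalRingHom (fun _ => k) a)
  vertex_mul_arrow := by simp
  arrow_mul_vertex := by simp
  arrow_mul_arrow := by simp

/-- The coefficient of a vertex, which is multiplicative. -/
def vertexCoeff (a : V) : A →ₐ[k] k := B.lift (isRepresentation_single D k a)

@[simp] theorem vertexCoeff_vertex_self : B.vertexCoeff a (B.vertex a) = 1 := by
  simp [vertexCoeff]

theorem vertexCoeff_vertex_of_ne (h : a ≠ b) : B.vertexCoeff a (B.vertex b) = 0 := by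
  simp [vertexCoeff, h]

@[simp] theorem vertexCoeff_word : B.vertexCoeff a (B.word l) = 0 := by
  obtain rfl | hl := eq_or_ne l []
  · simp
  · rw [vertexCoeff, B.lift_word _ hl]
    exact List.prod_eq_zero (by simpa using List.exists_mem_of_ne_nil l hl)

theorem vertexCoeff_apply : B.vertexCoeff a x = B.basis.repr x (Sum.inl a) := by
  suffices (B.vertexCoeff a).toLinearMap = B.basis.coord (Sum.inl a) from
    LinearMap.congr_fun this x
  refine B.hom_ext (fun b => ?_) fun l hl => ?_
  · change B.vertexCoeff a (B.vertex b) = B.basis.coord _ (B.vertex b)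
    obtain rfl | hab := eq_or_ne a b
    · rw [vertexCoeff_vertex_self]
      simp [vertex]
    · rw [B.vertexCoeff_vertex_of_ne hab]
      simp [vertex, hab.symm]
  · change B.vertexCoeff a (B.word l) = B.basis.coord _ (B.word l)
    rw [vertexCoeff_word]
    simp [B.word_of_good hl]

theorem coeff_word_mul_self (hl : D.Good l) (ha : D.StartsAt l a) (y : A) :
    B.coeff l (B.word l * y) = B.vertexCoeff a y := by
  suffices B.coeff l ∘ₗ LinearMap.mulLeft k (B.word l) = (B.vertexCoeff a).toLinearMap from
    LinearMap.congr_fun this y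
  obtain ⟨m, β, rfl⟩ := (List.eq_nil_or_concat' l).resolve_left hl.1
  rw [startsAt_concat] at ha
  refine B.hom_ext (fun b => ?_) fun n hn => ?_
  · change B.coeff _ (B.word _ * B.vertex b) = B.vertexCoeff a (B.vertex b)
    obtain rfl | hab := eq_or_ne a b
    · rw [B.word_mul_vertex_of_startsAt (startsAt_concat.2 ha), B.coeff_word_self hl,
        vertexCoeff_vertex_self]
    · rw [B.word_mul_vertex_of_not_startsAt (by rwa [startsAt_concat, ha]), map_zero,
        B.vertexCoeff_vertex_of_ne hab]
  · change B.coeff _ (B.word _ * B.word n) = B.vertexCoeff a (B.word n)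
    rw [B.word_mul hl.1 hn.1, B.coeff_word_of_ne (by simpa using hn.1), vertexCoeff_word]

theorem coeff_mul_word_self (hl : D.Good l) (ha : D.EndsAt l a) (y : A) :
    B.coeff l (y * B.word l) = B.vertexCoeff a y := by
  suffices B.coeff l ∘ₗ LinearMap.mulRight k (B.word l) = (B.vertexCoeff a).toLinearMap from
    LinearMap.congr_fun this y
  obtain ⟨β, m, rfl⟩ := List.exists_cons_of_ne_nil hl.1
  rw [endsAt_cons] at ha
  refine B.hom_ext (fun b => ?_) fun n hn => ?_
  · change B.coeff _ (B.vertex b * B.word _) = B.vertexCoeff a (B.vertex b)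
    obtain rfl | hab := eq_or_ne a b
    · rw [B.vertex_mul_word_of_endsAt (endsAt_cons.2 ha), B.coeff_word_self hl,
        vertexCoeff_vertex_self]
    · rw [B.vertex_mul_word_of_not_endsAt (by rwa [endsAt_cons, ha]), map_zero,
        B.vertexCoeff_vertex_of_ne hab]
  · change B.coeff _ (B.word n * B.word _) = B.vertexCoeff a (B.word n)
    rw [B.word_mul hn.1 hl.1, B.coeff_word_of_ne (by simpa using hn.1), vertexCoeff_word]

theorem coeff_word_mul_of_not_prefix (h : ¬ m <+: l) (y : A) : B.coeff l (B.word m * y) = 0 := by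
  suffices B.coeff l ∘ₗ LinearMap.mulLeft k (B.word m) = 0 from LinearMap.congr_fun this y
  have hm : m ≠ [] := by
    rintro rfl
    exact h List.nil_prefix
  refine B.hom_ext (fun b => ?_) fun n hn => ?_
  · change B.coeff l (B.word m * B.vertex b) = 0
    by_cases hb : D.StartsAt m b
    · rw [B.word_mul_vertex_of_startsAt hb, B.coeff_word_of_ne]
      rintro rfl
      exact h List.prefix_rfl
    · rw [B.word_mul_vertex_of_not_startsAt hb, map_zero]
  · change B.coeff l (B.word m * B.word n) = 0
    rw [B.word_mul hm hn.1, B.coeff_word_of_ne]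
    rintro rfl
    exact h (List.prefix_append m n)

theorem coeff_mul_word_of_not_suffix (h : ¬ m <:+ l) (y : A) : B.coeff l (y * B.word m) = 0 := by
  suffices B.coeff l ∘ₗ LinearMap.mulRight k (B.word m) = 0 from LinearMap.congr_fun this y
  have hm : m ≠ [] := by
    rintro rfl
    exact h List.nil_suffix
  refine B.hom_ext (fun b => ?_) fun n hn => ?_
  · change B.coeff l (B.vertex b * B.word m) = 0
    by_cases hb : D.EndsAt m b
    · rw [B.vertex_mul_word_of_endsAt hb, B.coeff_word_of_ne]
      rintro rfl
      exact h List.suffix_rfl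
    · rw [B.vertex_mul_word_of_not_endsAt hb, map_zero]
  · change B.coeff l (B.word n * B.word m) = 0
    rw [B.word_mul hn.1 hm, B.coeff_word_of_ne]
    rintro rfl
    exact h (List.suffix_append n m)

theorem coeff_singleton_mul_vertex :
    B.coeff [α] (x * B.vertex b) = B.coeff [α] x * B.vertexCoeff (D.src α) (B.vertex b) := by
  suffices B.coeff [α] ∘ₗ LinearMap.mulRight k (B.vertex b) =
      B.vertexCoeff (D.src α) (B.vertex b) • B.coeff [α] by
    simpa [mul_comm] using LinearMap.congr_fun this x
  refine B.hom_ext (fun a => ?_) fun l hl => ?_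
  · change B.coeff [α] (B.vertex a * B.vertex b) = B.vertexCoeff _ _ • B.coeff [α] (B.vertex a)
    obtain rfl | hab := eq_or_ne a b
    · simp
    · simp [B.vertex_mul_vertex_of_ne hab]
  change B.coeff [α] (B.word l * B.vertex b) = B.vertexCoeff _ _ • B.coeff [α] (B.word l)
  obtain rfl | h := eq_or_ne l [α]
  · by_cases hb : D.StartsAt [α] b
    · rw [B.word_mul_vertex_of_startsAt hb, startsAt_singleton.1 hb, vertexCoeff_vertex_self,
        one_smul]
    · rw [B.word_mul_vertex_of_not_startsAt hb,
        B.vertexCoeff_vertex_of_ne fun h => hb (startsAt_singleton.2 h), zero_smul, map_zero]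
  · by_cases hb : D.StartsAt l b
    · simp [B.word_mul_vertex_of_startsAt hb, B.coeff_word_of_ne h.symm]
    · simp [B.word_mul_vertex_of_not_startsAt hb, B.coeff_word_of_ne h.symm]

theorem coeff_singleton_mul : B.coeff [α] (x * y) =
    B.vertexCoeff (D.tgt α) x * B.coeff [α] y + B.coeff [α] x * B.vertexCoeff (D.src α) y := by
  suffices B.coeff [α] ∘ₗ LinearMap.mulLeft k x = B.vertexCoeff (D.tgt α) x • B.coeff [α] +
      B.coeff [α] x • (B.vertexCoeff (D.src α)).toLinearMap from LinearMap.congr_fun this y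
  refine B.hom_ext (fun b => ?_) fun l hl => ?_
  · simpa using B.coeff_singleton_mul_vertex
  · change B.coeff [α] (x * B.word l) = B.vertexCoeff _ x • B.coeff [α] (B.word l) +
      B.coeff [α] x • B.vertexCoeff _ (B.word l)
    obtain rfl | h := eq_or_ne l [α]
    · rw [B.coeff_mul_word_self hl (endsAt_cons.2 rfl), B.coeff_word_self hl]
      simp
    · have h' : ¬ l <:+ [α] := by simp [List.suffix_cons_iff, h, hl.1]
      rw [B.coeff_mul_word_of_not_suffix h', B.coeff_word_of_ne h.symm]
      simp

end Coeff

/-! ## The radical -/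

section Radical

variable {V E : Type*} [Fintype V] {D : GentleDatum V E} {k A : Type*} [Field k] [Ring A]
  [Algebra k A] (B : PathBasis D k A) {α β : E} {l : List E} {x y : A}

/-- The span of the paths of positive length. -/
def radical : Submodule k A := Submodule.span k (Set.range B.word)

theorem word_mem_radical : B.word l ∈ B.radical := Submodule.subset_span ⟨l, rfl⟩

theorem mem_radical : x ∈ B.radical ↔ ∀ a, B.vertexCoeff a x = 0 := by
  constructor
  · intro hx a
    have : B.radical ≤ LinearMap.ker (B.vertexCoeff a).toLinearMap := by
      rw [radical, Submodule.span_le]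
      rintro _ ⟨l, rfl⟩
      exact B.vertexCoeff_word
    exact this hx
  · intro h
    rw [← B.basis.linearCombination_repr x, Finsupp.linearCombination_apply]
    refine Submodule.sum_mem _ fun i _ => ?_
    obtain a | l := i
    · change B.basis.repr x (Sum.inl a) • B.basis (Sum.inl a) ∈ B.radical
      rw [← B.vertexCoeff_apply, h a, zero_smul]
      exact zero_mem _
    · change B.basis.repr x (Sum.inr l) • B.basis (Sum.inr l) ∈ B.radical
      rw [← B.word_of_good l.2]
      exact Submodule.smul_mem _ _ B.word_mem_radical

theorem coeff_singleton_mul_of_mem_radical (hx : x ∈ B.radical) (hy : y ∈ B.radical) :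
    B.coeff [α] (x * y) = 0 := by
  simp [coeff_singleton_mul, B.mem_radical.1 hx, B.mem_radical.1 hy]

theorem coeff_pair_word_mul (h : D.NonRel β α) (hy : y ∈ B.radical) :
    B.coeff [β, α] (B.word l * y) = B.coeff [β] (B.word l) * B.coeff [α] y := by
  refine LinearMap.eqOn_span (f := B.coeff [β, α] ∘ₗ LinearMap.mulLeft k (B.word l))
    (g := B.coeff [β] (B.word l) • B.coeff [α]) ?_ hy
  rintro _ ⟨m, rfl⟩
  change B.coeff [β, α] (B.word l * B.word m) = B.coeff [β] (B.word l) * B.coeff [α] (B.word m)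
  obtain rfl | hl := eq_or_ne l []
  · simp
  obtain rfl | hm := eq_or_ne m []
  · simp
  rw [B.word_mul hl hm]
  obtain rfl | hlβ := eq_or_ne l [β]
  · rw [B.coeff_word_self (Good.singleton β), one_mul]
    obtain rfl | hmα := eq_or_ne m [α]
    · rw [B.coeff_word_self (Good.singleton α)]
      exact B.coeff_word_self ((good_cons_iff rfl).2 ⟨Good.singleton α, h⟩)
    · rw [B.coeff_word_of_ne hmα.symm, B.coeff_word_of_ne (by simpa using hmα.symm)]
  · rw [B.coeff_word_of_ne hlβ.symm, zero_mul, B.coeff_word_of_ne]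
    intro hlm
    obtain ⟨γ, l, rfl⟩ := List.exists_cons_of_ne_nil hl
    obtain ⟨δ, m, rfl⟩ := List.exists_cons_of_ne_nil hm
    cases l <;> simp_all

theorem coeff_pair_mul_of_mem_radical (h : D.NonRel β α) (hx : x ∈ B.radical)
    (hy : y ∈ B.radical) : B.coeff [β, α] (x * y) = B.coeff [β] x * B.coeff [α] y := by
  rw [mul_comm]
  refine LinearMap.eqOn_span (f := B.coeff [β, α] ∘ₗ LinearMap.mulRight k y)
    (g := B.coeff [α] y • B.coeff [β]) ?_ hx
  rintro _ ⟨l, rfl⟩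
  exact (B.coeff_pair_word_mul h hy).trans (mul_comm _ _)

theorem radical_pow_le (n : ℕ) :
    B.radical ^ (n + 1) ≤ Submodule.span k (B.word '' {l | n < l.length}) := by
  induction n with
  | zero =>
    rw [zero_add, pow_one, radical, Submodule.span_le]
    rintro _ ⟨l, rfl⟩
    obtain rfl | hl := eq_or_ne l []
    · simp
    · exact Submodule.subset_span ⟨l, List.length_pos_iff.2 hl, rfl⟩
  | succ n ih =>
    rw [pow_succ]
    refine (mul_le_mul_left ih B.radical).trans ?_
    rw [radical, Submodule.span_mul_span, Submodule.span_le]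
    rintro _ ⟨_, ⟨l, hl, rfl⟩, _, ⟨m, rfl⟩, rfl⟩
    obtain rfl | hm := eq_or_ne m []
    · simp
    have := List.length_pos_iff.2 hm
    rw [Set.mem_ofPred_eq] at hl
    refine Submodule.subset_span ⟨l ++ m, by simp; omega, ?_⟩
    exact (B.word_mul (List.length_pos_iff.1 (by omega)) hm).symm

theorem exists_radical_pow_eq_bot : ∃ n, B.radical ^ n = ⊥ := by
  obtain ⟨L, hL⟩ := D.bounded
  refine ⟨L + 1, eq_bot_iff.2 ((B.radical_pow_le L).trans ?_)⟩
  rw [Submodule.span_le]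
  rintro _ ⟨l, hl, rfl⟩
  exact B.word_of_not_good fun h => (hL l h.2).not_gt hl

end Radical

end PathBasis

/-! ## The automorphisms given by detours -/

namespace GentleDatum

variable {V E : Type*} (D : GentleDatum V E) {α β : E}

/-- The arrows to which a multiple of a parallel path can be added: those outside of all relations
that have a detour. -/
def Movable (α : E) : Prop := D.Free α ∧ D.detour α ≠ []

variable {D}

theorem Movable.isDetour (h : D.Movable α) : D.IsDetour α (D.detour α) := isDetour_detour h.2

theorem Movable.detour_ne_singleton (h : D.Movable α) (hβ : D.Free β) : D.detour α ≠ [β] := by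
  intro heq
  obtain ⟨-, hs, ht, hhead, -⟩ := h.isDetour
  rw [heq] at hs ht hhead
  obtain rfl := D.parallel_free (startsAt_singleton.1 hs).symm (endsAt_cons.1 ht).symm h.1 hβ
  exact hhead rfl

end GentleDatum

namespace PathBasis

open GentleDatum

section Deform

variable {V E : Type*} [Fintype V] {D : GentleDatum V E} {k A : Type*} [Field k] [Ring A]
  [Algebra k A] (B : PathBasis D k A) {n n' : E → k} {t t' : E → kˣ} {a : V} {α β : E} {l : List E}

open Classical in
/-- The multiple of a parallel path that is added to an arrow. -/
def detourTerm (n : E → k) (α : E) : A := if D.Movable α then n α • B.word (D.detour α) else 0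

theorem detourTerm_of_movable (h : D.Movable α) :
    B.detourTerm n α = n α • B.word (D.detour α) := if_pos h

theorem detourTerm_of_not_movable (h : ¬ D.Movable α) : B.detourTerm n α = 0 := if_neg h

theorem detourTerm_mul_word (hl : l ≠ []) : B.detourTerm n α * B.word l = 0 := by
  by_cases h : D.Movable α
  · rw [B.detourTerm_of_movable h, smul_mul_assoc, B.word_mul h.2 hl,
      B.word_of_not_good (h.isDetour.not_good_append h.1 hl), smul_zero]
  · rw [B.detourTerm_of_not_movable h, zero_mul]

theorem word_mul_detourTerm (hl : l ≠ []) : B.word l * B.detourTerm n α = 0 := by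
  by_cases h : D.Movable α
  · rw [B.detourTerm_of_movable h, mul_smul_comm, B.word_mul hl h.2,
      B.word_of_not_good (h.isDetour.not_good_prepend h.1 hl), smul_zero]
  · rw [B.detourTerm_of_not_movable h, mul_zero]

theorem detourTerm_mul_detourTerm : B.detourTerm n α * B.detourTerm n β = 0 := by
  by_cases h : D.Movable β
  · rw [B.detourTerm_of_movable h, mul_smul_comm, B.detourTerm_mul_word h.2, smul_zero]
  · rw [B.detourTerm_of_not_movable h, mul_zero]

theorem vertex_tgt_mul_detourTerm :
    B.vertex (D.tgt α) * B.detourTerm n α = B.detourTerm n α := by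
  by_cases h : D.Movable α
  · rw [B.detourTerm_of_movable h, mul_smul_comm, B.vertex_mul_word_of_endsAt h.isDetour.2.2.1]
  · rw [B.detourTerm_of_not_movable h, mul_zero]

theorem detourTerm_mul_vertex_src :
    B.detourTerm n α * B.vertex (D.src α) = B.detourTerm n α := by
  by_cases h : D.Movable α
  · rw [B.detourTerm_of_movable h, smul_mul_assoc, B.word_mul_vertex_of_startsAt h.isDetour.2.1]
  · rw [B.detourTerm_of_not_movable h, zero_mul]

theorem vertex_tgt_mul_arrow : B.vertex (D.tgt α) * B.word [α] = B.word [α] :=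
  B.vertex_mul_word_of_endsAt (endsAt_cons.2 rfl)

theorem arrow_mul_vertex_src : B.word [α] * B.vertex (D.src α) = B.word [α] :=
  B.word_mul_vertex_of_startsAt (startsAt_singleton.2 rfl)

theorem arrow_mul_arrow_of_not_nonRel (h : ¬ D.NonRel β α) : B.word [β] * B.word [α] = 0 := by
  rw [← B.word_cons (List.cons_ne_nil α []), B.word_of_not_good]
  exact fun hg => h ((good_cons_iff rfl).1 hg).2

theorem isRepresentation_deform (n : E → k) (t : E → kˣ) : IsRepresentation D B.vertex
    fun α => (t α : k) • (B.word [α] + B.detourTerm n α) where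
  vertex := B.completeOrthogonalIdempotents_vertex
  vertex_mul_arrow α := by
    rw [mul_smul_comm, mul_add, vertex_tgt_mul_arrow, vertex_tgt_mul_detourTerm]
  arrow_mul_vertex α := by
    rw [smul_mul_assoc, add_mul, arrow_mul_vertex_src, detourTerm_mul_vertex_src]
  arrow_mul_arrow β α h := by
    rw [smul_mul_smul_comm, add_mul, mul_add, mul_add, B.arrow_mul_arrow_of_not_nonRel h,
      B.word_mul_detourTerm (List.cons_ne_nil β []), B.detourTerm_mul_word (List.cons_ne_nil α []),
      detourTerm_mul_detourTerm]
    simp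

/-- The homomorphism that fixes the vertices, adds multiples of parallel paths to the arrows and
scales the result by `t`. -/
def deform (n : E → k) (t : E → kˣ) : A →ₐ[k] A := B.lift (B.isRepresentation_deform n t)

@[simp] theorem deform_vertex : B.deform n t (B.vertex a) = B.vertex a := B.lift_vertex _

theorem deform_arrow :
    B.deform n t (B.word [α]) = (t α : k) • (B.word [α] + B.detourTerm n α) := by
  rw [deform, B.lift_word _ (List.cons_ne_nil α []), List.map_singleton, List.prod_singleton]

theorem deform_word_cons (hl : l ≠ []) : B.deform n t (B.word (α :: l)) =
    (((α :: l).map t).prod : k) • B.word (α :: l) := by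
  induction l generalizing α with
  | nil => exact absurd rfl hl
  | cons β l ih =>
    rw [B.word_cons hl, map_mul, deform_arrow, List.map_cons, List.prod_cons, Units.val_mul]
    obtain rfl | hl' := eq_or_ne l []
    · rw [deform_arrow, smul_mul_smul_comm, add_mul, mul_add, mul_add,
        B.word_mul_detourTerm (List.cons_ne_nil α []), B.detourTerm_mul_word hl,
        detourTerm_mul_detourTerm]
      simp
    · rw [ih hl', smul_mul_smul_comm, add_mul, B.detourTerm_mul_word hl, add_zero]

theorem deform_word_of_ne_singleton (hl : ∀ α, l ≠ [α]) :
    B.deform n t (B.word l) = ((l.map t).prod : k) • B.word l := by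
  cases l with
  | nil => simp
  | cons α l => exact B.deform_word_cons fun h => hl α (by rw [h])

theorem deform_detour (h : D.Movable α) : B.deform n t (B.word (D.detour α)) =
    (((D.detour α).map t).prod : k) • B.word (D.detour α) := by
  by_cases hβ : ∃ β, D.detour α = [β]
  · obtain ⟨β, hβ⟩ := hβ
    have : ¬ D.Movable β := fun h' => h.detour_ne_singleton h'.1 hβ
    rw [hβ, deform_arrow, B.detourTerm_of_not_movable this]
    simp
  · exact B.deform_word_of_ne_singleton (not_exists.1 hβ)

theorem deform_one : B.deform 0 1 = AlgHom.id k A := by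
  refine B.algHom_ext (by simp) fun α => ?_
  simp [deform_arrow, detourTerm]

theorem deform_comp_deform {n'' : E → k} (h : ∀ α, D.Movable α →
      n'' α = n α + (((D.detour α).map t).prod / t α : kˣ) * n' α) :
    (B.deform n t).comp (B.deform n' t') = B.deform n'' (t * t') := by
  refine B.algHom_ext (by simp) fun α => ?_
  rw [AlgHom.comp_apply, deform_arrow, deform_arrow, map_smul, map_add, deform_arrow,
    Pi.mul_apply, Units.val_mul, mul_comm, mul_smul]
  congr 1
  by_cases hα : D.Movable α
  · rw [B.detourTerm_of_movable hα, B.detourTerm_of_movable hα, B.detourTerm_of_movable hα,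
      map_smul, B.deform_detour hα, h α hα, Units.val_div_eq_div_val, smul_add, smul_add, add_assoc,
      smul_smul, smul_smul, smul_smul, ← add_smul, mul_add, ← mul_assoc,
      mul_div_cancel₀ _ (t α).ne_zero, mul_comm (n' α)]
  · simp only [B.detourTerm_of_not_movable hα, map_zero, add_zero]

end Deform

/-! ## The action of automorphisms on vertices and arrows -/

section Action

variable {V E : Type*} [Fintype V] {D : GentleDatum V E} {k A : Type*} [Field k] [Ring A]
  [Algebra k A] (B : PathBasis D k A) {a b : V} {α β α' β' : E} {l : List E} {x : A}

/-- The automorphism induces the identity on the quotient by the radical. -/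
def FixesVertices (f : A ≃ₐ[k] A) : Prop := ∀ a, B.vertexCoeff a (f (B.vertex a)) = 1

/-- The matrix coefficients of the action on the quotient of the radical by its square. -/
def arrowCoeff (f : A ≃ₐ[k] A) (α β : E) : k := B.coeff [β] (f (B.word [α]))

variable {B} in
theorem map_mem_radical (f : A ≃ₐ[k] A) (hx : x ∈ B.radical) : f x ∈ B.radical := by
  obtain ⟨n, hn⟩ := B.exists_radical_pow_eq_bot
  have hpow : x ^ n = 0 := by simpa [hn] using Submodule.pow_mem_pow _ hx n
  refine B.mem_radical.2 fun a => eq_zero_of_pow_eq_zero (n := n) ?_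
  rw [← map_pow, ← map_pow, hpow, map_zero, map_zero]

theorem map_word_mem_radical (f : A ≃ₐ[k] A) : f (B.word l) ∈ B.radical :=
  map_mem_radical f B.word_mem_radical

theorem vertexCoeff_map_vertex (f : A ≃ₐ[k] A) :
    B.vertexCoeff a (f (B.vertex b)) = 0 ∨ B.vertexCoeff a (f (B.vertex b)) = 1 := by
  refine IsIdempotentElem.iff_eq_zero_or_one.1 ?_
  rw [IsIdempotentElem, ← map_mul, ← map_mul, vertex_mul_vertex_self]

theorem coeff_singleton_map [Fintype E] (f : A ≃ₐ[k] A) (hx : x ∈ B.radical) :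
    B.coeff [α] (f x) = ∑ β, B.coeff [β] x * B.arrowCoeff f β α := by
  suffices Set.EqOn (B.coeff [α] ∘ₗ f.toLinearMap)
      (∑ β, B.arrowCoeff f β α • B.coeff [β] : A →ₗ[k] k) B.radical by
    simpa [mul_comm] using this hx
  refine LinearMap.eqOn_span ?_
  rintro _ ⟨l, rfl⟩
  change B.coeff [α] (f (B.word l)) = _
  simp only [LinearMap.sum_apply, LinearMap.smul_apply, smul_eq_mul]
  cases l with
  | nil => simp
  | cons γ l =>
    obtain rfl | hl := eq_or_ne l []
    · rw [Finset.sum_eq_single γ (fun β _ hβ => ?_) (by simp),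
        B.coeff_word_self (Good.singleton γ), mul_one, arrowCoeff]
      rw [B.coeff_word_of_ne (by simpa using hβ), mul_zero]
    · rw [Finset.sum_eq_zero fun β _ => ?_, B.word_cons hl, map_mul,
        B.coeff_singleton_mul_of_mem_radical (B.map_word_mem_radical f) (B.map_word_mem_radical f)]
      rw [B.coeff_word_of_ne (by simp [hl.symm]), mul_zero]

theorem arrowCoeff_mul [Fintype E] (f g : A ≃ₐ[k] A) :
    B.arrowCoeff (f * g) α β = ∑ γ, B.arrowCoeff g α γ * B.arrowCoeff f γ β :=
  B.coeff_singleton_map f (B.map_word_mem_radical g)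

theorem sum_arrowCoeff_mul_inv [Fintype E] (f : A ≃ₐ[k] A) (α : E) :
    ∑ β, B.arrowCoeff f α β * B.arrowCoeff f⁻¹ β α = 1 := by
  rw [← B.arrowCoeff_mul, inv_mul_cancel]
  exact B.coeff_word_self (Good.singleton α)

theorem exists_arrowCoeff_ne_zero [Finite E] (f : A ≃ₐ[k] A) (α : E) :
    ∃ β, B.arrowCoeff f α β ≠ 0 := by
  have := Fintype.ofFinite E
  by_contra! h
  simpa [h] using B.sum_arrowCoeff_mul_inv f α

variable {B} in
theorem not_nonRel_of_arrowCoeff_ne_zero {f : A ≃ₐ[k] A} (h : ¬ D.NonRel β α)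
    (hβ : B.arrowCoeff f β β' ≠ 0) (hα : B.arrowCoeff f α α' ≠ 0) : ¬ D.NonRel β' α' := by
  intro h'
  refine mul_ne_zero hβ hα ?_
  rw [arrowCoeff, arrowCoeff, ← B.coeff_pair_mul_of_mem_radical h' (B.map_word_mem_radical f)
    (B.map_word_mem_radical f), ← map_mul, B.arrow_mul_arrow_of_not_nonRel h, map_zero, map_zero]

namespace FixesVertices

variable {B} {f : A ≃ₐ[k] A}

theorem vertexCoeff_map (hf : B.FixesVertices f) : B.vertexCoeff a (f x) = B.vertexCoeff a x := by
  suffices (B.vertexCoeff a).comp f = B.vertexCoeff a from DFunLike.congr_fun this x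
  refine B.algHom_ext (fun b => ?_) fun α => ?_
  · change B.vertexCoeff a (f (B.vertex b)) = _
    obtain rfl | hab := eq_or_ne a b
    · rw [hf a, vertexCoeff_vertex_self]
    · have : B.vertexCoeff a (f (B.vertex a)) * B.vertexCoeff a (f (B.vertex b)) = 0 := by
        rw [← map_mul, ← map_mul, B.vertex_mul_vertex_of_ne hab, map_zero, map_zero]
      rwa [hf a, one_mul, ← B.vertexCoeff_vertex_of_ne hab] at this
  · rw [vertexCoeff_word]
    exact B.mem_radical.1 (B.map_word_mem_radical f) a

theorem one : B.FixesVertices 1 := fun _ => B.vertexCoeff_vertex_self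

theorem parallel_of_arrowCoeff_ne_zero (hf : B.FixesVertices f) (h : B.arrowCoeff f α β ≠ 0) :
    D.src β = D.src α ∧ D.tgt β = D.tgt α := by
  have hrad := B.mem_radical.1 (B.map_word_mem_radical f (l := [α]))
  have hcoeff : B.arrowCoeff f α β = B.vertexCoeff (D.tgt β) (B.vertex (D.tgt α)) *
      B.arrowCoeff f α β * B.vertexCoeff (D.src β) (B.vertex (D.src α)) := by
    rw [arrowCoeff]
    nth_rw 1 [← B.arrow_mul_vertex_src, ← B.vertex_tgt_mul_arrow]
    rw [map_mul f, map_mul f, coeff_singleton_mul, coeff_singleton_mul, map_mul, hrad, hrad,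
      hf.vertexCoeff_map, hf.vertexCoeff_map]
    ring
  constructor
  · by_contra hne
    rw [hcoeff, B.vertexCoeff_vertex_of_ne hne, mul_zero] at h
    exact h rfl
  · by_contra hne
    rw [hcoeff, B.vertexCoeff_vertex_of_ne hne, zero_mul, zero_mul] at h
    exact h rfl

variable [Finite E]

theorem eq_of_arrowCoeff_ne_zero (hf : B.FixesVertices f) (hα : ¬ D.Free α)
    (h : B.arrowCoeff f α β ≠ 0) (h' : B.arrowCoeff f α β' ≠ 0) : β = β' := by
  obtain ⟨hs, ht⟩ := hf.parallel_of_arrowCoeff_ne_zero h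
  obtain ⟨hs', ht'⟩ := hf.parallel_of_arrowCoeff_ne_zero h'
  simp only [Free, not_forall, not_and_or] at hα
  obtain ⟨γ, ⟨hc, hγ⟩ | ⟨hc, hγ⟩⟩ := hα <;>
    obtain ⟨δ, hδ⟩ := B.exists_arrowCoeff_ne_zero f γ <;>
    obtain ⟨hsδ, htδ⟩ := hf.parallel_of_arrowCoeff_ne_zero hδ
  · exact D.rel_left_unique (htδ.trans (hc.trans hs.symm))
      (not_nonRel_of_arrowCoeff_ne_zero hγ h hδ) (htδ.trans (hc.trans hs'.symm))
      (not_nonRel_of_arrowCoeff_ne_zero hγ h' hδ)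
  · exact D.rel_right_unique (ht.trans (hc.trans hsδ.symm))
      (not_nonRel_of_arrowCoeff_ne_zero hγ hδ h) (ht'.trans (hc.trans hsδ.symm))
      (not_nonRel_of_arrowCoeff_ne_zero hγ hδ h')

end FixesVertices

/-- The automorphisms that represent elements of the neutral component of the group of outer
automorphisms. -/
def Neutral (f : A ≃ₐ[k] A) : Prop :=
  B.FixesVertices f ∧ ∀ α, ¬ D.Free α → B.arrowCoeff f α α ≠ 0

theorem Neutral.arrowCoeff_eq_zero {B : PathBasis D k A} [Finite E] {f : A ≃ₐ[k] A}
    (hf : B.Neutral f) (hα : ¬ D.Free α) (h : α ≠ β) : B.arrowCoeff f α β = 0 := by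
  by_contra hβ
  exact h (hf.1.eq_of_arrowCoeff_ne_zero hα (hf.2 α hα) hβ)

theorem Neutral.arrowCoeff_mul_inv {B : PathBasis D k A} [Finite E] {f : A ≃ₐ[k] A}
    (hf : B.Neutral f) (α : E) : B.arrowCoeff f α α * B.arrowCoeff f⁻¹ α α = 1 := by
  have := Fintype.ofFinite E
  by_cases hα : D.Free α
  · have hsum := B.sum_arrowCoeff_mul_inv f⁻¹ α
    rw [inv_inv, Finset.sum_eq_single α (fun β _ hβ => ?_) (by simp)] at hsum
    · rwa [mul_comm]
    suffices B.arrowCoeff f β α = 0 by rw [this, mul_zero]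
    by_cases hβ' : D.Free β
    · by_contra hne
      obtain ⟨hs, ht⟩ := hf.1.parallel_of_arrowCoeff_ne_zero hne
      exact hβ (D.parallel_free hs.symm ht.symm hβ' hα)
    · exact hf.arrowCoeff_eq_zero hβ' hβ
  · have hsum := B.sum_arrowCoeff_mul_inv f α
    rwa [Finset.sum_eq_single α (fun β _ hβ => ?_) (by simp)] at hsum
    rw [hf.arrowCoeff_eq_zero hα hβ.symm, zero_mul]

open Classical in
/-- The indicator function of the automorphisms that represent elements of the neutral component. -/
def neutralIndicator [Fintype E] (f : A ≃ₐ[k] A) : k :=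
  (∏ a, B.vertexCoeff a (f (B.vertex a))) *
    ∏ α with ¬ D.Free α, B.arrowCoeff f α α * B.arrowCoeff f⁻¹ α α

theorem neutralIndicator_of_neutral [Fintype E] {f : A ≃ₐ[k] A} (hf : B.Neutral f) :
    B.neutralIndicator f = 1 := by
  rw [neutralIndicator, Finset.prod_eq_one fun a _ => hf.1 a,
    Finset.prod_eq_one fun α _ => hf.arrowCoeff_mul_inv α, one_mul]

theorem neutralIndicator_of_not_neutral [Fintype E] {f : A ≃ₐ[k] A} (hf : ¬ B.Neutral f) :
    B.neutralIndicator f = 0 := by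
  classical
  rw [Neutral, not_and_or, FixesVertices] at hf
  push Not at hf
  rw [neutralIndicator, mul_eq_zero]
  obtain ⟨a, ha⟩ | ⟨α, hα, h0⟩ := hf
  · exact Or.inl (Finset.prod_eq_zero (Finset.mem_univ a)
      ((B.vertexCoeff_map_vertex f).resolve_right ha))
  · exact Or.inr (Finset.prod_eq_zero (i := α) (by simp [hα]) (by simp [h0]))

end Action

/-! ### Inner automorphisms -/

section Inner

variable {V E : Type*} [Fintype V] {D : GentleDatum V E} {k A : Type*} [Field k] [Ring A]
  [Algebra k A] (B : PathBasis D k A) {a : V} {α β : E} {y : A}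

variable (k) in
/-- Conjugation by a unit. -/
def inner (x : Aˣ) : A ≃ₐ[k] A := MulSemiringAction.toAlgAut (ConjAct Aˣ) k A (ConjAct.toConjAct x)

theorem inner_apply (x : Aˣ) (y : A) : inner k x y = x * y * (x⁻¹ : Aˣ) := rfl

theorem inner_mem_inn (x : Aˣ) : inner k x ∈ Inn k A := ⟨_, rfl⟩

theorem exists_eq_inner {f : A ≃ₐ[k] A} (h : f ∈ Inn k A) : ∃ x : Aˣ, f = inner k x := by
  obtain ⟨x, rfl⟩ := h
  exact ⟨ConjAct.ofConjAct x, rfl⟩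

theorem vertexCoeff_mul_vertexCoeff_inv (x : Aˣ) (a : V) :
    B.vertexCoeff a x * B.vertexCoeff a (x⁻¹ : Aˣ) = 1 := by
  rw [← map_mul, Units.mul_inv, map_one]

theorem vertexCoeff_unit_ne_zero (x : Aˣ) (a : V) : B.vertexCoeff a x ≠ 0 :=
  left_ne_zero_of_mul_eq_one (B.vertexCoeff_mul_vertexCoeff_inv x a)

theorem vertexCoeff_inner (x : Aˣ) : B.vertexCoeff a (inner k x y) = B.vertexCoeff a y := by
  rw [inner_apply, map_mul, map_mul, mul_right_comm, vertexCoeff_mul_vertexCoeff_inv, one_mul]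

theorem arrowCoeff_inner_mul (x : Aˣ) (f : A ≃ₐ[k] A) : B.arrowCoeff (inner k x * f) α β =
    B.vertexCoeff (D.tgt β) x * B.vertexCoeff (D.src β) (x⁻¹ : Aˣ) * B.arrowCoeff f α β := by
  have hrad := B.mem_radical.1 (B.map_word_mem_radical f (l := [α]))
  change B.coeff [β] (inner k x (f (B.word [α]))) = _
  rw [inner_apply, coeff_singleton_mul, coeff_singleton_mul, map_mul, hrad, hrad, arrowCoeff]
  ring

theorem neutral_inner_mul {x : Aˣ} {f : A ≃ₐ[k] A} :
    B.Neutral (inner k x * f) ↔ B.Neutral f := by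
  have hvertex (a : V) : B.vertexCoeff a ((inner k x * f) (B.vertex a)) =
      B.vertexCoeff a (f (B.vertex a)) := B.vertexCoeff_inner x
  simp only [Neutral, FixesVertices, hvertex, arrowCoeff_inner_mul, ne_eq, mul_eq_zero,
    B.vertexCoeff_unit_ne_zero, false_or]

end Inner

end PathBasis

/-! ## Cycles and detours in the algebra -/

namespace GentleDatum

variable {V E : Type*} {D : GentleDatum V E} {α α' : E} {l m : List E} {a : V}

theorem endsAt_cycle (a : V) : D.EndsAt (D.cycle a) a := by
  by_cases h : D.cycle a = []
  · simp [h, EndsAt]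
  · exact (isCycle_cycle h).2.2

theorem startsAt_cycle (a : V) : D.StartsAt (D.cycle a) a := by
  by_cases h : D.cycle a = []
  · simp [h, StartsAt]
  · exact (isCycle_cycle h).2.1

theorem endsAt_detour (α : E) : D.EndsAt (D.detour α) (D.tgt α) := by
  by_cases h : D.detour α = []
  · simp [h, EndsAt]
  · exact (isDetour_detour h).2.2.1

theorem startsAt_detour (α : E) : D.StartsAt (D.detour α) (D.src α) := by
  by_cases h : D.detour α = []
  · simp [h, StartsAt]
  · exact (isDetour_detour h).2.1

theorem detour_ne_cons : D.detour α ≠ α :: l := by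
  intro h
  have hα := (isDetour_detour (h ▸ List.cons_ne_nil α l)).2.2.2.1
  simp [h] at hα

theorem detour_ne_concat : D.detour α ≠ l ++ [α] := by
  intro h
  have hα := (isDetour_detour (h ▸ List.concat_ne_nil α l)).2.2.2.2
  simp [h] at hα

theorem not_prefix_detour (h : D.detour α ≠ []) : ¬ D.detour α <+: α :: m := by
  obtain ⟨β, l, hl⟩ := List.exists_cons_of_ne_nil h
  rw [hl, List.cons_prefix_cons]
  rintro ⟨rfl, -⟩
  exact detour_ne_cons hl

theorem not_suffix_detour (h : D.detour α ≠ []) : ¬ D.detour α <:+ m ++ [α] := by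
  obtain ⟨l, β, hl⟩ := (List.eq_nil_or_concat' _).resolve_left h
  rintro ⟨n, hn⟩
  rw [hl, ← List.append_assoc] at hn
  obtain rfl : β = α := by simpa using (List.append_inj' hn rfl).2
  exact detour_ne_concat hl

theorem Good.not_prefix_cons (h : D.Good (l ++ [α])) (hl : l ≠ []) : ¬ l ++ [α] <+: α :: m := by
  obtain ⟨β, l, rfl⟩ := List.exists_cons_of_ne_nil hl
  rw [List.cons_append, List.cons_prefix_cons]
  rintro ⟨rfl, -⟩
  simpa using h.nodup

theorem Good.not_suffix_concat (h : D.Good (α :: l)) (hl : l ≠ []) : ¬ α :: l <:+ m ++ [α] := by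
  obtain ⟨l, β, rfl⟩ := (List.eq_nil_or_concat' l).resolve_left hl
  rintro ⟨n, hn⟩
  rw [← List.cons_append, ← List.append_assoc] at hn
  obtain rfl : β = α := by simpa using (List.append_inj' hn rfl).2
  simpa using h.nodup

theorem Good.eq_of_concat (h : D.Good (l ++ [α])) (h' : D.Good (l ++ [α'])) (hl : l ≠ []) :
    α = α' := by
  obtain ⟨β, hβ⟩ := (h.left hl).exists_mem_getLast?
  exact D.nonRel_right_unique ((good_append_iff hβ rfl).1 h).2.2 ((good_append_iff hβ rfl).1 h').2.2

theorem Good.eq_of_cons (h : D.Good (α :: l)) (h' : D.Good (α' :: l)) (hl : l ≠ []) :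
    α = α' := by
  obtain ⟨β, hβ⟩ := (h.right (l := [α]) hl).exists_mem_head?
  exact D.nonRel_left_unique ((good_cons_iff hβ).1 h).2 ((good_cons_iff hβ).1 h').2

end GentleDatum

namespace PathBasis

open GentleDatum

section Parallel

variable {V E : Type*} [Fintype V] {D : GentleDatum V E} {k A : Type*} [Field k] [Ring A]
  [Algebra k A] (B : PathBasis D k A) {a b : V} {α : E} {l m : List E} {z : A}

/-- The element given by the cycle at a vertex, which is zero if there is none. -/
def cycleWord (a : V) : A := B.word (D.cycle a)

theorem cycleWord_of_eq_nil (h : D.cycle a = []) : B.cycleWord a = 0 := by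
  rw [cycleWord, h, word_nil]

theorem cycleWord_mul_word (hm : m ≠ []) (h : D.cycle a ≠ []) :
    B.cycleWord a * B.word m = B.word (D.cycle a ++ m) := B.word_mul h hm

theorem word_mul_cycleWord (hm : m ≠ []) (h : D.cycle a ≠ []) :
    B.word m * B.cycleWord a = B.word (m ++ D.cycle a) := B.word_mul hm h

theorem cycleWord_mul_arrow_of_not_good (h : ¬ D.Good (D.cycle a ++ [α])) :
    B.cycleWord a * B.word [α] = 0 := by
  by_cases hc : D.cycle a = []
  · rw [B.cycleWord_of_eq_nil hc, zero_mul]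
  · rw [B.cycleWord_mul_word (List.cons_ne_nil α []) hc, B.word_of_not_good h]

theorem arrow_mul_cycleWord_of_not_good (h : ¬ D.Good (α :: D.cycle a)) :
    B.word [α] * B.cycleWord a = 0 := by
  by_cases hc : D.cycle a = []
  · rw [B.cycleWord_of_eq_nil hc, mul_zero]
  · rw [B.word_mul_cycleWord (List.cons_ne_nil α []) hc, List.singleton_append,
      B.word_of_not_good h]

theorem coeff_cons_cycleWord_mul :
    B.coeff (α :: m) (B.cycleWord a * B.word [α] * z) = 0 := by
  by_cases hg : D.Good (D.cycle a ++ [α])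
  · by_cases h : D.cycle a = []
    · rw [B.cycleWord_of_eq_nil h, zero_mul, zero_mul, map_zero]
    · rw [B.cycleWord_mul_word (List.cons_ne_nil α []) h,
        B.coeff_word_mul_of_not_prefix (hg.not_prefix_cons h)]
  · rw [B.cycleWord_mul_arrow_of_not_good hg, zero_mul, map_zero]

theorem coeff_concat_mul_cycleWord :
    B.coeff (m ++ [α]) (z * (B.word [α] * B.cycleWord a)) = 0 := by
  by_cases hg : D.Good (α :: D.cycle a)
  · by_cases h : D.cycle a = []
    · rw [B.cycleWord_of_eq_nil h, mul_zero, mul_zero, map_zero]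
    · rw [B.word_mul_cycleWord (List.cons_ne_nil α []) h, List.singleton_append,
        B.coeff_mul_word_of_not_suffix (hg.not_suffix_concat h)]
  · rw [B.arrow_mul_cycleWord_of_not_good hg, mul_zero, map_zero]

theorem coeff_cons_detour_mul : B.coeff (α :: m) (B.word (D.detour α) * z) = 0 := by
  by_cases h : D.detour α = []
  · rw [h, word_nil, zero_mul, map_zero]
  · exact B.coeff_word_mul_of_not_prefix (not_prefix_detour h) z

theorem coeff_concat_mul_detour : B.coeff (m ++ [α]) (z * B.word (D.detour α)) = 0 := by
  by_cases h : D.detour α = []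
  · rw [h, word_nil, mul_zero, map_zero]
  · exact B.coeff_mul_word_of_not_suffix (not_suffix_detour h) z

/-- The span of the paths of positive length from `a` to `b`. -/
def pathSpan (a b : V) : Submodule k A :=
  Submodule.span k (B.word '' {l | D.StartsAt l a ∧ D.EndsAt l b})

theorem vertex_mul_mul_vertex_mem_pathSpan (hz : z ∈ B.radical) :
    B.vertex b * z * B.vertex a ∈ B.pathSpan a b := by
  suffices B.radical ≤ (B.pathSpan a b).comap
      (LinearMap.mulRight k (B.vertex a) ∘ₗ LinearMap.mulLeft k (B.vertex b)) from this hz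
  refine Submodule.span_le.2 ?_
  rintro _ ⟨l, rfl⟩
  change B.vertex b * B.word l * B.vertex a ∈ B.pathSpan a b
  by_cases ht : D.EndsAt l b
  · rw [B.vertex_mul_word_of_endsAt ht]
    by_cases hs : D.StartsAt l a
    · rw [B.word_mul_vertex_of_startsAt hs]
      exact Submodule.subset_span ⟨l, ⟨hs, ht⟩, rfl⟩
    · rw [B.word_mul_vertex_of_not_startsAt hs]
      exact zero_mem _
  · rw [B.vertex_mul_word_of_not_endsAt ht, zero_mul]
    exact zero_mem _

theorem coeff_smul_cycleWord_mul_arrow (h : D.cycle a ≠ [] → m ≠ D.cycle a ++ [α]) :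
    B.coeff (D.cycle a ++ [α]) (B.word m) • (B.cycleWord a * B.word [α]) = 0 := by
  by_cases hc : D.cycle a = []
  · rw [B.cycleWord_of_eq_nil hc, zero_mul, smul_zero]
  · rw [B.coeff_word_of_ne (h hc).symm, zero_smul]

theorem coeff_smul_arrow_mul_cycleWord (h : D.cycle a ≠ [] → m ≠ α :: D.cycle a) :
    B.coeff (α :: D.cycle a) (B.word m) • (B.word [α] * B.cycleWord a) = 0 := by
  by_cases hc : D.cycle a = []
  · rw [B.cycleWord_of_eq_nil hc, mul_zero, smul_zero]
  · rw [B.coeff_word_of_ne (h hc).symm, zero_smul]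

theorem eq_sum_of_mem_pathSpan (hz : z ∈ B.pathSpan (D.src α) (D.tgt α)) :
    z = B.coeff [α] z • B.word [α] +
      B.coeff (D.cycle (D.tgt α) ++ [α]) z • (B.cycleWord (D.tgt α) * B.word [α]) +
      B.coeff (α :: D.cycle (D.src α)) z • (B.word [α] * B.cycleWord (D.src α)) +
      B.coeff (D.detour α) z • B.word (D.detour α) := by
  suffices Set.EqOn (LinearMap.id : A →ₗ[k] A) ((B.coeff [α]).smulRight (B.word [α]) +
      (B.coeff (D.cycle (D.tgt α) ++ [α])).smulRight (B.cycleWord (D.tgt α) * B.word [α]) +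
      (B.coeff (α :: D.cycle (D.src α))).smulRight (B.word [α] * B.cycleWord (D.src α)) +
      (B.coeff (D.detour α)).smulRight (B.word (D.detour α)) : A →ₗ[k] A)
      (B.pathSpan (D.src α) (D.tgt α)) from
    this hz
  refine LinearMap.eqOn_span ?_
  rintro _ ⟨m, ⟨hs, ht⟩, rfl⟩
  simp only [LinearMap.id_apply, LinearMap.add_apply, LinearMap.smulRight_apply]
  by_cases hm : D.Good m
  swap
  · simp [B.word_of_not_good hm]
  obtain rfl | ⟨u, hu, rfl⟩ | ⟨v, hv, rfl⟩ | hd := hm.parallel_cases hs ht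
  · rw [B.coeff_word_self hm, B.coeff_smul_cycleWord_mul_arrow (by simp),
      B.coeff_smul_arrow_mul_cycleWord (by simp), B.coeff_word_of_ne detour_ne_cons]
    simp
  · have hne := hu.1.1
    rw [hu.eq_cycle] at hm hne ⊢
    rw [B.coeff_word_of_ne (by simpa using hne), B.coeff_word_self hm,
      B.cycleWord_mul_word (List.cons_ne_nil α []) hne,
      B.coeff_smul_arrow_mul_cycleWord fun _ h => hm.not_prefix_cons hne (by rw [h]),
      B.coeff_word_of_ne detour_ne_concat]
    simp
  · have hne := hv.1.1
    rw [hv.eq_cycle] at hm hne ⊢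
    rw [B.coeff_word_of_ne (by simpa using hne), B.coeff_word_self hm,
      B.word_mul_cycleWord (List.cons_ne_nil α []) hne,
      B.coeff_smul_cycleWord_mul_arrow fun _ h => hm.not_suffix_concat hne (by rw [h]),
      B.coeff_word_of_ne detour_ne_cons]
    simp
  · rw [hd.eq_detour] at hm ⊢
    rw [B.coeff_word_of_ne detour_ne_cons.symm, B.coeff_word_self hm,
      B.coeff_smul_cycleWord_mul_arrow fun _ => detour_ne_concat,
      B.coeff_smul_arrow_mul_cycleWord fun _ => detour_ne_cons]
    simp

end Parallel

section CycleUnit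

variable {V E : Type*} [Fintype V] {D : GentleDatum V E} {k A : Type*} [Field k] [Ring A]
  [Algebra k A] (B : PathBasis D k A) {a : V} {l : List E} (ζ : V → k)

theorem vertex_mul_cycleWord : B.vertex a * B.cycleWord a = B.cycleWord a :=
  B.vertex_mul_word_of_endsAt (endsAt_cycle a)

theorem cycleWord_mul_vertex : B.cycleWord a * B.vertex a = B.cycleWord a :=
  B.word_mul_vertex_of_startsAt (startsAt_cycle a)

theorem cycleWord_mul_cycleWord (a b : V) : B.cycleWord a * B.cycleWord b = 0 := by
  obtain rfl | hab := eq_or_ne a b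
  · by_cases h : D.cycle a = []
    · rw [B.cycleWord_of_eq_nil h, zero_mul]
    · rw [cycleWord, B.word_mul h h, B.word_of_not_good (not_good_append_self _)]
  · rw [← B.cycleWord_mul_vertex, ← B.vertex_mul_cycleWord (a := b), mul_assoc,
      ← mul_assoc (B.vertex a), B.vertex_mul_vertex_of_ne hab, zero_mul, mul_zero]

/-- A linear combination of cycles. -/
def cycleSum : A := ∑ a, ζ a • B.cycleWord a

theorem cycleSum_mem_radical : B.cycleSum ζ ∈ B.radical :=
  sum_mem fun _ _ => Submodule.smul_mem _ _ B.word_mem_radical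

theorem cycleSum_mul_self : B.cycleSum ζ * B.cycleSum ζ = 0 := by
  simp [cycleSum, Finset.sum_mul_sum, cycleWord_mul_cycleWord]

theorem cycleSum_mul_vertex (a : V) : B.cycleSum ζ * B.vertex a = ζ a • B.cycleWord a := by
  rw [cycleSum, Finset.sum_mul, Finset.sum_eq_single a (fun b _ hb => ?_) (by simp),
    smul_mul_assoc, cycleWord_mul_vertex]
  rw [smul_mul_assoc, ← cycleWord_mul_vertex, mul_assoc, B.vertex_mul_vertex_of_ne hb, mul_zero,
    smul_zero]

theorem vertex_mul_cycleSum (a : V) : B.vertex a * B.cycleSum ζ = ζ a • B.cycleWord a := by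
  rw [cycleSum, Finset.mul_sum, Finset.sum_eq_single a (fun b _ hb => ?_) (by simp),
    mul_smul_comm, vertex_mul_cycleWord]
  rw [mul_smul_comm, ← vertex_mul_cycleWord, ← mul_assoc, B.vertex_mul_vertex_of_ne hb.symm,
    zero_mul, smul_zero]

theorem cycleSum_mul_word (h : D.EndsAt l a) :
    B.cycleSum ζ * B.word l = ζ a • (B.cycleWord a * B.word l) := by
  rw [← B.vertex_mul_word_of_endsAt h, ← mul_assoc, cycleSum_mul_vertex, smul_mul_assoc,
    ← mul_assoc, cycleWord_mul_vertex]

theorem word_mul_cycleSum (h : D.StartsAt l a) :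
    B.word l * B.cycleSum ζ = ζ a • (B.word l * B.cycleWord a) := by
  rw [← B.word_mul_vertex_of_startsAt h, mul_assoc, vertex_mul_cycleSum, mul_smul_comm, mul_assoc,
    vertex_mul_cycleWord]

/-- The unit that differs from the identity by a linear combination of cycles, which is
an element of square zero. -/
def cycleUnit : Aˣ where
  val := 1 + B.cycleSum ζ
  inv := 1 - B.cycleSum ζ
  val_inv := by simp [mul_sub, add_mul, cycleSum_mul_self]
  inv_val := by simp [sub_mul, mul_add, cycleSum_mul_self]

theorem val_cycleUnit : (B.cycleUnit ζ : A) = 1 + B.cycleSum ζ := rfl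

theorem val_inv_cycleUnit : ((B.cycleUnit ζ)⁻¹ : Aˣ) = 1 - B.cycleSum ζ := rfl

theorem inner_cycleUnit_vertex : inner k (B.cycleUnit ζ) (B.vertex a) = B.vertex a := by
  rw [inner_apply, val_cycleUnit, val_inv_cycleUnit, add_mul, one_mul, cycleSum_mul_vertex, mul_sub,
    mul_one, add_mul, vertex_mul_cycleSum, smul_mul_assoc, cycleSum, Finset.mul_sum,
    Finset.sum_eq_zero fun b _ => by rw [mul_smul_comm, cycleWord_mul_cycleWord, smul_zero]]
  simp

theorem vertexCoeff_cycleUnit : B.vertexCoeff a (B.cycleUnit ζ : A) = 1 := by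
  rw [val_cycleUnit, map_add, map_one, B.mem_radical.1 (B.cycleSum_mem_radical ζ), add_zero]

theorem vertexCoeff_inv_cycleUnit : B.vertexCoeff a ((B.cycleUnit ζ)⁻¹ : Aˣ) = 1 := by
  rw [val_inv_cycleUnit, map_sub, map_one, B.mem_radical.1 (B.cycleSum_mem_radical ζ), sub_zero]

end CycleUnit

end PathBasis

/-! ## A normal form of the automorphisms that fix the vertices -/

namespace GentleDatum

variable {V E : Type*} {D : GentleDatum V E} {α β : E}

theorem good_detour_concat (hα : D.detour α ≠ []) (hβα : D.tgt β = D.src α)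
    (hrel : ¬ D.NonRel α β) : D.Good (D.detour α ++ [β]) := by
  obtain ⟨hg, hs, -, -, hlast⟩ := isDetour_detour hα
  obtain ⟨γ, hγ⟩ := hg.exists_mem_getLast?
  refine (good_append_iff hγ rfl).2 ⟨hg, Good.singleton β, by_contra fun hγβ => ?_⟩
  obtain rfl := D.rel_left_unique hβα hrel (hβα.trans (hs γ hγ).symm) hγβ
  exact hlast hγ

theorem good_cons_detour (hα : D.detour α ≠ []) (hαβ : D.tgt α = D.src β)
    (hrel : ¬ D.NonRel β α) : D.Good (β :: D.detour α) := by
  obtain ⟨hg, -, ht, hhead, -⟩ := isDetour_detour hα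
  obtain ⟨γ, hγ⟩ := hg.exists_mem_head?
  refine (good_cons_iff hγ).2 ⟨hg, by_contra fun hβγ => ?_⟩
  obtain rfl := D.rel_right_unique hαβ hrel ((ht γ hγ).trans hαβ) hβγ
  exact hhead hγ

end GentleDatum

namespace PathBasis

open GentleDatum

section NormalForm

variable {V E : Type*} [Fintype V] {D : GentleDatum V E} {k A : Type*} [Field k] [Ring A]
  [Algebra k A] (B : PathBasis D k A) {a : V} {α β : E} {l : List E} {h : A ≃ₐ[k] A}

variable {B} in
theorem map_arrow_eq_sum (hv : ∀ a, h (B.vertex a) = B.vertex a) (α : E) :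
    h (B.word [α]) = B.arrowCoeff h α α • B.word [α] +
      B.coeff (D.cycle (D.tgt α) ++ [α]) (h (B.word [α])) •
        (B.cycleWord (D.tgt α) * B.word [α]) +
      B.coeff (α :: D.cycle (D.src α)) (h (B.word [α])) •
        (B.word [α] * B.cycleWord (D.src α)) +
      B.coeff (D.detour α) (h (B.word [α])) • B.word (D.detour α) := by
  refine B.eq_sum_of_mem_pathSpan ?_
  have hpath : h (B.word [α]) = B.vertex (D.tgt α) * h (B.word [α]) * B.vertex (D.src α) := by
    rw [← hv, ← hv (D.src α), ← map_mul, ← map_mul, vertex_tgt_mul_arrow, arrow_mul_vertex_src]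
  rw [hpath]
  exact B.vertex_mul_mul_vertex_mem_pathSpan (B.map_word_mem_radical h)

theorem arrow_mul_arrow_of_good_cycle (hα : D.Good (D.cycle a ++ [α]))
    (hβ : D.Good (β :: D.cycle a)) (ha : D.cycle a ≠ []) : B.word [β] * B.word [α] = 0 := by
  refine B.arrow_mul_arrow_of_not_nonRel fun hβα => ?_
  obtain ⟨γ, u, hu⟩ := List.exists_cons_of_ne_nil ha
  rw [hu] at hα hβ
  obtain rfl := D.nonRel_right_unique ((good_cons_iff rfl).1 hβ).2 hβα
  simpa using hα.nodup

variable {B} in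
/- The product `β α` vanishes, and the cycle `c` at the vertex between `α` and `β` enters the
coefficient of the path `β c α` in the image of this product through both factors. -/
theorem coeff_cycle_add_coeff_cycle_eq_zero (hv : ∀ a, h (B.vertex a) = B.vertex a)
    (ha : D.cycle a ≠ []) (hα : D.Good (D.cycle a ++ [α])) (hβ : D.Good (β :: D.cycle a)) :
    B.arrowCoeff h β β * B.coeff (D.cycle a ++ [α]) (h (B.word [α])) +
      B.coeff (β :: D.cycle a) (h (B.word [β])) * B.arrowCoeff h α α = 0 := by
  have hgood : D.Good (β :: D.cycle a ++ [α]) := hβ.append_of_overlap (l := [β]) hα ha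
  have hβα := B.arrow_mul_arrow_of_good_cycle hα hβ ha
  obtain rfl : D.tgt α = a := by
    obtain ⟨γ, hγ⟩ := (hα.left ha).exists_mem_getLast?
    rw [← startsAt_cycle a γ hγ]
    exact D.tgt_eq_src ((good_append_iff hγ rfl).1 hα).2.2
  have hsrc : D.src β = D.tgt α := by
    obtain ⟨γ, hγ⟩ := (hα.left ha).exists_mem_head?
    rw [← endsAt_cycle (D.tgt α) γ hγ]
    exact (D.tgt_eq_src ((good_cons_iff hγ).1 hβ).2).symm
  have hcoeff :
      B.coeff (β :: (D.cycle (D.tgt α) ++ [α])) (h (B.word [β]) * h (B.word [α])) = 0 := by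
    rw [← map_mul, hβα, map_zero, map_zero]
  have eα := map_arrow_eq_sum hv α
  have eβ := map_arrow_eq_sum hv β
  rw [hsrc] at eβ
  set x := B.coeff (D.cycle (D.tgt α) ++ [α]) (h (B.word [α]))
  set y := B.coeff (β :: D.cycle (D.tgt α)) (h (B.word [β]))
  rw [eβ] at hcoeff
  simp only [add_mul, map_add, smul_mul_assoc, map_smul, B.coeff_cons_cycleWord_mul,
    B.coeff_cons_detour_mul, smul_zero, add_zero] at hcoeff
  rw [eα, ← List.cons_append] at hcoeff
  simp only [mul_add, map_add, mul_smul_comm, map_smul, B.coeff_concat_mul_cycleWord,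
    B.coeff_concat_mul_detour, smul_zero, add_zero, hβα, zero_add] at hcoeff
  have hword : B.word [β] * (B.cycleWord (D.tgt α) * B.word [α]) =
      B.word (β :: D.cycle (D.tgt α) ++ [α]) := by
    rw [B.cycleWord_mul_word (by simp) ha, ← B.word_cons (by simp), List.cons_append]
  have hzero : B.word [β] * B.cycleWord (D.tgt α) * (B.cycleWord (D.tgt α) * B.word [α]) = 0 := by
    rw [mul_assoc, ← mul_assoc (B.cycleWord _), cycleWord_mul_cycleWord, zero_mul, mul_zero]
  rw [hzero, mul_assoc, hword, B.coeff_word_self hgood] at hcoeff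
  simp only [map_zero, smul_eq_mul, mul_one] at hcoeff
  linear_combination hcoeff

theorem exists_cycle_coeff (hv : ∀ a, h (B.vertex a) = B.vertex a)
    (h0 : ∀ α, B.arrowCoeff h α α ≠ 0) (ha : D.cycle a ≠ []) : ∃ z : k,
      (∀ α, D.Good (D.cycle a ++ [α]) →
        B.coeff (D.cycle a ++ [α]) (h (B.word [α])) = -(z * B.arrowCoeff h α α)) ∧
      ∀ β, D.Good (β :: D.cycle a) →
        B.coeff (β :: D.cycle a) (h (B.word [β])) = z * B.arrowCoeff h β β := by
  by_cases hα : ∃ α, D.Good (D.cycle a ++ [α])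
  · obtain ⟨α, hα⟩ := hα
    have := h0 α
    refine ⟨-(B.coeff (D.cycle a ++ [α]) (h (B.word [α])) / B.arrowCoeff h α α),
      fun α' hα' => ?_, fun β hβ => ?_⟩
    · obtain rfl := hα.eq_of_concat hα' ha
      field_simp
    · have := coeff_cycle_add_coeff_cycle_eq_zero hv ha hα hβ
      field_simp
      linear_combination this
  by_cases hβ : ∃ β, D.Good (β :: D.cycle a)
  · obtain ⟨β, hβ⟩ := hβ
    have := h0 β
    refine ⟨B.coeff (β :: D.cycle a) (h (B.word [β])) / B.arrowCoeff h β β,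
      fun α hα' => absurd ⟨α, hα'⟩ hα, fun β' hβ' => ?_⟩
    obtain rfl := hβ.eq_of_cons hβ' ha
    field_simp
  · exact ⟨0, fun α hα' => absurd ⟨α, hα'⟩ hα, fun β hβ' => absurd ⟨β, hβ'⟩ hβ⟩

theorem exists_cycle_coeff_smul (hv : ∀ a, h (B.vertex a) = B.vertex a)
    (h0 : ∀ α, B.arrowCoeff h α α ≠ 0) : ∃ ζ : V → k, ∀ α,
      B.coeff (D.cycle (D.tgt α) ++ [α]) (h (B.word [α])) •
          (B.cycleWord (D.tgt α) * B.word [α]) =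
        -(ζ (D.tgt α) * B.arrowCoeff h α α) • (B.cycleWord (D.tgt α) * B.word [α]) ∧
      B.coeff (α :: D.cycle (D.src α)) (h (B.word [α])) •
          (B.word [α] * B.cycleWord (D.src α)) =
        (ζ (D.src α) * B.arrowCoeff h α α) • (B.word [α] * B.cycleWord (D.src α)) := by
  have (a : V) := fun ha : D.cycle a ≠ [] => B.exists_cycle_coeff hv h0 ha
  choose! ζ hζα hζβ using this
  refine ⟨ζ, fun α => ⟨?_, ?_⟩⟩
  · by_cases hc : D.cycle (D.tgt α) = []
    · simp [B.cycleWord_of_eq_nil hc]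
    by_cases hg : D.Good (D.cycle (D.tgt α) ++ [α])
    · rw [hζα _ hc α hg]
    · simp [B.cycleWord_mul_arrow_of_not_good hg]
  · by_cases hc : D.cycle (D.src α) = []
    · simp [B.cycleWord_of_eq_nil hc]
    by_cases hg : D.Good (α :: D.cycle (D.src α))
    · rw [hζβ _ hc α hg]
    · simp [B.arrow_mul_cycleWord_of_not_good hg]

variable (α) in
/-- The coefficient of the detour in the product of an arrow with the cycles at both of its ends. It
is `1` if this product is the detour, and `0` otherwise. -/
def cycleDetourCoeff : k :=
  B.coeff (D.detour α) (B.cycleWord (D.tgt α) * B.word [α] * B.cycleWord (D.src α))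

theorem cycleWord_mul_arrow_mul_cycleWord :
    B.cycleWord (D.tgt α) * B.word [α] * B.cycleWord (D.src α) =
      B.cycleDetourCoeff α • B.word (D.detour α) := by
  by_cases hu : D.cycle (D.tgt α) = []
  · simp [cycleDetourCoeff, B.cycleWord_of_eq_nil hu]
  by_cases hv : D.cycle (D.src α) = []
  · simp [cycleDetourCoeff, B.cycleWord_of_eq_nil hv]
  rw [cycleDetourCoeff, B.cycleWord_mul_word (List.cons_ne_nil α []) hu,
    B.word_mul_cycleWord (by simp) hv, List.append_assoc, List.singleton_append]
  by_cases hg : D.Good (D.cycle (D.tgt α) ++ α :: D.cycle (D.src α))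
  · have hd := ((isCycle_cycle hu).isDetour (isCycle_cycle hv) hg).eq_detour
    rw [hd] at hg ⊢
    rw [B.coeff_word_self hg, one_smul]
  · simp [B.word_of_not_good hg]

/-- The coefficient of the detour of `α` in the normal form of an automorphism that maps `α` to `z`,
where `s` is the inverse of the coefficient of `α` in `z`. With `s` as a separate argument this is a
polynomial expression. -/
def detourCoeff (α : E) (z : A) (s : k) : k :=
  B.coeff (D.detour α) z * s - B.cycleDetourCoeff α *
    (B.coeff (D.cycle (D.tgt α) ++ [α]) z * s) * (B.coeff (α :: D.cycle (D.src α)) z * s)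

/-- The common form of the images of the arrows, up to scalars, under an automorphism that fixes the
vertices. -/
def arrowForm (ζ : V → k) (n : E → k) (α : E) : A :=
  ((B.cycleUnit ζ)⁻¹ : Aˣ) * B.word [α] * B.cycleUnit ζ + n α • B.word (D.detour α)

theorem inv_cycleUnit_mul_arrow_mul_cycleUnit (ζ : V → k) :
    ((B.cycleUnit ζ)⁻¹ : Aˣ) * B.word [α] * B.cycleUnit ζ = B.word [α] -
      ζ (D.tgt α) • (B.cycleWord (D.tgt α) * B.word [α]) +
      ζ (D.src α) • (B.word [α] * B.cycleWord (D.src α)) -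
      (ζ (D.tgt α) * ζ (D.src α) * B.cycleDetourCoeff α) • B.word (D.detour α) := by
  rw [mul_smul, ← B.cycleWord_mul_arrow_mul_cycleWord, val_cycleUnit, val_inv_cycleUnit, sub_mul,
    one_mul, B.cycleSum_mul_word ζ (endsAt_cons.2 rfl), mul_add, mul_one, sub_mul,
    B.word_mul_cycleSum ζ (startsAt_singleton.2 rfl), smul_mul_assoc, mul_assoc (B.cycleWord _),
    B.word_mul_cycleSum ζ (startsAt_singleton.2 rfl), mul_smul_comm, smul_smul,
    mul_assoc (B.cycleWord _)]
  abel

theorem exists_map_arrow_eq_arrowForm (hv : ∀ a, h (B.vertex a) = B.vertex a)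
    (h0 : ∀ α, B.arrowCoeff h α α ≠ 0) : ∃ ζ : V → k, ∀ α, h (B.word [α]) =
      B.arrowCoeff h α α • B.arrowForm ζ
        (fun α => B.detourCoeff α (h (B.word [α])) (B.arrowCoeff h α α)⁻¹) α := by
  obtain ⟨ζ, hζ⟩ := B.exists_cycle_coeff_smul hv h0
  refine ⟨ζ, fun α => ?_⟩
  obtain ⟨htgt, hsrc⟩ := hζ α
  have hc := h0 α
  have hdetour : B.arrowCoeff h α α *
      B.detourCoeff α (h (B.word [α])) (B.arrowCoeff h α α)⁻¹ =
        B.coeff (D.detour α) (h (B.word [α])) +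
          B.arrowCoeff h α α * (ζ (D.tgt α) * ζ (D.src α) * B.cycleDetourCoeff α) := by
    rw [detourCoeff]
    by_cases hε : B.cycleDetourCoeff α = 0
    · simp only [hε, zero_mul, mul_zero, sub_zero, add_zero]
      field_simp
    have hne : B.cycleWord (D.tgt α) * B.word [α] * B.cycleWord (D.src α) ≠ 0 := fun h => by
      rw [cycleDetourCoeff, h, map_zero] at hε
      exact hε rfl
    have hne' := hne
    rw [mul_assoc] at hne'
    rw [smul_left_injective k (left_ne_zero_of_mul hne) htgt,
      smul_left_injective k (right_ne_zero_of_mul hne') hsrc]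
    field_simp
    ring
  have hsum := map_arrow_eq_sum hv α
  rw [htgt, hsrc] at hsum
  rw [arrowForm, smul_add, smul_smul, hdetour, inv_cycleUnit_mul_arrow_mul_cycleUnit]
  refine hsum.trans ?_
  module

variable {ζ : V → k} {n : E → k}

theorem conj_arrow_mul_conj_arrow_of_not_nonRel (u : Aˣ) (hβα : ¬ D.NonRel β α) :
    (u⁻¹ : Aˣ) * B.word [β] * u * ((u⁻¹ : Aˣ) * B.word [α] * u) = 0 := by
  calc _ = (u⁻¹ : Aˣ) * (B.word [β] * (u * (u⁻¹ : Aˣ)) * B.word [α]) * u := by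
        simp only [mul_assoc]
    _ = 0 := by
      rw [Units.mul_inv, mul_one, B.arrow_mul_arrow_of_not_nonRel hβα, mul_zero, zero_mul]

theorem coeff_detour_concat_arrowForm_mul_arrowForm (hβα : ¬ D.NonRel β α)
    (hg : D.Good (D.detour β ++ [α])) (hβ : D.detour β ≠ []) :
    B.coeff (D.detour β ++ [α]) (B.arrowForm ζ n β * B.arrowForm ζ n α) = n β := by
  have hlong : B.coeff (D.detour β ++ [α]) (B.word (D.detour β) *
      (B.cycleWord (D.tgt α) * B.word [α]) * B.cycleUnit ζ) = 0 := by
    by_cases hc : D.cycle (D.tgt α) = []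
    · simp [B.cycleWord_of_eq_nil hc]
    rw [B.cycleWord_mul_word (List.cons_ne_nil α []) hc, B.word_mul hβ (by simp),
      B.coeff_word_mul_of_not_prefix fun hp => hc (List.length_eq_zero_iff.1 ?_)]
    have := hp.length_le
    grind
  rw [arrowForm, arrowForm, mul_add, map_add, mul_smul_comm, map_smul, coeff_concat_mul_detour,
    smul_zero, add_zero, add_mul, B.conj_arrow_mul_conj_arrow_of_not_nonRel _ hβα, zero_add,
    smul_mul_assoc, map_smul, val_inv_cycleUnit, sub_mul, one_mul,
    B.cycleSum_mul_word ζ (endsAt_cons.2 rfl), sub_mul, mul_sub, ← mul_assoc,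
    B.word_mul hβ (List.cons_ne_nil α []), smul_mul_assoc, mul_smul_comm, map_sub, map_smul,
    ← mul_assoc, hlong, B.coeff_word_mul_self hg (startsAt_concat.2 rfl), vertexCoeff_cycleUnit,
    smul_zero, sub_zero, smul_eq_mul, mul_one]

theorem coeff_cons_detour_arrowForm_mul_arrowForm (hβα : ¬ D.NonRel β α)
    (hg : D.Good (β :: D.detour α)) (hα : D.detour α ≠ []) :
    B.coeff (β :: D.detour α) (B.arrowForm ζ n β * B.arrowForm ζ n α) = n α := by
  have hlong : B.coeff (β :: D.detour α) (((B.cycleUnit ζ)⁻¹ : Aˣ) *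
      (B.word [β] * (B.cycleWord (D.tgt α) * B.word (D.detour α)))) = 0 := by
    by_cases hc : D.cycle (D.tgt α) = []
    · simp [B.cycleWord_of_eq_nil hc]
    rw [B.cycleWord_mul_word hα hc, ← B.word_cons (by simp [hα]),
      B.coeff_mul_word_of_not_suffix fun hp => hc (List.length_eq_zero_iff.1 ?_)]
    have := hp.length_le
    grind
  rw [arrowForm, arrowForm, add_mul, map_add, smul_mul_assoc, map_smul, coeff_cons_detour_mul,
    smul_zero, add_zero, mul_add, B.conj_arrow_mul_conj_arrow_of_not_nonRel _ hβα, zero_add,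
    mul_smul_comm, map_smul, mul_assoc, mul_assoc, val_cycleUnit, add_mul, one_mul,
    B.cycleSum_mul_word ζ (endsAt_detour α), mul_add, mul_add, mul_smul_comm, mul_smul_comm,
    map_add, map_smul, hlong, ← B.word_cons hα, B.coeff_mul_word_self hg (endsAt_cons.2 rfl),
    vertexCoeff_inv_cycleUnit, smul_zero, add_zero, smul_eq_mul, mul_one]

theorem arrowForm_mul_arrowForm_of_not_nonRel (h0 : ∀ α, B.arrowCoeff h α α ≠ 0)
    (hform : ∀ α, h (B.word [α]) = B.arrowCoeff h α α • B.arrowForm ζ n α)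
    (hβα : ¬ D.NonRel β α) : B.arrowForm ζ n β * B.arrowForm ζ n α = 0 := by
  have hmap : h (B.word [β]) * h (B.word [α]) = 0 := by
    rw [← map_mul, B.arrow_mul_arrow_of_not_nonRel hβα, map_zero]
  rw [hform, hform α, smul_mul_smul_comm] at hmap
  exact (smul_eq_zero_iff_right (mul_ne_zero (h0 β) (h0 α))).1 hmap

theorem eq_zero_of_map_arrow_eq_arrowForm (h0 : ∀ α, B.arrowCoeff h α α ≠ 0)
    (hform : ∀ α, h (B.word [α]) = B.arrowCoeff h α α • B.arrowForm ζ n α)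
    (hα : ¬ D.Free α) (hd : D.detour α ≠ []) : n α = 0 := by
  simp only [Free, not_forall, not_and_or] at hα
  obtain ⟨β, ⟨hβα, hrel⟩ | ⟨hαβ, hrel⟩⟩ := hα
  · rw [← B.coeff_detour_concat_arrowForm_mul_arrowForm (ζ := ζ) (n := n) hrel
      (good_detour_concat hd hβα hrel) hd,
      B.arrowForm_mul_arrowForm_of_not_nonRel h0 hform hrel, map_zero]
  · rw [← B.coeff_cons_detour_arrowForm_mul_arrowForm (ζ := ζ) (n := n) hrel
      (good_cons_detour hd hαβ hrel) hd,
      B.arrowForm_mul_arrowForm_of_not_nonRel h0 hform hrel, map_zero]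

theorem inner_cycleUnit_detour_of_free (ζ : V → k) (hα : D.Free α) :
    inner k (B.cycleUnit ζ) (B.word (D.detour α)) = B.word (D.detour α) := by
  by_cases hd : D.detour α = []
  · simp only [hd, word_nil, map_zero]
  have hdet := isDetour_detour hd
  have hleft : B.cycleWord (D.tgt α) * B.word (D.detour α) = 0 := by
    by_cases hc : D.cycle (D.tgt α) = []
    · rw [B.cycleWord_of_eq_nil hc, zero_mul]
    · rw [B.cycleWord_mul_word hd hc, B.word_of_not_good (hdet.not_good_prepend hα hc)]
  have hright : B.word (D.detour α) * B.cycleWord (D.src α) = 0 := by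
    by_cases hc : D.cycle (D.src α) = []
    · rw [B.cycleWord_of_eq_nil hc, mul_zero]
    · rw [B.word_mul_cycleWord hd hc, B.word_of_not_good (hdet.not_good_append hα hc)]
  rw [inner_apply, val_cycleUnit, val_inv_cycleUnit, add_mul, one_mul,
    B.cycleSum_mul_word ζ (endsAt_detour α), hleft, smul_zero, add_zero, mul_sub, mul_one,
    B.word_mul_cycleSum ζ (startsAt_detour α), hright, smul_zero, sub_zero]

theorem exists_inner_detour_normalForm (hv : ∀ a, h (B.vertex a) = B.vertex a)
    (h0 : ∀ α, B.arrowCoeff h α α ≠ 0) :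
    ∃ x : Aˣ, (∀ a, inner k x (h (B.vertex a)) = B.vertex a) ∧
      ∀ α, inner k x (h (B.word [α])) = B.arrowCoeff h α α • (B.word [α] + B.detourTerm
        (fun α => B.detourCoeff α (h (B.word [α])) (B.arrowCoeff h α α)⁻¹) α) := by
  obtain ⟨ζ, hform⟩ := B.exists_map_arrow_eq_arrowForm hv h0
  refine ⟨B.cycleUnit ζ, fun a => by rw [hv, inner_cycleUnit_vertex], fun α => ?_⟩
  have hdetour (n : E → k) (hform : ∀ α, h (B.word [α]) = B.arrowCoeff h α α • B.arrowForm ζ n α) :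
      inner k (B.cycleUnit ζ) (n α • B.word (D.detour α)) = B.detourTerm n α := by
    by_cases hm : D.Movable α
    · rw [map_smul, B.inner_cycleUnit_detour_of_free ζ hm.1, B.detourTerm_of_movable hm]
    rw [B.detourTerm_of_not_movable hm]
    by_cases hd : D.detour α = []
    · rw [hd, word_nil, smul_zero, map_zero]
    · rw [B.eq_zero_of_map_arrow_eq_arrowForm h0 hform (fun hα => hm ⟨hα, hd⟩) hd, zero_smul,
        map_zero]
  refine (congrArg _ (hform α)).trans ?_
  rw [map_smul, arrowForm, map_add, hdetour _ hform, inner_apply]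
  simp only [mul_assoc, Units.mul_inv_cancel_left, Units.mul_inv, mul_one]

end NormalForm

end PathBasis

/-! ## A normal form of the automorphisms modulo the inner automorphisms -/

namespace PathBasis

section VertexUnit

variable {V E : Type*} [Fintype V] {D : GentleDatum V E} {k A : Type*} [Field k] [Ring A]
  [Algebra k A] (B : PathBasis D k A) {a b : V} {y : A}

/-- The linear combination of the vertices with the given coefficients. -/
def vertexSum (c : V → k) : A := ∑ a, c a • B.vertex a

theorem vertexSum_mul_vertex (c : V → k) : B.vertexSum c * B.vertex a = c a • B.vertex a := by
  rw [vertexSum, Finset.sum_mul, Finset.sum_eq_single a (fun b _ hb => ?_) (by simp)]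
  · rw [smul_mul_assoc, vertex_mul_vertex_self]
  · rw [smul_mul_assoc, B.vertex_mul_vertex_of_ne hb, smul_zero]

theorem vertex_mul_vertexSum (c : V → k) : B.vertex a * B.vertexSum c = c a • B.vertex a := by
  rw [vertexSum, Finset.mul_sum, Finset.sum_eq_single a (fun b _ hb => ?_) (by simp)]
  · rw [mul_smul_comm, vertex_mul_vertex_self]
  · rw [mul_smul_comm, B.vertex_mul_vertex_of_ne hb.symm, smul_zero]

theorem vertexSum_mul_vertexSum (c d : V → k) :
    B.vertexSum c * B.vertexSum d = B.vertexSum (c * d) := by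
  conv_lhs => rw [vertexSum.eq_1 B d, Finset.mul_sum]
  refine Finset.sum_congr rfl fun a _ => ?_
  rw [mul_smul_comm, vertexSum_mul_vertex, smul_smul, mul_comm, Pi.mul_apply]

theorem vertexSum_one : B.vertexSum (1 : V → k) = 1 := by
  simpa [vertexSum] using B.completeOrthogonalIdempotents_vertex.complete

/-- The unit given by a scalar for each vertex. -/
def vertexUnit (s : V → kˣ) : Aˣ where
  val := B.vertexSum fun a => s a
  inv := B.vertexSum fun a => (s a)⁻¹
  val_inv := by
    rw [vertexSum_mul_vertexSum, ← B.vertexSum_one]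
    congr 1
    ext a
    simp
  inv_val := by
    rw [vertexSum_mul_vertexSum, ← B.vertexSum_one]
    congr 1
    ext a
    simp

theorem inner_vertexUnit (s : V → kˣ) (hb : B.vertex b * y = y) (ha : y * B.vertex a = y) :
    inner k (B.vertexUnit s) y = ((s b / s a : kˣ) : k) • y := by
  have hleft : (B.vertexUnit s : A) * y = (s b : k) • y := by
    rw [← hb, ← mul_assoc]
    exact congrArg (· * y) (B.vertexSum_mul_vertex _) |>.trans (smul_mul_assoc _ _ _)
  have hright : y * ((B.vertexUnit s)⁻¹ : Aˣ) = (s a : k)⁻¹ • y := by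
    rw [← ha, mul_assoc]
    exact congrArg (y * ·) (B.vertex_mul_vertexSum _) |>.trans (mul_smul_comm _ _ _)
  rw [inner_apply, hleft, smul_mul_assoc, hright, smul_smul, Units.val_div_eq_div_val,
    div_eq_mul_inv]

theorem inner_vertexUnit_comp_deform (s : V → kˣ) (n : E → k) (t : E → kˣ) :
    (inner k (B.vertexUnit s) : A →ₐ[k] A).comp (B.deform n t) =
      B.deform n (t * D.coboundary s) := by
  refine B.algHom_ext (fun a => ?_) fun α => ?_
  · rw [AlgHom.comp_apply, deform_vertex, deform_vertex, AlgEquiv.toAlgHom_apply,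
      B.inner_vertexUnit s B.vertex_mul_vertex_self B.vertex_mul_vertex_self]
    simp
  · rw [AlgHom.comp_apply, deform_arrow, deform_arrow, map_smul, AlgEquiv.toAlgHom_apply,
      B.inner_vertexUnit s (b := D.tgt α) (a := D.src α), smul_smul, ← Units.val_mul]
    · rfl
    · rw [mul_add, vertex_tgt_mul_arrow, vertex_tgt_mul_detourTerm]
    · rw [add_mul, arrow_mul_vertex_src, detourTerm_mul_vertex_src]

end VertexUnit

section Straighten

variable {V E : Type*} [Fintype V] {D : GentleDatum V E} {k A : Type*} [Field k] [Ring A]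
  [Algebra k A] (B : PathBasis D k A) {f : A ≃ₐ[k] A} {a : V}

/-- The element that conjugates the vertices to their images under an automorphism. -/
def transport (f : A ≃ₐ[k] A) : A := ∑ a, f (B.vertex a) * B.vertex a

variable {B} in
theorem FixesVertices.vertexCoeff_transport (hf : B.FixesVertices f) (a : V) :
    B.vertexCoeff a (B.transport f) = 1 := by
  rw [transport, map_sum, Finset.sum_eq_single a (fun b _ hb => ?_) (by simp)]
  · rw [map_mul, hf a, vertexCoeff_vertex_self, one_mul]
  · rw [map_mul, B.vertexCoeff_vertex_of_ne hb.symm, mul_zero]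

theorem map_vertex_mul_transport :
    f (B.vertex a) * B.transport f = B.transport f * B.vertex a := by
  have hleft : f (B.vertex a) * B.transport f = f (B.vertex a) * B.vertex a := by
    rw [transport, Finset.mul_sum, Finset.sum_eq_single a (fun b _ hb => ?_) (by simp)]
    · rw [← mul_assoc, ← map_mul, vertex_mul_vertex_self]
    · rw [← mul_assoc, ← map_mul, B.vertex_mul_vertex_of_ne hb.symm, map_zero, zero_mul]
  have hright : B.transport f * B.vertex a = f (B.vertex a) * B.vertex a := by
    rw [transport, Finset.sum_mul, Finset.sum_eq_single a (fun b _ hb => ?_) (by simp)]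
    · rw [mul_assoc, vertex_mul_vertex_self]
    · rw [mul_assoc, B.vertex_mul_vertex_of_ne hb, mul_zero]
  rw [hleft, hright]

/-- The inverse of `transport` if the automorphism induces the identity modulo the radical, given
by a finite geometric series. -/
def transportInv (f : A ≃ₐ[k] A) : A :=
  ∑ i ∈ Finset.range B.exists_radical_pow_eq_bot.choose, (1 - B.transport f) ^ i

variable {B} in
theorem FixesVertices.one_sub_transport_pow (hf : B.FixesVertices f) :
    (1 - B.transport f) ^ B.exists_radical_pow_eq_bot.choose = 0 := by
  have hrad : 1 - B.transport f ∈ B.radical := B.mem_radical.2 fun a => by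
    rw [map_sub, map_one, hf.vertexCoeff_transport, sub_self]
  simpa [B.exists_radical_pow_eq_bot.choose_spec] using Submodule.pow_mem_pow _ hrad
    B.exists_radical_pow_eq_bot.choose

/-- The unit formed by `transport` and its inverse. -/
def FixesVertices.transportUnit {B : PathBasis D k A} (hf : B.FixesVertices f) : Aˣ where
  val := B.transportInv f
  inv := B.transport f
  val_inv := by
    simpa [transportInv, hf.one_sub_transport_pow] using
      geom_sum_mul_neg (1 - B.transport f) B.exists_radical_pow_eq_bot.choose
  inv_val := by
    simpa [transportInv, hf.one_sub_transport_pow] using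
      mul_neg_geom_sum (1 - B.transport f) B.exists_radical_pow_eq_bot.choose

/-- The conjugate of an automorphism that fixes the vertices. -/
def straighten (f : A ≃ₐ[k] A) (y : A) : A := B.transportInv f * f y * B.transport f

namespace FixesVertices

variable {B} (hf : B.FixesVertices f)
include hf

theorem vertexCoeff_transportUnit_inv (a : V) :
    B.vertexCoeff a (hf.transportUnit⁻¹ : Aˣ) = 1 := hf.vertexCoeff_transport a

theorem vertexCoeff_transportUnit (a : V) : B.vertexCoeff a hf.transportUnit = 1 := by
  simpa [hf.vertexCoeff_transportUnit_inv] using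
    B.vertexCoeff_mul_vertexCoeff_inv hf.transportUnit a

theorem straighten_vertex (a : V) : B.straighten f (B.vertex a) = B.vertex a := by
  rw [straighten, mul_assoc, map_vertex_mul_transport, ← mul_assoc]
  exact (congrArg (· * B.vertex a) hf.transportUnit.mul_inv).trans (one_mul _)

theorem arrowCoeff_inner_transportUnit_mul (α : E) :
    B.arrowCoeff (inner k hf.transportUnit * f) α α = B.arrowCoeff f α α := by
  rw [arrowCoeff_inner_mul, hf.vertexCoeff_transportUnit, hf.vertexCoeff_transportUnit_inv,
    one_mul, one_mul]

end FixesVertices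

end Straighten

section Normal

variable {V E : Type*} [Fintype V] {D : GentleDatum V E} {k A : Type*} [Field k] [Ring A]
  [Algebra k A] (B : PathBasis D k A) {f : A ≃ₐ[k] A}

/-- The coefficient of the detour of an arrow in the normal form of an automorphism. -/
def normalVec (f : A ≃ₐ[k] A) (α : E) : k :=
  B.detourCoeff α (B.straighten f (B.word [α])) (B.arrowCoeff f⁻¹ α α)

open Classical in
/-- The coefficients of the arrows in the normal form of an automorphism. -/
def normalTor (f : A ≃ₐ[k] A) (α : E) : kˣ :=
  if h : B.arrowCoeff f α α ≠ 0 then Units.mk0 _ h else 1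

variable {B} [Finite E]

theorem Neutral.val_normalTor (hf : B.Neutral f) (α : E) :
    (B.normalTor f α : k) = B.arrowCoeff f α α := by
  rw [normalTor, dif_pos (left_ne_zero_of_mul_eq_one (hf.arrowCoeff_mul_inv α)), Units.val_mk0]

theorem Neutral.val_normalTor_inv (hf : B.Neutral f) (α : E) :
    (B.normalTor f α : k)⁻¹ = B.arrowCoeff f⁻¹ α α := by
  rw [hf.val_normalTor, eq_inv_of_mul_eq_one_right (hf.arrowCoeff_mul_inv α)]

theorem inner_mul (x y : Aˣ) : inner k (x * y) = inner k x * inner k y :=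
  map_mul (MulSemiringAction.toAlgAut (ConjAct Aˣ) k A) (ConjAct.toConjAct x) (ConjAct.toConjAct y)

theorem Neutral.exists_inner_mul_eq_deform (hf : B.Neutral f) :
    ∃ x : Aˣ, ((inner k x * f : A ≃ₐ[k] A) : A →ₐ[k] A) =
      B.deform (B.normalVec f) (B.normalTor f) := by
  set u := hf.1.transportUnit
  have hu (α : E) : B.arrowCoeff (inner k u * f) α α = B.normalTor f α := by
    rw [hf.1.arrowCoeff_inner_transportUnit_mul, hf.val_normalTor]
  obtain ⟨y, hvertex, harrow⟩ := B.exists_inner_detour_normalForm (h := inner k u * f)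
    hf.1.straighten_vertex fun α => (hu α).symm ▸ Units.ne_zero _
  refine ⟨y * u, B.algHom_ext (fun a => ?_) fun α => ?_⟩
  · rw [inner_mul, mul_assoc, deform_vertex]
    exact hvertex a
  · rw [inner_mul, mul_assoc, deform_arrow]
    simp only [hu, hf.val_normalTor_inv] at harrow
    exact harrow α

end Normal

end PathBasis

/-! ## A parametrization of the outer automorphisms -/

theorem list_prod_map_mem {X ι M : Type*} [Group M] {S : Subgroup (X → M)} {t : X → ι → M}
    (ht : ∀ i, (fun x => t x i) ∈ S) (l : List ι) : (fun x => (l.map (t x)).prod) ∈ S := by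
  induction l with
  | nil => exact one_mem S
  | cons i l ih => exact mul_mem (ht i) ih

namespace GentleDatum

variable {V E : Type*} (D : GentleDatum V E) {k : Type*} [Field k] {T : Finset E} {α : E}

/-- The character by which the diagonal automorphisms act on the coefficient of the detour of
`α`. -/
def detourWeight (α : E) : (E → kˣ) →* kˣ where
  toFun t := ((D.detour α).map t).prod / t α
  map_one' := by simp [Pi.one_def]
  map_mul' t t' := by simp [Pi.mul_def, List.prod_map_mul, mul_div_mul_comm]

theorem detourWeight_apply (t : E → kˣ) :
    D.detourWeight α t = ((D.detour α).map t).prod / t α := rfl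

theorem detourWeight_mem_laurentMonomials :
    ⇑(D.detourWeight (k := k) α) ∈ laurentMonomials k E :=
  div_mem (list_prod_map_mem coord_mem_laurentMonomials _) (coord_mem_laurentMonomials α)

variable {D}

theorem detourWeight_coboundary (h : D.Movable α) (x : V → kˣ) :
    D.detourWeight α (D.coboundary x) = 1 := by
  obtain ⟨hgood, hs, ht, -⟩ := h.isDetour
  rw [detourWeight_apply, prod_map_coboundary x hgood hs ht, coboundary, div_self']

theorem exists_detourWeight_ne_one [Infinite k] (h : D.Movable α) :
    ∃ t : E → kˣ, D.detourWeight α t ≠ 1 := by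
  classical
  obtain ⟨c, hc⟩ := Infinite.exists_notMem_finset ({0, 1} : Finset k)
  simp only [Finset.mem_insert, Finset.mem_singleton, not_or] at hc
  lift c to kˣ using isUnit_iff_ne_zero.2 hc.1
  obtain ⟨β, l, hl⟩ := List.exists_cons_of_ne_nil h.2
  obtain ⟨hgood, -, -, hhead, -⟩ := h.isDetour
  rw [hl] at hgood hhead
  have hβ : β ∉ l := (List.nodup_cons.1 hgood.nodup).1
  have hαβ : α ≠ β := fun hαβ => hhead (hαβ ▸ rfl)
  refine ⟨Pi.mulSingle β c, fun hone => hc.2 ?_⟩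
  have hprod : (l.map (Pi.mulSingle β c)).prod = 1 := by
    refine List.prod_eq_one fun x hx => ?_
    obtain ⟨γ, hγ, rfl⟩ := List.mem_map.1 hx
    exact Pi.mulSingle_eq_of_ne (M := fun _ => kˣ) (ne_of_mem_of_not_mem hγ hβ) c
  rw [detourWeight_apply, hl, List.map_cons, List.prod_cons, hprod, Pi.mulSingle_eq_same,
    Pi.mulSingle_eq_of_ne hαβ, mul_one, div_one] at hone
  rw [hone, Units.val_one]

variable (T) in
/-- Extension by one of functions on the arrows outside of `T`. -/
abbrev extendTor : ({α // α ∉ T} → kˣ) →* (E → kˣ) :=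
  Function.ExtendByOne.hom kˣ Subtype.val

theorem extendTor_apply_of_notMem (t : {α // α ∉ T} → kˣ) (h : α ∉ T) :
    extendTor T t α = t ⟨α, h⟩ := Subtype.val_injective.extend_apply t 1 ⟨α, h⟩

theorem extendTor_apply_of_mem (t : {α // α ∉ T} → kˣ) (h : α ∈ T) : extendTor T t α = 1 :=
  Function.extend_apply' t (1 : E → kˣ) α <| by
    rintro ⟨β, rfl⟩
    exact β.2 h

theorem extendTor_restrict {t : E → kˣ} (h : ∀ α ∈ T, t α = 1) :
    extendTor T (fun α => t α) = t := by
  funext α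
  by_cases hα : α ∈ T
  · rw [extendTor_apply_of_mem _ hα, h α hα]
  · rw [extendTor_apply_of_notMem _ hα]

theorem extendTor_apply_mem_laurentMonomials (α : E) :
    (fun t : {α // α ∉ T} → kˣ => extendTor T t α) ∈ laurentMonomials k {α // α ∉ T} := by
  by_cases h : α ∈ T
  · simp only [extendTor_apply_of_mem _ h]
    exact one_mem _
  · simp only [extendTor_apply_of_notMem _ h]
    exact coord_mem_laurentMonomials _

/-- Extension by zero of functions on the movable arrows. -/
abbrev extendVec (n : {α // D.Movable α} → k) : E → k := Function.extend Subtype.val n 0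

theorem extendVec_apply (n : {α // D.Movable α} → k) (h : D.Movable α) :
    extendVec n α = n ⟨α, h⟩ := Subtype.val_injective.extend_apply n 0 ⟨α, h⟩

variable (D T) in
/-- The character by which the torus of the arrows outside of `T` acts on the coefficient of the
detour of `α`. -/
def detourChar (α : {α // D.Movable α}) : ({α // α ∉ T} → kˣ) →* kˣ :=
  (D.detourWeight α.1).comp (extendTor T)

theorem detourChar_mem_laurentMonomials (α : {α // D.Movable α}) :
    ⇑(D.detourChar (k := k) T α) ∈ laurentMonomials k {α // α ∉ T} :=
  comp_mem_of_mem_laurentMonomials extendTor_apply_mem_laurentMonomials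
    D.detourWeight_mem_laurentMonomials

theorem exists_detourChar_ne_one [Infinite k] {s : V → (E → kˣ) → kˣ}
    (hs : ∀ α ∈ T, ∀ t, t α * D.coboundary (fun a => s a t) α = 1) (α : {α // D.Movable α}) :
    ∃ t, D.detourChar (k := k) T α t ≠ 1 := by
  obtain ⟨t, ht⟩ := exists_detourWeight_ne_one (k := k) α.2
  refine ⟨fun β => (t * D.coboundary fun a => s a t) β, ?_⟩
  have hext := extendTor_restrict (t := t * D.coboundary fun a => s a t) fun β hβ => hs β hβ t
  rwa [detourChar, MonoidHom.comp_apply, hext, map_mul, detourWeight_coboundary α.2, mul_one]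

end GentleDatum

namespace PathBasis

open GentleDatum

variable {V E : Type*} [Fintype V] {D : GentleDatum V E} {k A : Type*} [Field k] [Ring A]
  [Algebra k A] (B : PathBasis D k A) {n n' : E → k} {t : E → kˣ} {α : E} {T : Finset E}

theorem deform_congr (h : ∀ α, D.Movable α → n α = n' α) : B.deform n t = B.deform n' t := by
  refine B.algHom_ext (fun a => by rw [deform_vertex, deform_vertex]) fun α => ?_
  rw [deform_arrow, deform_arrow]
  by_cases hα : D.Movable α
  · rw [B.detourTerm_of_movable hα, B.detourTerm_of_movable hα, h α hα]
  · rw [B.detourTerm_of_not_movable hα, B.detourTerm_of_not_movable hα]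

theorem coeff_singleton_deform_arrow : B.coeff [α] (B.deform n t (B.word [α])) = t α := by
  have hdetour : B.coeff [α] (B.detourTerm n α) = 0 := by
    by_cases hα : D.Movable α
    · rw [B.detourTerm_of_movable hα, map_smul,
        B.coeff_word_of_ne (hα.detour_ne_singleton hα.1).symm, smul_zero]
    · rw [B.detourTerm_of_not_movable hα, map_zero]
  rw [deform_arrow, map_smul, map_add, hdetour, B.coeff_word_self (Good.singleton α), add_zero,
    smul_eq_mul, mul_one]

section Injectivity

variable {y : Aˣ} (h : ∀ z, B.deform n t z = inner k y z)
include h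

theorem mul_vertexCoeff_src_of_deform_eq_inner (α : E) :
    t α * B.vertexCoeff (D.src α) y = B.vertexCoeff (D.tgt α) y := by
  have hcoeff : B.arrowCoeff (inner k y) α α = t α := by
    rw [arrowCoeff, ← h, coeff_singleton_deform_arrow]
  rw [← mul_one (inner k y), arrowCoeff_inner_mul, arrowCoeff, AlgEquiv.one_apply,
    B.coeff_word_self (Good.singleton α), mul_one] at hcoeff
  rw [← hcoeff, mul_assoc, mul_comm (B.vertexCoeff _ (y⁻¹ : Aˣ)), vertexCoeff_mul_vertexCoeff_inv,
    mul_one]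

theorem eq_zero_of_deform_eq_inner (hα : D.Movable α) (ht : t α = 1) : n α = 0 := by
  have hmul : (B.word [α] + n α • B.word (D.detour α)) * y = y * B.word [α] := by
    rw [← B.detourTerm_of_movable hα, ← one_smul k (_ + _), ← Units.val_one, ← ht, ← deform_arrow,
      h, inner_apply, Units.inv_mul_cancel_right]
  obtain ⟨hgood, hs, -, hhead, hlast⟩ := hα.isDetour
  have hprefix : ¬ [α] <+: D.detour α := by
    rintro ⟨l, hl⟩
    exact hhead (hl ▸ rfl)
  have hsuffix : ¬ [α] <:+ D.detour α := by
    rintro ⟨l, hl⟩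
    exact hlast (hl ▸ List.getLast?_concat)
  have hcoeff := congrArg (B.coeff (D.detour α)) hmul
  rw [add_mul, map_add, B.coeff_word_mul_of_not_prefix hprefix,
    B.coeff_mul_word_of_not_suffix hsuffix, smul_mul_assoc, map_smul,
    B.coeff_word_mul_self hgood hs, zero_add, smul_eq_mul] at hcoeff
  exact (mul_eq_zero.1 hcoeff).resolve_right (B.vertexCoeff_unit_ne_zero y _)

theorem eq_one_of_deform_eq_inner
    (hT : ∀ x : V → kˣ, (∀ α ∈ T, x (D.tgt α) = x (D.src α)) → ∀ a b, x a = x b)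
    (ht : ∀ α ∈ T, t α = 1) : t = 1 := by
  have hmul := B.mul_vertexCoeff_src_of_deform_eq_inner h
  have hconst (a b : V) : B.vertexCoeff a y = B.vertexCoeff b y := congrArg Units.val <|
    hT (fun a => Units.mk0 _ (B.vertexCoeff_unit_ne_zero y a)) (fun α hα => Units.ext <| by
      rw [Units.val_mk0, ← hmul, ht α hα, Units.val_one, one_mul, Units.val_mk0]) a b
  funext α
  refine Units.ext (mul_right_cancel₀ (B.vertexCoeff_unit_ne_zero y (D.src α)) ?_)
  rw [hmul, Pi.one_apply, Units.val_one, one_mul, hconst]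

end Injectivity

variable (T) in
/-- The action of the semidirect product by endomorphisms of the algebra. -/
def deformHom : TorusVector (D.detourChar (k := k) T) →* (A →ₐ[k] A) where
  toFun x := B.deform (extendVec x.vec) (extendTor T x.tor)
  map_one' := by
    rw [TorusVector.one_vec, TorusVector.one_tor, map_one]
    refine Eq.trans ?_ B.deform_one
    exact B.deform_congr fun α hα => extendVec_apply 0 hα
  map_mul' x y := by
    rw [TorusVector.mul_tor, map_mul]
    refine (B.deform_comp_deform fun α hα => ?_).symm
    rw [extendVec_apply _ hα, extendVec_apply _ hα, extendVec_apply _ hα, TorusVector.mul_vec]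
    rfl

variable (T) in
/-- The action of the semidirect product by automorphisms of the algebra. -/
def param : TorusVector (D.detourChar (k := k) T) →* (A ≃ₐ[k] A) :=
  (AlgEquiv.algHomUnitsEquiv k A).toMonoidHom.comp (B.deformHom T).toHomUnits

theorem param_apply (x : TorusVector (D.detourChar (k := k) T)) (y : A) :
    B.param T x y = B.deform (extendVec x.vec) (extendTor T x.tor) y := rfl

theorem eq_one_of_param_mem_inn {x : TorusVector (D.detourChar (k := k) T)}
    (hT : ∀ x : V → kˣ, (∀ α ∈ T, x (D.tgt α) = x (D.src α)) → ∀ a b, x a = x b)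
    (hx : B.param T x ∈ Inn k A) : x = 1 := by
  obtain ⟨y, hy⟩ := exists_eq_inner hx
  have hdeform (z : A) := (B.param_apply x z).symm.trans (DFunLike.congr_fun hy z)
  have htor : extendTor T x.tor = 1 :=
    B.eq_one_of_deform_eq_inner hdeform hT fun α => extendTor_apply_of_mem x.tor
  refine TorusVector.ext (funext fun α => ?_) (funext fun α => ?_)
  · rw [← extendVec_apply x.vec α.2]
    exact B.eq_zero_of_deform_eq_inner hdeform α.2 (congrFun htor α)
  · rw [← extendTor_apply_of_notMem x.tor α.2]
    exact congrFun htor α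

variable {s : V → (E → kˣ) → kˣ}

variable (T s) in
/-- The parameters of the normal form of an automorphism, where `s` is a potential for the spanning
tree `T`. -/
def normalParam (f : A ≃ₐ[k] A) : TorusVector (D.detourChar (k := k) T) where
  vec α := B.normalVec f α
  tor α := B.normalTor f α * D.coboundary (fun a => s a (B.normalTor f)) α

variable {B} in
theorem Neutral.exists_inner_mul_eq_param [Finite E] {f : A ≃ₐ[k] A}
    (hs : ∀ α ∈ T, ∀ t, t α * D.coboundary (fun a => s a t) α = 1) (hf : B.Neutral f) :
    ∃ x : Aˣ, inner k x * f = B.param T (B.normalParam T s f) := by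
  obtain ⟨x, hx⟩ := hf.exists_inner_mul_eq_deform
  set z : V → kˣ := fun a => s a (B.normalTor f)
  have htor : extendTor T (B.normalParam T s f).tor = B.normalTor f * D.coboundary z :=
    extendTor_restrict fun α hα => hs α hα _
  have hdeform : B.deform (extendVec (B.normalParam T s f).vec) (B.normalTor f * D.coboundary z) =
      B.deform (B.normalVec f) (B.normalTor f * D.coboundary z) :=
    B.deform_congr fun α hα => extendVec_apply _ hα
  refine ⟨B.vertexUnit z * x, AlgEquiv.ext fun y => ?_⟩
  rw [param_apply, htor, hdeform, ← inner_vertexUnit_comp_deform, ← hx, inner_mul, mul_assoc]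
  rfl

end PathBasis

/-! ## Regularity of the parametrization and of the normal form -/

section HasRegularCoords

variable {X k A : Type*} [Field k] [Ring A] [Algebra k A] {R : Subalgebra k (X → k)}

variable (R) in
/-- The map to the algebra `A` is regular: its coordinates belong to the algebra `R` of regular
functions. -/
def HasRegularCoords (g : X → A) : Prop := ∀ φ : A →ₗ[k] k, (fun x => φ (g x)) ∈ R

namespace HasRegularCoords

variable {g h : X → A}

theorem const (a : A) : HasRegularCoords R fun _ => a := fun φ => R.algebraMap_mem (φ a)

theorem add (hg : HasRegularCoords R g) (hh : HasRegularCoords R h) :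
    HasRegularCoords R fun x => g x + h x := fun φ => by
  simp only [map_add]
  exact add_mem (hg φ) (hh φ)

theorem sub (hg : HasRegularCoords R g) (hh : HasRegularCoords R h) :
    HasRegularCoords R fun x => g x - h x := fun φ => by
  simp only [map_sub]
  exact sub_mem (hg φ) (hh φ)

theorem smul {c : X → k} (hc : c ∈ R) (hg : HasRegularCoords R g) :
    HasRegularCoords R fun x => c x • g x := fun φ => by
  simp only [map_smul, smul_eq_mul]
  exact mul_mem hc (hg φ)

theorem sum {ι : Type*} {s : Finset ι} {g : ι → X → A} (hg : ∀ i ∈ s, HasRegularCoords R (g i)) :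
    HasRegularCoords R fun x => ∑ i ∈ s, g i x := fun φ => by
  have hsum : (fun x => φ (∑ i ∈ s, g i x)) = ∑ i ∈ s, fun x => φ (g i x) := by
    ext x
    rw [map_sum, Finset.sum_apply]
  exact hsum ▸ sum_mem fun i hi => hg i hi φ

theorem mul [Module.Finite k A] (hg : HasRegularCoords R g) (hh : HasRegularCoords R h) :
    HasRegularCoords R fun x => g x * h x := by
  let b := Module.finBasis k A
  have hexpand (x : X) :
      g x * h x = ∑ i, ∑ j, (b.coord i (g x) * b.coord j (h x)) • (b i * b j) := by
    conv_lhs => rw [← b.sum_repr (g x), ← b.sum_repr (h x), Finset.sum_mul_sum]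
    simp only [smul_mul_smul_comm, Module.Basis.coord_apply]
  simp only [hexpand]
  exact sum fun i _ => sum fun j _ => smul (mul_mem (hg _) (hh _)) (const _)

theorem pow [Module.Finite k A] (hg : HasRegularCoords R g) (n : ℕ) :
    HasRegularCoords R fun x => g x ^ n := by
  induction n with
  | zero => simpa only [pow_zero] using const 1
  | succ n ih => simpa only [pow_succ] using ih.mul hg

end HasRegularCoords

theorem hasRegularCoords_autRegular_apply (a : A) :
    HasRegularCoords (autRegular k A) fun f => f a :=
  fun φ => Algebra.subset_adjoin (Or.inl ⟨φ, a, rfl⟩)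

theorem hasRegularCoords_autRegular_inv_apply (a : A) :
    HasRegularCoords (autRegular k A) fun f => f⁻¹ a :=
  fun φ => Algebra.subset_adjoin (Or.inr ⟨φ, a, rfl⟩)

end HasRegularCoords

namespace PathBasis

open GentleDatum

variable {V E : Type*} [Fintype V] {D : GentleDatum V E} {k A : Type*} [Field k] [Ring A]
  [Algebra k A] (B : PathBasis D k A)

section Param

variable {T : Finset E}

theorem hasRegularCoords_of_vertex_of_word {X : Type*} {R : Subalgebra k (X → k)}
    {F : X → A →ₐ[k] A} (vertex : ∀ a, HasRegularCoords R fun x => F x (B.vertex a))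
    (word : ∀ l, D.Good l → HasRegularCoords R fun x => F x (B.word l)) (y : A) :
    HasRegularCoords R fun x => F x y := fun φ => by
  let L : A →ₗ[k] X → k := LinearMap.pi fun x => φ ∘ₗ (F x).toLinearMap
  suffices (Subalgebra.toSubmodule R).mkQ ∘ₗ L = 0 from
    (Submodule.Quotient.mk_eq_zero _).1 (LinearMap.congr_fun this y)
  exact B.hom_ext (fun a => (Submodule.Quotient.mk_eq_zero _).2 (vertex a φ))
    fun l hl => (Submodule.Quotient.mk_eq_zero _).2 (word l hl φ)

theorem hasRegularCoords_detourTerm (α : E) :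
    HasRegularCoords (TorusVector.regular (D.detourChar (k := k) T)) fun x =>
      B.detourTerm (extendVec x.vec) α := by
  by_cases hα : D.Movable α
  · simp only [B.detourTerm_of_movable hα, extendVec_apply _ hα]
    exact .smul (TorusVector.vec_mem_regular (χ := D.detourChar T) ⟨α, hα⟩) (.const _)
  · simp only [B.detourTerm_of_not_movable hα]
    exact .const 0

theorem hasRegularCoords_deform_word (l : List E) :
    HasRegularCoords (TorusVector.regular (D.detourChar (k := k) T)) fun x =>
      B.deform (extendVec x.vec) (extendTor T x.tor) (B.word l) := by
  have htor (α : E) : (fun x : TorusVector (D.detourChar T) => extendTor T x.tor α) ∈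
      regularUnits (TorusVector.regular (D.detourChar (k := k) T)) :=
    TorusVector.monomial_mem_regularUnits (extendTor_apply_mem_laurentMonomials α)
  by_cases hl : ∃ α, l = [α]
  · obtain ⟨α, rfl⟩ := hl
    simp only [deform_arrow]
    exact .smul (htor α).1 ((HasRegularCoords.const _).add (B.hasRegularCoords_detourTerm α))
  · simp only [B.deform_word_of_ne_singleton (not_exists.1 hl)]
    exact .smul (list_prod_map_mem htor l).1 (.const _)

theorem hasRegularCoords_param (y : A) :
    HasRegularCoords (TorusVector.regular (D.detourChar (k := k) T)) fun x => B.param T x y := by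
  refine B.hasRegularCoords_of_vertex_of_word (F := B.deformHom T) (fun a φ => ?_)
    (fun l _ => B.hasRegularCoords_deform_word l) y
  convert HasRegularCoords.const (B.vertex a) φ
  exact B.deform_vertex

theorem autRegular_le_comap_param :
    autRegular k A ≤ (TorusVector.regular (D.detourChar T)).comap (pullback k (B.param T)) := by
  refine Algebra.adjoin_le ?_
  rintro _ (⟨φ, y, rfl⟩ | ⟨φ, y, rfl⟩)
  · exact B.hasRegularCoords_param y φ
  · have hinv := TorusVector.regular_le_comap_inv (D.detourChar_mem_laurentMonomials (T := T))
      (B.hasRegularCoords_param y φ)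
    exact (congrArg (· ∈ TorusVector.regular _)
      (funext fun x => congrArg (fun f : A ≃ₐ[k] A => φ (f y)) (map_inv (B.param T) x))).mp hinv

end Param

section Normal

theorem moduleFinite [Finite E] (B : PathBasis D k A) : Module.Finite k A := by
  have : Finite {l // D.Good l} := D.finite_good
  exact Module.Finite.of_basis B.basis

theorem arrowCoeff_mem_autRegular (α β : E) :
    (fun f => B.arrowCoeff f α β) ∈ autRegular k A :=
  hasRegularCoords_autRegular_apply _ _

theorem arrowCoeff_inv_mem_autRegular (α β : E) :
    (fun f => B.arrowCoeff f⁻¹ α β) ∈ autRegular k A :=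
  hasRegularCoords_autRegular_inv_apply _ _

theorem hasRegularCoords_straighten [Finite E] (y : A) :
    HasRegularCoords (autRegular k A) fun f => B.straighten f y := by
  have := B.moduleFinite
  have htransport : HasRegularCoords (autRegular k A) B.transport :=
    .sum fun a _ => (hasRegularCoords_autRegular_apply _).mul (.const _)
  have htransportInv : HasRegularCoords (autRegular k A) B.transportInv :=
    .sum fun i _ => ((HasRegularCoords.const 1).sub htransport).pow i
  exact (htransportInv.mul (hasRegularCoords_autRegular_apply y)).mul htransport

theorem normalVec_mem_autRegular [Finite E] (α : E) :
    (fun f => B.normalVec f α) ∈ autRegular k A := by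
  have hstraighten := B.hasRegularCoords_straighten (B.word [α])
  have hinv := B.arrowCoeff_inv_mem_autRegular α α
  exact sub_mem (mul_mem (hstraighten _) hinv)
    (mul_mem (mul_mem ((autRegular k A).algebraMap_mem _) (mul_mem (hstraighten _) hinv))
      (mul_mem (hstraighten _) hinv))

theorem neutralIndicator_mem_autRegular [Fintype E] : B.neutralIndicator ∈ autRegular k A := by
  classical
  have hprod : B.neutralIndicator = (∏ a, fun f => B.vertexCoeff a (f (B.vertex a))) *
      ∏ α with ¬ D.Free α, fun f => B.arrowCoeff f α α * B.arrowCoeff f⁻¹ α α := by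
    ext f
    simp only [neutralIndicator, Pi.mul_apply, Finset.prod_apply]
  rw [hprod]
  exact mul_mem
    (prod_mem fun a _ => hasRegularCoords_autRegular_apply _ (B.vertexCoeff a).toLinearMap)
    (prod_mem fun α _ =>
      mul_mem (B.arrowCoeff_mem_autRegular α α) (B.arrowCoeff_inv_mem_autRegular α α))

end Normal

/-! ### The neutral automorphisms -/

section Neutral

theorem neutral_congr {f g : A ≃ₐ[k] A}
    (h : (QuotientGroup.mk f : Out k A) = QuotientGroup.mk g) : B.Neutral f ↔ B.Neutral g := by
  rw [QuotientGroup.eq_iff_div_mem] at h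
  obtain ⟨x, hx⟩ := exists_eq_inner h
  rw [← B.neutral_inner_mul (x := x) (f := g), ← hx, div_mul_cancel]

theorem neutral_one : B.Neutral (1 : A ≃ₐ[k] A) :=
  ⟨FixesVertices.one, fun α _ => by
    rw [arrowCoeff, AlgEquiv.one_apply, B.coeff_word_self (Good.singleton α)]
    exact one_ne_zero⟩

theorem isClopen_setOf_neutral [Finite E] :
    @IsClopen _ (zariskiTopology (autRegular k A)) {f | B.Neutral f} := by
  have := Fintype.ofFinite E
  have hone : {f | B.Neutral f} = {f | B.neutralIndicator f = 1} := by
    ext f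
    by_cases hf : B.Neutral f
    · simp [hf, B.neutralIndicator_of_neutral hf]
    · simp [hf, B.neutralIndicator_of_not_neutral hf]
  have hzero : {f | B.Neutral f} = {f | B.neutralIndicator f ≠ 0} := by
    ext f
    by_cases hf : B.Neutral f
    · simp [hf, B.neutralIndicator_of_neutral hf]
    · simp [hf, B.neutralIndicator_of_not_neutral hf]
  refine ⟨hone ▸ isClosed_zariski_setOf_eq B.neutralIndicator_mem_autRegular
    (one_mem (autRegular k A)), hzero ▸ ?_⟩
  exact TopologicalSpace.isOpen_generateFrom_of_mem ⟨_, B.neutralIndicator_mem_autRegular, rfl⟩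

theorem neutral_of_mk_mem_outNeutral [Finite E] {f : A ≃ₐ[k] A}
    (hf : (QuotientGroup.mk f : Out k A) ∈ OutNeutral k A) : B.Neutral f := by
  let := zariskiTopology (autRegular k A)
  let := outTopology k A
  let N : Set (Out k A) := QuotientGroup.mk '' {f | B.Neutral f}
  have hpreimage : QuotientGroup.mk ⁻¹' N = {f | B.Neutral f} := by
    ext f
    refine ⟨?_, fun h => ⟨f, h, rfl⟩⟩
    rintro ⟨g, hg, h⟩
    exact (B.neutral_congr h).1 hg
  have hquotient : IsQuotientMap (QuotientGroup.mk : (A ≃ₐ[k] A) → Out k A) :=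
    ⟨⟨rfl⟩, QuotientGroup.mk_surjective⟩
  have hclopen : IsClopen N := hquotient.isClopen_preimage.1 (hpreimage ▸ B.isClopen_setOf_neutral)
  have hone : (1 : Out k A) ∈ N := ⟨1, B.neutral_one, rfl⟩
  exact hpreimage.subset (hclopen.connectedComponent_subset hone hf)

end Neutral

end PathBasis

/-! ## The structure of the neutral component -/

namespace PathBasis

open GentleDatum

variable {V E : Type*} [Fintype V] {D : GentleDatum V E} {k A : Type*} [Field k] [Ring A]
  [Algebra k A] (B : PathBasis D k A) {T : Finset E} {s : V → (E → kˣ) → kˣ}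

theorem mk_param_mem_outNeutral [Infinite k] [Finite E]
    (x : TorusVector (D.detourChar (k := k) T)) :
    (QuotientGroup.mk (B.param T x) : Out k A) ∈ OutNeutral k A := by
  obtain ⟨S, hS, hone, hx⟩ := TorusVector.exists_isPreconnected_one_mem x
  let := zariskiTopology (TorusVector.regular (D.detourChar (k := k) T))
  let := zariskiTopology (autRegular k A)
  let := outTopology k A
  have hcont : Continuous fun x => (QuotientGroup.mk (B.param T x) : Out k A) :=
    (continuous_coinduced_rng (f := (QuotientGroup.mk : (A ≃ₐ[k] A) → Out k A))).comp
      (continuous_zariski B.autRegular_le_comap_param)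
  refine (hS.image _ hcont.continuousOn).subset_connectedComponent ⟨1, hone, ?_⟩ ⟨x, hx, rfl⟩
  exact congrArg QuotientGroup.mk (map_one (B.param T))

variable {B} in
theorem Neutral.mk_eq_mk_param [Finite E] {f : A ≃ₐ[k] A}
    (hs : ∀ α ∈ T, ∀ t, t α * D.coboundary (fun a => s a t) α = 1) (hf : B.Neutral f) :
    (QuotientGroup.mk f : Out k A) = QuotientGroup.mk (B.param T (B.normalParam T s f)) := by
  obtain ⟨x, hx⟩ := hf.exists_inner_mul_eq_param hs
  rw [eq_comm, ← hx, QuotientGroup.eq_iff_div_mem, mul_div_cancel_right]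
  exact inner_mem_inn x

theorem mk_mem_outNeutral_iff [Infinite k] [Finite E] [Nonempty V] {f : A ≃ₐ[k] A} :
    (QuotientGroup.mk f : Out k A) ∈ OutNeutral k A ↔ B.Neutral f := by
  refine ⟨B.neutral_of_mk_mem_outNeutral, fun hf => ?_⟩
  obtain ⟨T, hT⟩ := exists_isSubtree_univ D k
  obtain ⟨s, -, hs⟩ := hT.exists_potential
  exact hf.mk_eq_mk_param hs ▸ B.mk_param_mem_outNeutral _

section Regular

/-- The regular functions on the closed set of the neutral automorphisms. -/
def neutralRegular : Subalgebra k ({f // B.Neutral f} → k) :=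
  (autRegular k A).map (pullback k Subtype.val)

theorem mem_neutralRegular {F : (A ≃ₐ[k] A) → k} (hF : F ∈ autRegular k A) :
    (fun f : {f // B.Neutral f} => F f) ∈ B.neutralRegular := ⟨F, hF, rfl⟩

theorem normalTor_mem_regularUnits [Finite E] (α : E) :
    (fun f : {f // B.Neutral f} => B.normalTor f α) ∈ regularUnits B.neutralRegular := by
  refine ⟨?_, ?_⟩
  · simpa only [fun f : {f // B.Neutral f} => f.2.val_normalTor α] using
      B.mem_neutralRegular (B.arrowCoeff_mem_autRegular α α)
  · simpa only [fun f : {f // B.Neutral f} => f.2.val_normalTor_inv α] using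
      B.mem_neutralRegular (B.arrowCoeff_inv_mem_autRegular α α)

theorem regular_le_comap_normalParam [Finite E] (hs : ∀ a, s a ∈ laurentMonomials k E) :
    TorusVector.regular (D.detourChar T) ≤ B.neutralRegular.comap
      (pullback k fun f : {f // B.Neutral f} => B.normalParam T s f) := by
  have htor (α : E) : (fun f : {f // B.Neutral f} => B.normalTor f α *
      D.coboundary (fun a => s a (B.normalTor f)) α) ∈ regularUnits B.neutralRegular :=
    comp_mem_of_mem_laurentMonomials B.normalTor_mem_regularUnits
      (mul_mem (coord_mem_laurentMonomials α) (div_mem (hs (D.tgt α)) (hs (D.src α))))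
  exact TorusVector.regular_le_comap_pullback
    (fun α => B.mem_neutralRegular (B.normalVec_mem_autRegular α.1))
    (fun α => (htor α).1) fun α => (htor α).2

variable [Infinite k] [Finite E] [Nonempty V]

/-- The projection from the neutral automorphisms to the neutral component of the group of outer
automorphisms. -/
def toOutNeutral (f : {f // B.Neutral f}) : OutNeutral k A :=
  ⟨QuotientGroup.mk f.1, B.mk_mem_outNeutral_iff.2 f.2⟩

theorem toOutNeutral_surjective : Function.Surjective B.toOutNeutral := by
  rintro ⟨y, hy⟩
  obtain ⟨f, rfl⟩ := QuotientGroup.mk_surjective y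
  exact ⟨⟨f, B.mk_mem_outNeutral_iff.1 hy⟩, rfl⟩

/- The neutral automorphisms form an open and closed set, so that a regular function on them extends
by zero to a regular function on all automorphisms. -/
theorem comap_toOutNeutral_le_outNeutralRegular :
    B.neutralRegular.comap (pullback k B.toOutNeutral) ≤ outNeutralRegular k A := by
  classical
  have := Fintype.ofFinite E
  rintro F ⟨G, hG, hGF⟩
  refine ⟨fun y => if hy : y ∈ OutNeutral k A then F ⟨y, hy⟩ else 0, ?_,
    funext fun y => dif_pos y.2⟩
  suffices hF : (fun f : A ≃ₐ[k] A => if hf : (QuotientGroup.mk f : Out k A) ∈ OutNeutral k A then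
      F ⟨_, hf⟩ else 0) = B.neutralIndicator * G from
    Set.mem_of_eq_of_mem (s := autRegular k A) hF (mul_mem B.neutralIndicator_mem_autRegular hG)
  ext f
  by_cases hf : B.Neutral f
  · rw [dif_pos (B.mk_mem_outNeutral_iff.2 hf), Pi.mul_apply, B.neutralIndicator_of_neutral hf,
      one_mul]
    exact (congrFun hGF ⟨f, hf⟩).symm
  · rw [dif_neg (B.mk_mem_outNeutral_iff.not.2 hf), Pi.mul_apply,
      B.neutralIndicator_of_not_neutral hf, zero_mul]

end Regular

section Equiv

variable [Infinite k] [Finite E]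

variable (T) in
/-- The homomorphism to the neutral component of the group of outer automorphisms that is induced by
`param`. -/
def outNeutralHom : TorusVector (D.detourChar (k := k) T) →* OutNeutral k A :=
  ((QuotientGroup.mk' (Inn k A)).comp (B.param T)).codRestrict _ B.mk_param_mem_outNeutral

theorem outNeutralRegular_le_comap_outNeutralHom :
    outNeutralRegular k A ≤
      (TorusVector.regular (D.detourChar T)).comap (pullback k (B.outNeutralHom T)) := by
  rintro _ ⟨F, hF, rfl⟩
  have hmem : pullback k (B.param T) (pullback k QuotientGroup.mk F) ∈
      TorusVector.regular (D.detourChar T) := B.autRegular_le_comap_param hF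
  exact hmem

variable [Nonempty V]

theorem outNeutralHom_normalParam
    (hs : ∀ α ∈ T, ∀ t, t α * D.coboundary (fun a => s a t) α = 1) (f : {f // B.Neutral f}) :
    B.outNeutralHom T (B.normalParam T s f) = B.toOutNeutral f :=
  Subtype.ext (f.2.mk_eq_mk_param hs).symm

variable (hT : D.IsSubtree k Finset.univ T)
include hT

theorem bijective_outNeutralHom : Function.Bijective (B.outNeutralHom T) := by
  refine ⟨(injective_iff_map_eq_one _).2 fun x hx => ?_, fun y => ?_⟩
  · refine B.eq_one_of_param_mem_inn
      (fun x hx a b => hT.eq_of_mem x hx a (Finset.mem_univ a) b (Finset.mem_univ b)) ?_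
    exact (QuotientGroup.eq_one_iff _).1 (congrArg Subtype.val hx)
  · obtain ⟨s, -, hs⟩ := hT.exists_potential
    obtain ⟨f, rfl⟩ := B.toOutNeutral_surjective y
    exact ⟨_, B.outNeutralHom_normalParam hs f⟩

/-- The isomorphism from the neutral component of the group of outer automorphisms to the semidirect
product, for a spanning tree `T`. -/
def outNeutralEquiv : OutNeutral k A ≃* TorusVector (D.detourChar (k := k) T) :=
  (MulEquiv.ofBijective (B.outNeutralHom T) (B.bijective_outNeutralHom hT)).symm

theorem isRegularIso_outNeutralEquiv :
    IsRegularIso (outNeutralRegular k A) (TorusVector.regular (D.detourChar T))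
      (B.outNeutralEquiv hT) := by
  obtain ⟨s, hs, hs'⟩ := hT.exists_potential
  have hsymm (x) : B.outNeutralEquiv hT (B.outNeutralHom T x) = x :=
    MulEquiv.symm_apply_apply (MulEquiv.ofBijective _ (B.bijective_outNeutralHom hT)) x
  refine fun F => ⟨fun hF => B.comap_toOutNeutral_le_outNeutralRegular ?_, fun hF => ?_⟩
  · have hcomp : (fun f => F (B.outNeutralEquiv hT (B.toOutNeutral f))) =
        fun f : {f // B.Neutral f} => F (B.normalParam T s f) :=
      funext fun f => by rw [← B.outNeutralHom_normalParam hs', hsymm]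
    exact Set.mem_of_eq_of_mem (s := B.neutralRegular) hcomp (B.regular_le_comap_normalParam hs hF)
  · have hcomp : (fun x => F (B.outNeutralEquiv hT (B.outNeutralHom T x))) = F :=
      funext fun x => by rw [hsymm]
    exact hcomp ▸ B.outNeutralRegular_le_comap_outNeutralHom hF

end Equiv

end PathBasis

/-! ## The combinatorial datum of a gentle quiver -/

/-- The type of all arrows of a quiver. -/
abbrev QArrow (V : Type u) [Quiver.{v} V] : Type (max u v) := Σ a b : V, a ⟶ b

section Words

variable {V : Type u} [Quiver.{v} V] {P : Set (QPath V)} {a b c : V}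

variable (P) in
/-- The path `β α` (first `α`, then `β`) is defined and not a relation. -/
inductive NonRel : QArrow V → QArrow V → Prop
  | mk {a b c : V} (α : a ⟶ b) (β : b ⟶ c) (h : twoPath α β ∉ P) : NonRel ⟨b, c, β⟩ ⟨a, b, α⟩

theorem nonRel_iff {α : a ⟶ b} {β : b ⟶ c} : NonRel P ⟨b, c, β⟩ ⟨a, b, α⟩ ↔ twoPath α β ∉ P :=
  ⟨fun h => by cases h with | mk _ _ h => exact h, fun h => .mk α β h⟩

theorem NonRel.tgt_eq_src {β α : QArrow V} (h : NonRel P β α) : α.2.1 = β.1 := by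
  cases h
  rfl

theorem exists_eq_twoPath {p : QPath V} (h : p.2.2.length = 2) :
    ∃ (a b c : V) (α : a ⟶ b) (β : b ⟶ c), p = twoPath α β := by
  obtain ⟨a, c, _ | ⟨_ | ⟨_ | _, α⟩, β⟩⟩ := p
  · simp at h
  · simp at h
  · exact ⟨_, _, _, α, β, rfl⟩
  · simp at h

/-- The arrows of a path, the last one first. -/
def pathWord {a : V} : ∀ {b : V}, Path a b → List (QArrow V)
  | _, Path.nil => []
  | _, Path.cons p e => ⟨_, _, e⟩ :: pathWord p

@[simp] theorem pathWord_nil (a : V) : pathWord (Path.nil : Path a a) = [] := rfl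

@[simp] theorem pathWord_cons (p : Path a b) (e : b ⟶ c) :
    pathWord (p.cons e) = ⟨b, c, e⟩ :: pathWord p := rfl

@[simp] theorem pathWord_comp (p : Path a b) (q : Path b c) :
    pathWord (p.comp q) = pathWord q ++ pathWord p := by
  induction q with
  | nil => rfl
  | cons q e ih => simp [ih]

theorem length_pathWord (p : Path a b) : (pathWord p).length = p.length := by
  induction p with
  | nil => rfl
  | cons p e ih => simp [ih]

theorem eq_nil_of_pathWord_eq_nil {p : QPath V} (h : pathWord p.2.2 = []) :
    p = ⟨p.1, p.1, Path.nil⟩ := by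
  obtain ⟨a, b, _ | ⟨p, e⟩⟩ := p
  · rfl
  · simp at h

theorem exists_head?_pathWord {p : Path a b} (h : pathWord p ≠ []) :
    ∃ α, (pathWord p).head? = some α ∧ α.2.1 = b := by
  cases p with
  | nil => exact absurd rfl h
  | cons p e => exact ⟨_, rfl, rfl⟩

theorem exists_getLast?_pathWord {p : Path a b} (h : pathWord p ≠ []) :
    ∃ α, (pathWord p).getLast? = some α ∧ α.1 = a := by
  induction p with
  | nil => exact absurd rfl h
  | cons p e ih =>
    cases p with
    | nil => exact ⟨_, rfl, rfl⟩
    | cons p e' =>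
      rw [pathWord_cons, pathWord_cons, List.getLast?_cons_cons]
      exact ih (List.cons_ne_nil _ _)

theorem pathWord_injective {p : Path a c} {q : Path b c} (h : pathWord p = pathWord q) :
    (⟨a, c, p⟩ : QPath V) = ⟨b, c, q⟩ := by
  induction p generalizing b with
  | nil =>
    cases q with
    | nil => rfl
    | cons q e => simp at h
  | cons p e ih =>
    cases q with
    | nil => simp at h
    | cons q e' =>
      rw [pathWord_cons, pathWord_cons, List.cons.injEq] at h
      obtain ⟨harrow, hword⟩ := h
      cases harrow
      cases ih hword
      rfl

theorem eq_of_pathWord_eq {p q : QPath V} (hp : pathWord p.2.2 ≠ [])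
    (h : pathWord p.2.2 = pathWord q.2.2) : p = q := by
  obtain ⟨α, hα, hαp⟩ := exists_head?_pathWord hp
  obtain ⟨β, hβ, hβq⟩ := exists_head?_pathWord (h ▸ hp)
  obtain rfl : α = β := Option.some.inj (hα.symm.trans ((congrArg List.head? h).trans hβ))
  obtain ⟨a, b, p⟩ := p
  obtain ⟨a', b', q⟩ := q
  obtain rfl : b = b' := hαp.symm.trans hβq
  exact pathWord_injective h

theorem exists_pathWord_eq {l : List (QArrow V)} (hl : l ≠ []) (h : l.IsChain (NonRel P)) :
    ∃ q : QPath V, pathWord q.2.2 = l := by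
  induction l with
  | nil => exact absurd rfl hl
  | cons β l ih =>
    obtain _ | ⟨α, l⟩ := l
    · exact ⟨⟨β.1, β.2.1, Path.nil.cons β.2.2⟩, rfl⟩
    obtain ⟨hβα, hchain⟩ := List.isChain_cons_cons.1 h
    obtain ⟨⟨a, b, q⟩, hq⟩ := ih (List.cons_ne_nil _ _) hchain
    dsimp only at hq
    obtain ⟨α', hα', hα'q⟩ := exists_head?_pathWord (hq ▸ List.cons_ne_nil α l)
    obtain rfl : α = α' := Option.some.inj ((congrArg List.head? hq).symm.trans hα')
    obtain rfl : β.1 = b := hβα.tgt_eq_src.symm.trans hα'q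
    exact ⟨⟨a, _, q.cons β.2.2⟩, congrArg (β :: ·) hq⟩

theorem not_isChain_pathWord_of_hasSubpathIn (hP : ∀ p ∈ P, p.2.2.length = 2) {p : Path a b}
    (h : HasSubpathIn P p) : ¬ (pathWord p).IsChain (NonRel P) := by
  obtain ⟨c, d, x, y, z, rfl, hy⟩ := h
  obtain ⟨_, _, _, α, β, hαβ⟩ := exists_eq_twoPath (hP _ hy)
  rw [hαβ] at hy
  cases hαβ
  intro hchain
  rw [pathWord_comp, pathWord_comp] at hchain
  exact nonRel_iff.1
    (List.isChain_cons_cons.1 hchain.right_of_append.left_of_append).1 hy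

theorem hasSubpathIn_of_not_isChain_pathWord {p : Path a b}
    (h : ¬ (pathWord p).IsChain (NonRel P)) : HasSubpathIn P p := by
  induction p with
  | nil => exact absurd List.isChain_nil h
  | cons p β ih =>
    by_cases hp : (pathWord p).IsChain (NonRel P)
    · cases p with
      | nil => exact absurd (List.isChain_singleton _) h
      | cons p α =>
        have hrel : ¬ NonRel P ⟨_, _, β⟩ ⟨_, _, α⟩ := fun hβα =>
          h (List.isChain_cons_cons.2 ⟨hβα, hp⟩)
        exact ⟨_, _, p, α.toPath.comp β.toPath, Path.nil, rfl, not_not.1 (nonRel_iff.not.1 hrel)⟩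
    · obtain ⟨c, d, x, y, z, rfl, hy⟩ := ih hp
      exact ⟨c, d, x, y, z.cons β, rfl, hy⟩

end Words

theorem eq_or_eq_or_eq_of_mk_le_two {X : Type*} (h : Cardinal.mk X ≤ 2) (x y z : X) :
    x = y ∨ x = z ∨ y = z := by
  classical
  by_contra! hne
  have hcard : ({x, y, z} : Finset X).card = 3 := Finset.card_eq_three.2 ⟨x, y, z, by simp [hne]⟩
  have hle := (Cardinal.card_le_of_finset {x, y, z}).trans h
  rw [hcard] at hle
  norm_num at hle

theorem QuiverConnected.eq_univ {V : Type u} [Quiver.{v} V] (h : QuiverConnected V) {W : Set V}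
    (hne : W.Nonempty) (hW : ∀ α : QArrow V, α.1 ∈ W ↔ α.2.1 ∈ W) : W = Set.univ := by
  obtain ⟨a, ha⟩ := hne
  refine Set.eq_univ_of_forall fun b => ?_
  obtain ⟨p⟩ := h.2 a b
  induction p with
  | nil => exact ha
  | cons _ e ih =>
    obtain e | e := e
    · exact (hW ⟨_, _, e⟩).1 ih
    · exact (hW ⟨_, _, e⟩).2 ih

namespace IsGentle

variable {V : Type u} [Quiver.{v} V] {P : Set (QPath V)} (hP : IsGentle P)
include hP

theorem finite_arrows [Finite V] : Finite (QArrow V) :=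
  have (a : V) : Finite (Σ b : V, a ⟶ b) :=
    Cardinal.lt_aleph0_iff_finite.1 ((hP.card_out a).trans_lt (Cardinal.natCast_lt_aleph0 (n := 2)))
  inferInstance

theorem nonRel_right_unique {β α α' : QArrow V} (h : NonRel P β α) (h' : NonRel P β α') :
    α = α' := by
  cases h with
  | mk α β h =>
    cases h' with
    | mk α' _ h' =>
      cases hP.pred_not_mem β (x := ⟨_, α⟩) h (y := ⟨_, α'⟩) h'
      rfl

theorem nonRel_left_unique {β β' α : QArrow V} (h : NonRel P β α) (h' : NonRel P β' α) :
    β = β' := by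
  cases h with
  | mk α β h =>
    cases h' with
    | mk _ β' h' =>
      cases hP.succ_not_mem α (x := ⟨_, β⟩) h (y := ⟨_, β'⟩) h'
      rfl

theorem rel_right_unique {β α α' : QArrow V} (hα : α.2.1 = β.1) (h : ¬ NonRel P β α)
    (hα' : α'.2.1 = β.1) (h' : ¬ NonRel P β α') : α = α' := by
  obtain ⟨b, c, β⟩ := β
  obtain ⟨a, _, α⟩ := α
  obtain ⟨a', _, α'⟩ := α'
  obtain rfl := hα
  obtain rfl := hα'
  rw [nonRel_iff, not_not] at h h'
  cases hP.pred_mem β (x := ⟨_, α⟩) h (y := ⟨_, α'⟩) h'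
  rfl

theorem rel_left_unique {β β' α : QArrow V} (hβ : α.2.1 = β.1) (h : ¬ NonRel P β α)
    (hβ' : α.2.1 = β'.1) (h' : ¬ NonRel P β' α) : β = β' := by
  obtain ⟨a, b, α⟩ := α
  obtain ⟨_, c, β⟩ := β
  obtain ⟨_, c', β'⟩ := β'
  obtain rfl := hβ
  obtain rfl := hβ'
  rw [nonRel_iff, not_not] at h h'
  cases hP.succ_mem α (x := ⟨_, β⟩) h (y := ⟨_, β'⟩) h'
  rfl

theorem exists_length_le [Finite (QArrow V)] :
    ∃ L : ℕ, ∀ l : List (QArrow V), l.IsChain (NonRel P) → l.length ≤ L := by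
  have := Fintype.ofFinite (QArrow V)
  choose n hn using fun β : QArrow V => hP.bounded β.2.2
  refine ⟨Finset.univ.sup n, fun l hl => ?_⟩
  obtain rfl | hne := eq_or_ne l []
  · exact Nat.zero_le _
  obtain ⟨⟨a, b, _ | ⟨q, e⟩⟩, rfl⟩ := exists_pathWord_eq hne hl
  · exact absurd rfl hne
  by_contra! hlt
  rw [length_pathWord] at hlt
  have hle : n ⟨_, _, e⟩ ≤ (q.cons e).length := (Finset.le_sup (Finset.mem_univ _)).trans hlt.le
  exact not_isChain_pathWord_of_hasSubpathIn hP.length_two ((hn ⟨_, _, e⟩).1 _ q hle) hl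

theorem out_le_two {α β γ : QArrow V} (hβ : α.1 = β.1) (hγ : α.1 = γ.1) :
    α = β ∨ α = γ ∨ β = γ := by
  obtain ⟨a, α⟩ := α
  obtain ⟨_, β⟩ := β
  obtain ⟨_, γ⟩ := γ
  obtain rfl := hβ
  obtain rfl := hγ
  simpa using eq_or_eq_or_eq_of_mk_le_two (hP.card_out a) α β γ

theorem in_le_two {α β γ : QArrow V} (hβ : α.2.1 = β.2.1) (hγ : α.2.1 = γ.2.1) :
    α = β ∨ α = γ ∨ β = γ := by
  obtain ⟨a, b, α⟩ := α
  obtain ⟨a', _, β⟩ := β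
  obtain ⟨a'', _, γ⟩ := γ
  obtain rfl := hβ
  obtain rfl := hγ
  let f (x : Σ a : V, a ⟶ b) : QArrow V := ⟨x.1, b, x.2⟩
  exact (eq_or_eq_or_eq_of_mk_le_two (hP.card_in b) ⟨a, α⟩ ⟨a', β⟩ ⟨a'', γ⟩).imp
    (congrArg f) (Or.imp (congrArg f) (congrArg f))

variable (hconn : QuiverConnected V)
include hconn

theorem isKroneckerQuiver {a b : V} {α α' : a ⟶ b} (hne : α ≠ α')
    (hin : ∀ c, IsEmpty (c ⟶ a)) (hout : ∀ c, IsEmpty (b ⟶ c)) : IsKroneckerQuiver V := by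
  have hne' : (⟨a, b, α⟩ : QArrow V) ≠ ⟨a, b, α'⟩ := by simpa using hne
  have hsrc (β : QArrow V) (hβ : β.1 = a) : β = ⟨a, b, α⟩ ∨ β = ⟨a, b, α'⟩ :=
    ((hP.out_le_two (α := ⟨a, b, α⟩) (β := ⟨a, b, α'⟩) rfl hβ.symm).resolve_left hne').imp
      Eq.symm Eq.symm
  have htgt (β : QArrow V) (hβ : β.2.1 = b) : β = ⟨a, b, α⟩ ∨ β = ⟨a, b, α'⟩ :=
    ((hP.in_le_two (α := ⟨a, b, α⟩) (β := ⟨a, b, α'⟩) rfl hβ.symm).resolve_left hne').imp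
      Eq.symm Eq.symm
  have huniv : ({a, b} : Set V) = Set.univ := hconn.eq_univ ⟨a, Or.inl rfl⟩ fun β => by
    constructor
    · rintro (hβ | hβ)
      · obtain rfl | rfl := hsrc β hβ <;> exact Or.inr rfl
      · exact ((hout β.2.1).false (hβ ▸ β.2.2)).elim
    · rintro (hβ | hβ)
      · exact ((hin β.1).false (hβ ▸ β.2.2)).elim
      · obtain rfl | rfl := htgt β hβ <;> exact Or.inl rfl
  refine ⟨a, b, fun hab => (hin a).false (hab ▸ α), fun c => huniv.symm.subset (Set.mem_univ c),
    ?_, hin b, hin a, hout b⟩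
  refine Nat.card_eq_two_iff.2 ⟨α, α', hne, Set.eq_univ_of_forall fun β => ?_⟩
  simpa using hsrc ⟨a, b, β⟩ rfl

theorem eq_of_parallel (hK : ¬ IsKroneckerQuiver V) {α α' : QArrow V} (hs : α.1 = α'.1)
    (ht : α.2.1 = α'.2.1)
    (h : ∀ β : QArrow V, (β.2.1 = α.1 → NonRel P α β) ∧ (α.2.1 = β.1 → NonRel P β α))
    (h' : ∀ β : QArrow V, (β.2.1 = α'.1 → NonRel P α' β) ∧ (α'.2.1 = β.1 → NonRel P β α')) :
    α = α' := by
  by_contra hne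
  obtain ⟨a, b, α⟩ := α
  obtain ⟨a', b', α'⟩ := α'
  obtain rfl : a = a' := hs
  obtain rfl : b = b' := ht
  refine hK (hP.isKroneckerQuiver hconn (fun hαα' : α = α' => hne (by rw [hαα']))
    (fun c => ⟨fun β => ?_⟩) fun c => ⟨fun β => ?_⟩)
  · exact hne (hP.nonRel_left_unique ((h ⟨_, _, β⟩).1 rfl) ((h' ⟨_, _, β⟩).1 rfl))
  · exact hne (hP.nonRel_right_unique ((h ⟨_, _, β⟩).2 rfl) ((h' ⟨_, _, β⟩).2 rfl))

omit hP hconn in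
/-- The combinatorial datum of a connected gentle quiver that is not the Kronecker quiver. -/
def datum (hP : IsGentle P) (hconn : QuiverConnected V) (hK : ¬ IsKroneckerQuiver V)
    [Finite (QArrow V)] : GentleDatum V (QArrow V) where
  src α := α.1
  tgt α := α.2.1
  NonRel := NonRel P
  tgt_eq_src := NonRel.tgt_eq_src
  nonRel_right_unique := hP.nonRel_right_unique
  nonRel_left_unique := hP.nonRel_left_unique
  rel_right_unique := hP.rel_right_unique
  rel_left_unique := hP.rel_left_unique
  bounded := hP.exists_length_le
  out_le_two := hP.out_le_two
  in_le_two := hP.in_le_two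
  connected _ := hconn.eq_univ
  parallel_free := hP.eq_of_parallel hconn hK

end IsGentle

/-! ## The basis of paths of a gentle algebra -/

namespace PathAlgebra

variable {k : Type w} [Field k] {V : Type u} [Quiver.{v} V] {a b c : V}

theorem of_mul_of_comp (p : Path a b) (q : Path b c) :
    of k ⟨b, c, q⟩ * of k ⟨a, b, p⟩ = of k ⟨a, c, p.comp q⟩ := by
  rw [mul_eq, mulMap_of_of, pathMul_comp]

theorem of_mul_of_ne {q p : QPath V} (h : p.2.1 ≠ q.1) : of k q * of k p = 0 := by
  rw [mul_eq, mulMap_of_of, pathMul_ne h]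

variable [Fintype V]

theorem map_mul_mul_eq_zero {M : Type*} [AddCommGroup M] [Module k M] (f : PathAlgebra k V →ₗ[k] M)
    {x : PathAlgebra k V} (h : ∀ q r, f (of k q * x * of k r) = 0) (y z : PathAlgebra k V) :
    f (y * x * z) = 0 := by
  have hright (q : QPath V) : f ∘ₗ LinearMap.mulLeft k (of k q * x) = 0 := hom_ext fun r => h q r
  have hleft : f ∘ₗ LinearMap.mulRight k (x * z) = 0 :=
    hom_ext fun q => by simpa [mul_assoc] using LinearMap.congr_fun (hright q) z
  simpa [mul_assoc] using LinearMap.congr_fun hleft y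

end PathAlgebra

namespace QuiverAlgebra

open PathAlgebra

variable {k : Type w} [Field k] {V : Type u} [Quiver.{v} V] [Fintype V] {P : Set (QPath V)}

theorem of_mem_relIdeal {a b : V} {p : Path a b} (h : HasSubpathIn P p) :
    of k ⟨a, b, p⟩ ∈ relIdeal k P := by
  obtain ⟨c, d, x, y, z, rfl, hy⟩ := h
  rw [← of_mul_of_comp, ← of_mul_of_comp]
  exact TwoSidedIdeal.mul_mem_left _ _ _ (TwoSidedIdeal.mul_mem_right _ _ _
    (TwoSidedIdeal.subset_span ⟨_, hy, rfl⟩))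

variable (k P) in
/-- The class of a path in the quotient of the path algebra by the relations. -/
def pathClass (p : QPath V) : QuiverAlgebra k P := (relIdeal k P).ringCon.mkₐ k (of k p)

theorem mk_eq_zero_iff {x : PathAlgebra k V} :
    (relIdeal k P).ringCon.mkₐ k x = 0 ↔ x ∈ relIdeal k P := by
  rw [TwoSidedIdeal.mem_iff, ← RingCon.eq]
  rfl

theorem sum_pathClass_nil : ∑ a : V, pathClass k P ⟨a, a, Path.nil⟩ = 1 := by
  rw [← map_one ((relIdeal k P).ringCon.mkₐ k), one_eq, map_sum]
  rfl

theorem pathClass_mul_of_comp {a b c : V} (p : Path a b) (q : Path b c) :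
    pathClass k P ⟨b, c, q⟩ * pathClass k P ⟨a, b, p⟩ = pathClass k P ⟨a, c, p.comp q⟩ := by
  rw [pathClass, pathClass, ← map_mul, of_mul_of_comp]
  rfl

theorem pathClass_mul_of_ne {q p : QPath V} (h : p.2.1 ≠ q.1) :
    pathClass k P q * pathClass k P p = 0 := by
  rw [pathClass, pathClass, ← map_mul, of_mul_of_ne h, map_zero]

theorem nil_mul_pathClass (q : QPath V) :
    pathClass k P ⟨q.2.1, q.2.1, Path.nil⟩ * pathClass k P q = pathClass k P q := by
  obtain ⟨a, b, q⟩ := q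
  rw [pathClass_mul_of_comp, Path.comp_nil]

theorem pathClass_mul_nil (q : QPath V) :
    pathClass k P q * pathClass k P ⟨q.1, q.1, Path.nil⟩ = pathClass k P q := by
  obtain ⟨a, b, q⟩ := q
  rw [pathClass_mul_of_comp, Path.nil_comp]

theorem pathClass_eq_zero {p : QPath V} (h : ¬ (pathWord p.2.2).IsChain (NonRel P)) :
    pathClass k P p = 0 :=
  mk_eq_zero_iff.2 (of_mem_relIdeal (hasSubpathIn_of_not_isChain_pathWord h))

theorem pathClass_mul_of_not_isChain {q p : QPath V}
    (h : ¬ (pathWord q.2.2 ++ pathWord p.2.2).IsChain (NonRel P)) :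
    pathClass k P q * pathClass k P p = 0 := by
  obtain ⟨a, b, p⟩ := p
  obtain ⟨b', c, q⟩ := q
  obtain rfl | hb := eq_or_ne b b'
  · rw [pathClass_mul_of_comp]
    exact pathClass_eq_zero (by simpa only [pathWord_comp] using h)
  · exact pathClass_mul_of_ne hb

theorem pathClass_mul_of_isChain {q p r : QPath V} (hq : pathWord q.2.2 ≠ [])
    (hp : pathWord p.2.2 ≠ []) (hr : pathWord r.2.2 = pathWord q.2.2 ++ pathWord p.2.2)
    (h : (pathWord r.2.2).IsChain (NonRel P)) :
    pathClass k P q * pathClass k P p = pathClass k P r := by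
  obtain ⟨β, hβ, hβq⟩ := exists_getLast?_pathWord hq
  obtain ⟨α, hα, hαp⟩ := exists_head?_pathWord hp
  rw [hr] at h
  have hβα : NonRel P β α := (List.isChain_append.1 h).2.2 β hβ α hα
  obtain ⟨a, b, p⟩ := p
  obtain ⟨b', c, q⟩ := q
  obtain rfl : b = b' := hαp.symm.trans (hβα.tgt_eq_src.trans hβq)
  have hcomp : pathWord (p.comp q) = pathWord r.2.2 := (pathWord_comp p q).trans hr.symm
  have hne : pathWord (p.comp q) ≠ [] :=
    (pathWord_comp p q).symm ▸ List.append_ne_nil_of_left_ne_nil hq _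
  rw [pathClass_mul_of_comp, eq_of_pathWord_eq (p := ⟨a, c, p.comp q⟩) hne hcomp]

end QuiverAlgebra

namespace IsGentle

open PathAlgebra QuiverAlgebra

variable {V : Type u} [Quiver.{v} V] [Finite (QArrow V)]
  {P : Set (QPath V)} (hP : IsGentle P) (hconn : QuiverConnected V) (hK : ¬ IsKroneckerQuiver V)

/-- The path of a vertex or of a good word: the index set of the basis of the gentle algebra. -/
def basisPath : V ⊕ {l // (hP.datum hconn hK).Good l} → QPath V
  | Sum.inl a => ⟨a, a, Path.nil⟩
  | Sum.inr l => (exists_pathWord_eq l.2.1 l.2.2).choose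

theorem pathWord_basisPath (l : {l // (hP.datum hconn hK).Good l}) :
    pathWord (hP.basisPath hconn hK (Sum.inr l)).2.2 = l.1 :=
  (exists_pathWord_eq l.2.1 l.2.2).choose_spec

theorem pathWord_basisPath_ne_nil (l : {l // (hP.datum hconn hK).Good l}) :
    pathWord (hP.basisPath hconn hK (Sum.inr l)).2.2 ≠ [] :=
  hP.pathWord_basisPath hconn hK l ▸ l.2.1

theorem startsAt_iff (l : {l // (hP.datum hconn hK).Good l}) {a : V} :
    (hP.datum hconn hK).StartsAt l.1 a ↔ (hP.basisPath hconn hK (Sum.inr l)).1 = a := by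
  have hw := hP.pathWord_basisPath hconn hK l
  obtain ⟨α, hα, hsrc⟩ := exists_getLast?_pathWord (hP.pathWord_basisPath_ne_nil hconn hK l)
  rw [hw] at hα
  rw [GentleDatum.StartsAt, hα, ← hsrc]
  simp [datum]

theorem endsAt_iff (l : {l // (hP.datum hconn hK).Good l}) {a : V} :
    (hP.datum hconn hK).EndsAt l.1 a ↔ (hP.basisPath hconn hK (Sum.inr l)).2.1 = a := by
  have hw := hP.pathWord_basisPath hconn hK l
  obtain ⟨α, hα, htgt⟩ := exists_head?_pathWord (hP.pathWord_basisPath_ne_nil hconn hK l)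
  rw [hw] at hα
  rw [GentleDatum.EndsAt, hα, ← htgt]
  simp [datum]

variable {k : Type w} [Field k]

section Reduction

open Classical in
/-- The linear map from the path algebra that sends the paths without relations to the basis vectors
and the other paths to zero. -/
def reduction : PathAlgebra k V →ₗ[k] (V ⊕ {l // (hP.datum hconn hK).Good l}) →₀ k :=
  Finsupp.linearCombination k fun p =>
    if h : (hP.datum hconn hK).Good (pathWord p.2.2) then
      Finsupp.single (Sum.inr ⟨_, h⟩) 1
    else if pathWord p.2.2 = [] then Finsupp.single (Sum.inl p.1) 1 else 0

open Classical in
theorem reduction_of (p : QPath V) : hP.reduction (k := k) hconn hK (of k p) =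
    if h : (hP.datum hconn hK).Good (pathWord p.2.2) then
      Finsupp.single (Sum.inr ⟨_, h⟩) 1
    else if pathWord p.2.2 = [] then Finsupp.single (Sum.inl p.1) 1 else 0 :=
  (Finsupp.linearCombination_single k _ _).trans (one_smul k _)

theorem reduction_of_hasSubpathIn {a b : V} {p : Path a b} (h : HasSubpathIn P p) :
    hP.reduction (k := k) hconn hK (of k ⟨a, b, p⟩) = 0 := by
  have hchain := not_isChain_pathWord_of_hasSubpathIn hP.length_two h
  rw [reduction_of, dif_neg fun hgood => hchain hgood.2, if_neg]
  exact fun hnil : pathWord p = [] => hchain (hnil ▸ List.isChain_nil)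

theorem reduction_basisPath (i : V ⊕ {l // (hP.datum hconn hK).Good l}) :
    hP.reduction (k := k) hconn hK (of k (hP.basisPath hconn hK i)) = Finsupp.single i 1 := by
  rw [reduction_of]
  obtain a | l := i
  · exact (dif_neg fun h => h.1 rfl).trans (if_pos rfl)
  · have hw := hP.pathWord_basisPath hconn hK l
    rw [dif_pos (hw ▸ l.2)]
    exact congrArg (fun m => Finsupp.single (Sum.inr m) 1) (Subtype.ext hw)

variable [Fintype V]

theorem reduction_of_mem_relIdeal {x : PathAlgebra k V} (hx : x ∈ relIdeal k P) :
    hP.reduction (k := k) hconn hK x = 0 := by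
  rw [relIdeal, TwoSidedIdeal.mem_span_iff_mem_addSubgroup_closure] at hx
  induction hx using AddSubgroup.closure_induction with
  | mem x hx =>
    obtain ⟨_, ⟨y, -, _, ⟨⟨a, b, p⟩, hp, rfl⟩, rfl⟩, z, -, rfl⟩ := hx
    refine map_mul_mul_eq_zero _ (fun ⟨b', c, q⟩ ⟨d, a', r⟩ => ?_) y z
    obtain rfl | hb := eq_or_ne b b'
    · obtain rfl | ha := eq_or_ne a' a
      · rw [of_mul_of_comp, of_mul_of_comp, ← Path.comp_assoc]
        exact hP.reduction_of_hasSubpathIn hconn hK ⟨_, _, r, p, q, rfl, hp⟩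
      · rw [of_mul_of_comp, of_mul_of_ne ha, map_zero]
    · rw [of_mul_of_ne hb, zero_mul, map_zero]
  | zero => exact map_zero _
  | add x y _ _ hx hy => rw [map_add, hx, hy, add_zero]
  | neg x _ hx => rw [map_neg, hx, neg_zero]

end Reduction

variable [Fintype V]

theorem linearIndependent_pathClass :
    LinearIndependent k fun i => pathClass k P (hP.basisPath hconn hK i) := by
  rw [linearIndependent_iff]
  intro c hc
  have hmem : Finsupp.linearCombination k (fun i => of k (hP.basisPath hconn hK i)) c ∈
      relIdeal k P := by
    rw [← mk_eq_zero_iff, ← hc]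
    exact Finsupp.apply_linearCombination k ((relIdeal k P).ringCon.mkₐ k).toLinearMap _ c
  have hred := hP.reduction_of_mem_relIdeal hconn hK hmem
  rw [Finsupp.apply_linearCombination] at hred
  have hsingle : (hP.reduction (k := k) hconn hK ∘ fun i => of k (hP.basisPath hconn hK i)) =
      fun i => Finsupp.single i 1 := funext (hP.reduction_basisPath hconn hK)
  simpa [hsingle, Finsupp.linearCombination_apply] using hred

theorem pathClass_mem_span (p : QPath V) : pathClass k P p ∈
    Submodule.span k (Set.range fun i => pathClass k P (hP.basisPath hconn hK i)) := by
  by_cases hnil : pathWord p.2.2 = []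
  · rw [eq_nil_of_pathWord_eq_nil hnil]
    exact Submodule.subset_span ⟨Sum.inl p.1, rfl⟩
  by_cases hchain : (pathWord p.2.2).IsChain (NonRel P)
  · rw [eq_of_pathWord_eq hnil (hP.pathWord_basisPath hconn hK ⟨_, hnil, hchain⟩).symm]
    exact Submodule.subset_span ⟨_, rfl⟩
  · rw [pathClass_eq_zero hchain]
    exact zero_mem _

theorem span_pathClass :
    Submodule.span k (Set.range fun i => pathClass k P (hP.basisPath hconn hK i)) = ⊤ := by
  refine Submodule.eq_top_iff'.2 fun x => ?_
  obtain ⟨x, rfl⟩ := RingCon.mkₐ_surjective (α := k) _ x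
  have hzero : Submodule.mkQ (Submodule.span k
      (Set.range fun i => pathClass k P (hP.basisPath hconn hK i))) ∘ₗ
      ((relIdeal k P).ringCon.mkₐ k).toLinearMap = 0 :=
    hom_ext fun p => (Submodule.Quotient.mk_eq_zero _).2 (hP.pathClass_mem_span hconn hK p)
  exact (Submodule.Quotient.mk_eq_zero _).1 (LinearMap.congr_fun hzero x)

variable (k) in
/-- The basis of the gentle algebra that consists of the classes of the paths without relations. -/
def gentleBasis :
    Module.Basis (V ⊕ {l // (hP.datum hconn hK).Good l}) k (QuiverAlgebra k P) :=
  .mk (hP.linearIndependent_pathClass hconn hK) (hP.span_pathClass hconn hK).ge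

theorem gentleBasis_apply (i : V ⊕ {l // (hP.datum hconn hK).Good l}) :
    hP.gentleBasis hconn hK k i = pathClass k P (hP.basisPath hconn hK i) :=
  Module.Basis.mk_apply _ _ i

variable (k) in
/-- The basis `gentleBasis` with its multiplication table. -/
def pathBasis : PathBasis (hP.datum hconn hK) k (QuiverAlgebra k P) := by
  refine
    { basis := hP.gentleBasis hconn hK k
      sum_vertices := ?_
      vertex_mul_self := fun a => ?_
      vertex_mul_of_ne := fun a b h => ?_
      word_mul_word_of_good := fun l m h => ?_
      word_mul_word_of_not_good := fun l m h => ?_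
      vertex_mul_word := fun a l h => ?_
      vertex_mul_word_of_not := fun a l h => ?_
      word_mul_vertex := fun a l h => ?_
      word_mul_vertex_of_not := fun a l h => ?_ } <;> simp only [gentleBasis_apply]
  · exact sum_pathClass_nil
  · exact nil_mul_pathClass ⟨a, a, Path.nil⟩
  · exact pathClass_mul_of_ne h.symm
  · refine pathClass_mul_of_isChain (hP.pathWord_basisPath_ne_nil hconn hK l)
      (hP.pathWord_basisPath_ne_nil hconn hK m) ?_ ?_ <;> simp only [pathWord_basisPath]
    exact h.2
  · refine pathClass_mul_of_not_isChain fun hchain => h ?_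
    simp only [pathWord_basisPath] at hchain
    exact ⟨List.append_ne_nil_of_left_ne_nil l.2.1 _, hchain⟩
  · obtain rfl := (hP.endsAt_iff hconn hK l).1 h
    exact nil_mul_pathClass _
  · exact pathClass_mul_of_ne ((hP.endsAt_iff hconn hK l).not.1 h)
  · obtain rfl := (hP.startsAt_iff hconn hK l).1 h
    exact pathClass_mul_nil _
  · exact pathClass_mul_of_ne (Ne.symm ((hP.startsAt_iff hconn hK l).not.1 h))

end IsGentle

theorem nonempty_compl_equiv_fin_cycleNumber {V : Type u} [Quiver.{v} V] [Finite (QArrow V)]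
    {T : Finset (QArrow V)} (hT : Nat.card V = T.card + 1) :
    Nonempty ({α // α ∉ T} ≃ Fin (cycleNumber V)) := by
  classical
  have := Fintype.ofFinite (QArrow V)
  refine ⟨Finite.equivFinOfCardEq ?_⟩
  rw [cycleNumber, hT, Nat.card_eq_fintype_card, Nat.card_eq_fintype_card,
    Fintype.card_subtype_compl, Fintype.card_coe, Nat.add_sub_add_right]

end

theorem mainTheorem5_general {k : Type w} [Field k] [Infinite k]
    {V : Type u} [Fintype V] [Quiver.{v} V]
    (P : Set (QPath V)) (hP : IsGentle P) (hconn : QuiverConnected V)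
    (hK : ¬ IsKroneckerQuiver V) :
    (∃ (n : ℕ) (G : Subgroup (GL (Fin n) k)) (e : OutNeutral k (QuiverAlgebra k P) ≃* G),
      IsClosed[zariskiTopology (glRegular k n)] (G : Set (GL (Fin n) k)) ∧
      (∀ g ∈ G, ∀ i j : Fin n, i < j → (g : Matrix (Fin n) (Fin n) k) i j = 0) ∧
      IsRegularIso (outNeutralRegular k (QuiverAlgebra k P))
        (restrictRegular (glRegular k n) G) e) ∧
    (∃ S U : Subgroup (OutNeutral k (QuiverAlgebra k P)),
      IsMaximalTorusOfRank (outNeutralRegular k (QuiverAlgebra k P)) S (cycleNumber V) ∧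
      U.Normal ∧
      IsClosed[zariskiTopology (outNeutralRegular k (QuiverAlgebra k P))]
        (U : Set (OutNeutral k (QuiverAlgebra k P))) ∧
      Group.IsNilpotent U ∧
      S.IsComplement' U) := by
  have : Nonempty V := hconn.1
  have : Finite (QArrow V) := hP.finite_arrows
  let D := hP.datum hconn hK
  let B : PathBasis D k (QuiverAlgebra k P) := hP.pathBasis hconn hK k
  obtain ⟨T, hT⟩ := GentleDatum.exists_isSubtree_univ D k
  obtain ⟨s, -, hs⟩ := hT.exists_potential
  obtain ⟨σ⟩ := nonempty_compl_equiv_fin_cycleNumber (Nat.card_eq_fintype_card.trans hT.card_eq)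
  let E := B.outNeutralEquiv hT
  have hE := B.isRegularIso_outNeutralEquiv hT
  obtain ⟨n, G, e, hG, hlower, he⟩ :=
    TorusVector.exists_lowerTriangular_embedding
      (D.detourChar_mem_laurentMonomials (k := k) (T := T))
  exact ⟨⟨n, G, E.trans e, hG, hlower, hE.trans he⟩,
    TorusVector.torusSubgroup E, TorusVector.vectorSubgroup E,
    TorusVector.isMaximalTorusOfRank_torusSubgroup hE (GentleDatum.exists_detourChar_ne_one hs) σ,
    TorusVector.vectorSubgroup_normal E, TorusVector.isClosed_vectorSubgroup hE,
    TorusVector.isNilpotent_vectorSubgroup E,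
    TorusVector.isComplement'_torusSubgroup_vectorSubgroup E⟩

theorem mainTheorem5 {k : Type w} [Field k] [IsAlgClosed k]
    {V : Type u} [Fintype V] [Quiver.{v} V] [∀ a b : V, Finite (a ⟶ b)]
    (P : Set (QPath V)) (hP : IsGentle P) (hconn : QuiverConnected V)
    (hK : ¬ IsKroneckerQuiver V) :
    -- `Out°(A)` is isomorphic to an algebraic group of lower triangular invertible matrices
    (∃ (n : ℕ) (G : Subgroup (GL (Fin n) k)) (e : OutNeutral k (QuiverAlgebra k P) ≃* G),
      IsClosed[zariskiTopology (glRegular k n)] (G : Set (GL (Fin n) k)) ∧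
      (∀ g ∈ G, ∀ i j : Fin n, i < j → (g : Matrix (Fin n) (Fin n) k) i j = 0) ∧
      IsRegularIso (outNeutralRegular k (QuiverAlgebra k P))
        (restrictRegular (glRegular k n) G) e) ∧
    -- and is the semidirect product of a maximal torus `S ≅ (kˣ) ^ c(Q)` and a closed nilpotent
    -- normal subgroup `U`
    (∃ S U : Subgroup (OutNeutral k (QuiverAlgebra k P)),
      IsMaximalTorusOfRank (outNeutralRegular k (QuiverAlgebra k P)) S (cycleNumber V) ∧
      U.Normal ∧
      IsClosed[zariskiTopology (outNeutralRegular k (QuiverAlgebra k P))]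
        (U : Set (OutNeutral k (QuiverAlgebra k P))) ∧
      Group.IsNilpotent U ∧
      S.IsComplement' U) :=
  mainTheorem5_general P hP hconn hK
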